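/- Let $p$ be an odd prime, $\mathbf k=\overline{\mathbb F}_p$, $W=W(\mathbf k)$, $K=W[1/p]$. Let $\epsilon\in W$ be the Teichmüller lift of a non-square of $\mathbb F_p$ and $\lambda\in W$ with $\lambda^2=\epsilon$. Let $\sigma$ be the endomorphism of $K[[x,y,z]]$ that is the Frobenius on $K$ and sends $x,y,z$ to $x^p,y^p,z^p$, and for a matrix $M$ put $M^{[i]}=\sigma^i(M)$. Put $\beta_0=xy+\frac{z^2}{4\epsilon}$ and $$E=\beta_0\begin{bmatrix}1&-\frac1\lambda\\ \lambda&-1\end{bmatrix},\quad C=\begin{bmatrix}\frac x\lambda&\frac y\lambda&\frac z\lambda\\ x&y&z\end{bmatrix},\quad B=\begin{bmatrix}\lambda y&-y\\ \lambda x&-x\\ \frac{\lambda z}{2\epsilon}&-\frac z{2\epsilon}\end{bmatrix},\quad F=\begin{bmatrix}\frac1{2p}E&\frac1{2p}C\\ B&0\end{bmatrix}.$$ Let $P$ be a superspecial point of the moduli space $\mathcal A_{2,\mathbf k}$ of principally polarized abelian surfaces. Identify its formal neighbourhood with $\mathrm{Spf}\,\mathbf k[[x,y,z]]$ in the standard coordinates,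 in which $(I+F)\sigma$ is the Frobenius of the crystal of special endomorphisms in a basis $\omega_1,\dots,\omega_5$ of the $\mathbb Z_p$-lattice of special endomorphisms of the $p$-divisible group at $P$. *Deformation loci.* Let $\mathbf I,\mathbf J\subset\mathbb Z_{\ge0}$ be finite. Call $(\mathbf I,\mathbf J)$ admissible if $\mathbf I\cap\mathbf J=\emptyset$; each maximal block of consecutive elements of $\mathbf I\cup\mathbf J$ lying in $\mathbf I$ has even length, so that it splits into pairs of neighbours; and any two consecutive elements of $\mathbf I\cup\mathbf J$ that do not form such a pair have different parity. Call $(\mathbf I,\mathbf J,j)$ admissible if $(\mathbf I,\mathbf J)$ is, and $j>\max(\mathbf I\cup\mathbf J)$ has parity different from this maximum (no condition on $j$ if $\mathbf I=\mathbf J=\emptyset$). Put $|(\mathbf I,\mathbf J)|=\#\mathbf J+\#\mathbf I/2$ and $|(\mathbf I,\mathbf J,j)|=1+\#\mathbf J+\#\mathbf I/2$. Let $A^{(\mathbf I,\mathbf J)}$ be the product, over the elements of $\mathbf I\cup\mathbf J$ in increasing order, of $E^{[j]}$ for $j\in\mathbf J$ and of $C^{[i]}B^{[i']}$ for each pair $i<i'$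 in $\mathbf I$; and put $A^{(\mathbf I,\mathbf J,j)}=A^{(\mathbf I,\mathbf J)}C^{[j]}$. For $n\ge1$ let $X_{n,\mathrm{even}}=\sum A^{(\mathbf I,\mathbf J)}$ and $Y_{n,\mathrm{even}}=\sum A^{(\mathbf I,\mathbf J,j)}$ be the sums over the admissible systems of length $n$ whose smallest index is even, and let $G^1_{n,\mathrm{even}}(\omega_j)$ be the $j$-th entry of the first row of $2^{-n}[X_{n,\mathrm{even}}\;Y_{n,\mathrm{even}}]$. For $\omega=\sum_j a_j\omega_j$ with $a_j\in\mathbb Z_p$, write $a_j=\sum_{k\ge0}a_{j,k}p^k$ with $a_{j,k}$ Teichmüller lifts of elements of $\mathbb F_p$, and put $G^1_{n,\mathrm{even}}(\omega)=\sum_j\sum_k a_{j,k}G^1_{n+k,\mathrm{even}}(\omega_j)\in W[[x,y,z]]$. For $n\ge1$ let $\mathcal D_n(\omega)\subset\mathrm{Spf}\,\mathbf k[[x,y,z]]$ be the closed formal subscheme cut out by $G^1_{n,\mathrm{even}}(\omega)\bmod p$, and $\mathcal D(\omega)=\mathcal D_1(\omega)$. *Newton strata.* At a point $q$ of $\mathrm{Spec}\,\mathbf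 k[[x,y,z]]$, with $\Omega$ an algebraic closure of its residue field, consider the $F$-isocrystal over $\Omega$ with Frobenius $(I+F)\sigma$, in which $x,y,z$ are replaced by the Teichmüller lifts in $W(\Omega)$ of their images in $\Omega$. The point $q$ is non-ordinary if the slope $-1$ does not occur, and supersingular if all slopes are $0$. Let $\mathcal D_n^{AO}(\omega)$ be the intersection of $\mathcal D_n(\omega)$ with the non-ordinary locus. Reduced closed formal subschemes are identified with closed subsets of $\mathrm{Spec}\,\mathbf k[[x,y,z]]$; the subscript $\mathrm{red}$ is the induced reduced structure. **Statement.** For every special endomorphism $\omega=\sum_j a_j\omega_j\neq0$: 1. $\mathcal D(\omega)_{\mathrm{red}}\subsetneq\mathcal D(p\omega)_{\mathrm{red}}$. 2. $\mathcal D_1^{AO}(\omega)_{\mathrm{red}}\subseteq\mathcal D_1^{AO}(p\omega)_{\mathrm{red}}$, and the two agree up to supersingular components: $\mathcal D_1^{AO}(p\omega)_{\mathrm{red}}$ is the union of $\mathcal D_1^{AO}(\omega)_{\mathrm{red}}$ and some irreducible components of the supersingular locus. 3. For every $n\ge2$, $\mathcal D_n^{AO}(\omega)_{\mathrm{red}}=\mathcal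 D_n^{AO}(p\omega)_{\mathrm{red}}$, and this contains the whole reduced supersingular locus. -/

import Mathlib

open scoped Matrix

noncomputable section

namespace Superspecial

variable (p : ℕ) [Fact p.Prime]

/-- The residue field `𝐤`, an algebraic closure of `𝔽_p`. -/
abbrev BaseField : Type := AlgebraicClosure (ZMod p)

/-- The ring of Witt vectors `W` of `𝐤`. -/
abbrev W : Type := WittVector p (BaseField p)

/-- `W[[x,y,z]]`, the coordinate ring of the formal deformation space over `W`. -/
abbrev WXYZ : Type := MvPowerSeries (Fin 3) (W p)

/-- `𝐤[[x,y,z]]`, the coordinate ring of the geometric formal deformation space. -/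
abbrev KXYZ : Type := MvPowerSeries (Fin 3) (BaseField p)

/-- The Frobenius lift `σ` on `W[[x,y,z]]`: the Witt vector Frobenius on the coefficients, and
`x, y, z ↦ x^p, y^p, z^p`. -/
def sigma : WXYZ p →+* WXYZ p :=
  (MvPowerSeries.map (WittVector.frobenius (p := p) (R := BaseField p))).comp
    ((MvPowerSeries.expand p (Fact.out : p.Prime).ne_zero :
      WXYZ p →ₐ[W p] WXYZ p) : WXYZ p →+* WXYZ p)

/-- The reduction map `W[[x,y,z]] → 𝐤[[x,y,z]]` modulo `p`. -/
def modP : WXYZ p →+* KXYZ p :=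
  MvPowerSeries.map (WittVector.constantCoeff : W p →+* BaseField p)

/-! ### The Frobenius of the crystal of special endomorphisms

Everything in the following blocks is a polynomial in `x, y, z` with coefficients in `ℤ[1/2, λ, 1/λ]`,
and `ε = λ ^ 2`.  They are written over an arbitrary coefficient ring, since they are used both
over `W[[x,y,z]]` and at the points of its special fibre. -/

section Blocks

variable {A : Type*} [CommRing A] (lam x y z : A)

/-- `β = x y + z² / (4ε)`. -/
def beta : A := x * y + z ^ 2 * Ring.inverse (4 * lam ^ 2)

/-- The block `E`. -/
def blockE : Matrix (Fin 2) (Fin 2) A :=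
  beta lam x y z • !![1, -Ring.inverse lam; lam, -1]

/-- The block `C`. -/
def blockC : Matrix (Fin 2) (Fin 3) A :=
  !![x * Ring.inverse lam, y * Ring.inverse lam, z * Ring.inverse lam; x, y, z]

/-- The block `B`. -/
def blockB : Matrix (Fin 3) (Fin 2) A :=
  !![lam * y, -y; lam * x, -x;
    lam * z * Ring.inverse (2 * lam ^ 2), -(z * Ring.inverse (2 * lam ^ 2))]

/-- The matrix `p (I + F)`, where `F = [[E/(2p), C/(2p)], [B, 0]]`, i.e. `p` times the matrix of
the Frobenius of the crystal in the basis `ω₁, …, ω₅`. -/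
def frobMatrix (p : ℕ) : Matrix (Fin 2 ⊕ Fin 3) (Fin 2 ⊕ Fin 3) A :=
  (p : A) • 1 +
    Matrix.fromBlocks (Ring.inverse (2 : A) • blockE lam x y z)
      (Ring.inverse (2 : A) • blockC lam x y z) ((p : A) • blockB lam x y z) 0

end Blocks

/-! ### Admissible index systems -/

/-- `(I, J)` is admissible.  The number of elements of `I`, and the number of elements of `I` below
each element of `J`, is even: this says that the maximal blocks of `I ∪ J` that lie in `I` have
even length, so that the elements of `I` come in pairs of neighbours.  Two consecutive elements
`a < b` of `I ∪ J` have different parity, except when they form such a pair, that is when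
`a` is an element of `I` with an even number of elements of `I` below it. -/
def Admissible (I J : Finset ℕ) : Prop :=
  Disjoint I J ∧ Even I.card ∧ (∀ j ∈ J, Even (I.filter (· < j)).card) ∧
    ∀ a ∈ I ∪ J, ∀ b ∈ I ∪ J, a < b → (∀ c ∈ I ∪ J, ¬ (a < c ∧ c < b)) →
      (a ∈ I → Odd (I.filter (· < a)).card) → Odd (a + b)

/-- The triple `(I, J, j)` is admissible: `(I, J)` is admissible, and `j` exceeds `max (I ∪ J)` and
has different parity (no condition on `j` if `I` and `J` are empty). -/
def AdmissibleTriple (I J : Finset ℕ) (j : ℕ) : Prop :=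
  Admissible I J ∧ (∀ a ∈ I ∪ J, a < j) ∧
    ∀ a ∈ I ∪ J, (∀ b ∈ I ∪ J, b ≤ a) → Odd (a + j)

/-- The length `#J + #I / 2` of a pair. -/
def len (I J : Finset ℕ) : ℕ := J.card + I.card / 2

/-- The set `S` is nonempty and its minimum is even. -/
def MinEven (S : Finset ℕ) : Prop := ∃ s ∈ S, Even s ∧ ∀ t ∈ S, s ≤ t

/-- The admissible pairs of length `n` with even minimum. -/
def PairsEven (n : ℕ) : Type :=
  {S : Finset ℕ × Finset ℕ // Admissible S.1 S.2 ∧ len S.1 S.2 = n ∧ MinEven (S.1 ∪ S.2)}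

/-- The admissible triples of length `n` with even minimum. -/
def TriplesEven (n : ℕ) : Type :=
  {S : Finset ℕ × Finset ℕ × ℕ // AdmissibleTriple S.1 S.2.1 S.2.2 ∧
    1 + len S.1 S.2.1 = n ∧ MinEven (insert S.2.2 (S.1 ∪ S.2.1))}

/-! ### The series `G¹_{n,even}` -/

/-- The sum of a family of power series of which every monomial meets only finitely many. -/
def formalSum {ι : Type*} (f : ι → WXYZ p) : WXYZ p :=
  fun m => ∑ᶠ i, MvPowerSeries.coeff m (f i)

variable (lam : W p)

/-- The block `E^{[i]} = σ^i(E)` over `W[[x,y,z]]`. -/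
def twE (i : ℕ) : Matrix (Fin 2) (Fin 2) (WXYZ p) :=
  (blockE (MvPowerSeries.C lam) (MvPowerSeries.X 0) (MvPowerSeries.X 1)
    (MvPowerSeries.X 2)).map ((sigma p)^[i])

/-- The block `C^{[i]} = σ^i(C)` over `W[[x,y,z]]`. -/
def twC (i : ℕ) : Matrix (Fin 2) (Fin 3) (WXYZ p) :=
  (blockC (MvPowerSeries.C lam) (MvPowerSeries.X 0) (MvPowerSeries.X 1)
    (MvPowerSeries.X 2)).map ((sigma p)^[i])

/-- The block `B^{[i]} = σ^i(B)` over `W[[x,y,z]]`. -/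
def twB (i : ℕ) : Matrix (Fin 3) (Fin 2) (WXYZ p) :=
  (blockB (MvPowerSeries.C lam) (MvPowerSeries.X 0) (MvPowerSeries.X 1)
    (MvPowerSeries.X 2)).map ((sigma p)^[i])

open Classical in
/-- The factor of `A^{(I,J)}` at the index `s`: `E^{[s]}` if `s ∈ J`; if `s ∈ I`, it is `C^{[s]}`
or `B^{[s]}` according as `s` is the first or the second member of its pair. -/
def factor (I J : Finset ℕ) (s : ℕ) : Matrix (Fin 2 ⊕ Fin 3) (Fin 2 ⊕ Fin 3) (WXYZ p) :=
  if s ∈ J then Matrix.fromBlocks (twE p lam s) 0 0 0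
  else if Even (I.filter (· < s)).card then Matrix.fromBlocks 0 (twC p lam s) 0 0
  else Matrix.fromBlocks 0 0 (twB p lam s) 0

/-- The `2 × 2` matrix `A^{(I,J)}`, the product of the factors in increasing order of the indices
(the identity if `I` and `J` are empty). -/
def matA (I J : Finset ℕ) : Matrix (Fin 2) (Fin 2) (WXYZ p) :=
  ((((I ∪ J).sort (· ≤ ·)).map (factor p lam I J)).prod).toBlocks₁₁

/-- `X_{n,even} = ∑ A^{(I,J)}` over the admissible `(I,J)` of length `n` with even minimum. -/
def matX (n : ℕ) : Matrix (Fin 2) (Fin 2) (WXYZ p) := fun r c =>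
  formalSum p fun S : PairsEven n => matA p lam S.1.1 S.1.2 r c

/-- `Y_{n,even} = ∑ A^{(I,J)} C^{[j]}` over the admissible `(I,J,j)` of length `n` with even
minimum. -/
def matY (n : ℕ) : Matrix (Fin 2) (Fin 3) (WXYZ p) := fun r c =>
  formalSum p fun S : TriplesEven n =>
    (matA p lam S.1.1 S.1.2.1 * twC p lam S.1.2.2) r c

/-- The first row of `F_{n,even}`; its `j`-th entry is `G¹_{n,even}(ω_j)`. -/
def rowF (n : ℕ) : Fin 2 ⊕ Fin 3 → WXYZ p := fun j =>
  MvPowerSeries.C (Ring.inverse (2 : W p) ^ n) *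
    Sum.elim (fun c => matX p lam n 0 c) (fun c => matY p lam n 0 c) j

/-- The digit `a_k ∈ W` of `a ∈ ℤ_p`: the Teichmüller lift of an element of `𝔽_p`, with
`a = ∑ a_k p^k`. -/
def digit (a : ℤ_[p]) (k : ℕ) : W p :=
  WittVector.teichmuller p
    (algebraMap (ZMod p) (BaseField p) (((WittVector.equiv p).symm a).coeff k))

/-- `G¹_{n,even}(ω) = ∑_j ∑_k a_{j,k} G¹_{n+k,even}(ω_j)`, for the special endomorphism
`ω = ∑_j a_j ω_j` given by its coordinates `a_j ∈ ℤ_p`. -/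
def seriesG (n : ℕ) (ω : Fin 2 ⊕ Fin 3 → ℤ_[p]) : WXYZ p :=
  ∑ j, formalSum p fun k : ℕ => MvPowerSeries.C (digit p (ω j) k) * rowF p lam (n + k) j

/-! ### Supports

A reduced closed formal subscheme of `Spf 𝐤[[x,y,z]]` is a radical ideal of `𝐤[[x,y,z]]`, that is
a closed subset of the spectrum of this ring. -/

/-- The reduced support of the divisor `𝒟_n(ω)` generated by `G¹_{n,even}(ω)` modulo `p`. -/
def suppD (n : ℕ) (ω : Fin 2 ⊕ Fin 3 → ℤ_[p]) : Set (PrimeSpectrum (KXYZ p)) :=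
  PrimeSpectrum.zeroLocus {modP p (seriesG p lam n ω)}

/-! ### Newton strata

At a point `q` of the spectrum of `𝐤[[x,y,z]]` with algebraically closed field `Ω` over its residue
field, the `σ`-equivariant map `W[[x,y,z]] → W(Ω)` lifting `𝐤[[x,y,z]] → Ω` sends `x, y, z` to the
Teichmüller lifts of their images. The fibre of the crystal at `q` thus has Frobenius `φ` with
matrix obtained from `I + F` by substitution of these lifts. -/

/-- An algebraic closure of the residue field of a point. -/
abbrev GeomField (q : PrimeSpectrum (KXYZ p)) : Type := AlgebraicClosure q.asIdeal.ResidueField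

/-- The geometric point `𝐤[[x,y,z]] → Ω` over `q`. -/
def geomPoint (q : PrimeSpectrum (KXYZ p)) : KXYZ p →+* GeomField p q :=
  (algebraMap q.asIdeal.ResidueField (GeomField p q)).comp
    (algebraMap (KXYZ p) q.asIdeal.ResidueField)

/-- The Teichmüller lift of the value at `q` of the coordinate `i`. -/
def coordAt (q : PrimeSpectrum (KXYZ p)) (i : Fin 3) : WittVector p (GeomField p q) :=
  WittVector.teichmuller p (geomPoint p q (MvPowerSeries.X i))

/-- The matrix over `W(Ω)` of `p φ`, where `φ` is the Frobenius of the fibre at `q`. -/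
def frobAt (q : PrimeSpectrum (KXYZ p)) :
    Matrix (Fin 2 ⊕ Fin 3) (Fin 2 ⊕ Fin 3) (WittVector p (GeomField p q)) :=
  frobMatrix (WittVector.map ((geomPoint p q).comp MvPowerSeries.C) lam)
    (coordAt p q 0) (coordAt p q 1) (coordAt p q 2) p

/-- The matrix `T σ(T) ⋯ σ^{n-1}(T)` of the `n`-th iterate of the `σ`-linear map with matrix `T`. -/
def iterMatrix {Ω : Type*} [CommRing Ω] {ι : Type*} [Fintype ι] [DecidableEq ι]
    (T : Matrix ι ι (WittVector p Ω)) : ℕ → Matrix ι ι (WittVector p Ω)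
  | 0 => 1
  | n + 1 => T * (iterMatrix T n).map WittVector.frobenius

/-- All Newton slopes of the `F`-crystal over `W(Ω)` with Frobenius matrix `T` are `≥ ρ`: up to
a bounded power of `p`, the `n`-th iterate of the Frobenius is divisible by `p ^ ⌊ρ n⌋`. -/
def SlopesGE {Ω : Type*} [CommRing Ω] {ι : Type*} [Fintype ι] [DecidableEq ι]
    (T : Matrix ι ι (WittVector p Ω)) (ρ : ℚ) : Prop :=
  ∃ c : ℕ, ∀ n : ℕ, ∃ N : Matrix ι ι (WittVector p Ω),
    (p : WittVector p Ω) ^ c • iterMatrix p T n = (p : WittVector p Ω) ^ ⌊ρ * n⌋₊ • N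

/-- The non-ordinary locus.  The slopes of `p φ` at an ordinary point are `0, 1, 1, 1, 2`; a point
is non-ordinary when the slope `0` does not occur. -/
def nonOrdinary : Set (PrimeSpectrum (KXYZ p)) :=
  {q | ∃ ρ : ℚ, 0 < ρ ∧ SlopesGE p (frobAt p lam q) ρ}

/-- The supersingular locus: all slopes of `p φ` are `1`.  Since the crystal is self-dual, the
slopes are symmetric about `1`, so this says that they are all `≥ 1`. -/
def supersingular : Set (PrimeSpectrum (KXYZ p)) :=
  {q | SlopesGE p (frobAt p lam q) 1}

/-- The reduced support of `𝒟_n^{AO}(ω)`, the intersection of `𝒟_n(ω)` with the non-ordinary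
germ. -/
def suppDAO (n : ℕ) (ω : Fin 2 ⊕ Fin 3 → ℤ_[p]) : Set (PrimeSpectrum (KXYZ p)) :=
  suppD p lam n ω ∩ nonOrdinary p lam

/-- The irreducible components of a set of points, viewed as subsets. -/
def components {X : Type*} [TopologicalSpace X] (S : Set X) : Set (Set X) :=
  {C | Maximal (fun T : Set X => IsIrreducible T ∧ T ⊆ S) C}

end Superspecial

end

noncomputable section

namespace Superspecial

/-! ### A quadric in three variables -/

section

open MvPowerSeries

section Quadric
variable {k : Type*} [Field k]

/-! Write G_n for the series G¹_{n,even}(ω) modulo p, and Q_i for the pairing of (x, y, z) with its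
p^i-th power twist.

A recursion in n. A nonempty admissible system with even minimum 2r is a first block, either one
index 2r of J or a pair 2r < 2r + i of I, followed by the translate by 2r + i + 1 of a shorter
system of the same kind (`prependPair_bijective`, `prependTriple_bijective`). Each block gives a
matrix of rank one: a scalar times a twist of the column (1, λ) times a twist of the row (1, -1/λ).
As σ(λ) = -λ, the row of a block meets the column of the next one in 2, which cancels one factor
1/2. Modulo p the twist σ is the p-th power, so the sum over r telescopes, and for n ≥ 1 G_{n+1} -
G_{n+1}^{p²} = β G_n^p + ∑_{i>0} (-1)^i Q_i G_n^{p^{i+1}} (`isStep_rowF`). The digits of ω lie in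
𝔽_p, so the relation holds for every ω (`isStep_seriesG`). Multiplication by p shifts the digits, so
G_n(pω) = G_{n+1}(ω) (`modP_seriesG_p_smul`), and the theorem compares consecutive members of one
sequence.

Consequences. The left side is a unit times G_{n+1}. The right side is G_n^p (β + G_n t), which
gives the inclusion of supports. The form β is prime (`prime_quadric`) and does not divide G_n if ω
≠ 0 (`not_beta_dvd_seriesG`). If the support did not grow, β + G_n t would be a power of β up to a
unit, and β would divide a power of G_n; hence the inclusion is strict (`IsStep.exists_prime`).
Modulo β every Q_{i+1} equals a r_i² with one fixed a ≡ Q_1 and r_0 = 1 (`exists_pairing_succ_eq`),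
so the right side becomes a G_n^{p²} times a unit: on β = 0, the series G_{n+1} vanishes exactly
where Q_1 or G_n does (`IsStep.mem_iff_of_beta_mem`).

Newton strata. Iterating the Frobenius matrix shows that the non-ordinary locus is β = 0 and the
supersingular locus is β = Q_1 = 0 (`mem_nonOrdinary_iff`, `mem_supersingular_iff`). So on β = 0 one
step adds the supersingular locus, and a second step adds nothing. -/

/-- The power series in which the third variable does not occur. -/
def zFree (k : Type*) [Field k] : Subring (MvPowerSeries (Fin 3) k) where
  carrier := {f | ∀ m : Fin 3 →₀ ℕ, m 2 ≠ 0 → coeff m f = 0}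
  mul_mem' {f g} hf hg m hm := by
    classical
    rw [coeff_mul]
    refine Finset.sum_eq_zero fun u hu => ?_
    have h : u.1 2 + u.2 2 = m 2 := by
      rw [← Finset.HasAntidiagonal.mem_antidiagonal.mp hu]; rfl
    by_cases h1 : u.1 2 = 0
    · rw [hg u.2 (by omega), mul_zero]
    · rw [hf u.1 h1, zero_mul]
  one_mem' m hm := by
    classical
    rw [coeff_one, if_neg]; rintro rfl; exact hm rfl
  add_mem' {f g} hf hg m hm := by rw [map_add, hf m hm, hg m hm, add_zero]
  zero_mem' m _ := map_zero _
  neg_mem' {f} hf m hm := by rw [map_neg, hf m hm, neg_zero]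

theorem C_mem_zFree (a : k) : C a ∈ zFree k := fun m hm => by
  classical
  rw [coeff_C, if_neg]; rintro rfl; exact hm rfl

theorem X_mem_zFree {i : Fin 3} (hi : i ≠ 2) : X i ∈ zFree k := fun m hm => by
  classical
  rw [coeff_X, if_neg]; rintro rfl; simp [hi] at hm

theorem eq_zero_of_add_X_mul_eq_zero {a b : MvPowerSeries (Fin 3) k} (ha : a ∈ zFree k)
    (h : a + X 2 * b = 0) : a = 0 ∧ b = 0 := by
  classical
  have key : ∀ m, coeff m a + (if Finsupp.single (2 : Fin 3) 1 ≤ m then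
      coeff (m - Finsupp.single 2 1) b else 0) = 0 := fun m => by
    have := congrArg (coeff m) h
    rw [map_add, X_def, coeff_monomial_mul, map_zero] at this
    simpa using this
  constructor
  · ext m
    by_cases hm : m 2 = 0
    · have := key m
      rwa [if_neg, add_zero] at this
      intro h'
      have := h' 2
      simp [hm] at this
    · exact ha m hm
  · ext m
    have := key (m + Finsupp.single 2 1)
    rwa [if_pos (by simp), ha _ (by simp), zero_add, add_tsub_cancel_right] at this

/-- The quadratic form `x y + c z²`. -/
def quadric (c : k) : MvPowerSeries (Fin 3) k := X 0 * X 1 + C c * X 2 ^ 2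

/-- The exponent of `x y`. -/
def expXY : Fin 3 →₀ ℕ := Finsupp.single 0 1 + Finsupp.single 1 1

theorem coeff_quadric_mul (c : k) (g : MvPowerSeries (Fin 3) k) (m : Fin 3 →₀ ℕ) :
    coeff m (quadric c * g) = (if expXY ≤ m then coeff (m - expXY) g else 0) +
      c * (if Finsupp.single 2 2 ≤ m then coeff (m - Finsupp.single 2 2) g else 0) := by
  classical
  have h1 : (X 0 * X 1 : MvPowerSeries (Fin 3) k) = monomial expXY 1 := by
    rw [X_def, X_def, monomial_mul_monomial, one_mul, expXY]
  rw [quadric, h1, add_mul, map_add, coeff_monomial_mul, mul_assoc, coeff_C_mul, X_pow_eq,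
    coeff_monomial_mul]
  simp

theorem expXY_apply_zero : expXY 0 = 1 := by simp [expXY]
theorem expXY_le_add_single (m : Fin 3 →₀ ℕ) :
    expXY ≤ m + Finsupp.single 2 2 ↔ expXY ≤ m := by
  constructor
  · intro h i
    have := h i
    fin_cases i <;> simp_all [expXY]
  · exact fun h => h.trans (by simp)

/-- The coefficients of the quotient of `f` by `x y + c z²`. -/
def quadricQuot (c : k) (f : MvPowerSeries (Fin 3) k) (m : Fin 3 →₀ ℕ) : k :=
  -- Comparing coefficients at the exponent of m times z² in f = (xy + cz²) g expresses c g_m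
  -- through f and the coefficient of g at m - xy + z². The exponent of x drops by one each time, so
  -- the recursion ends.
  c⁻¹ * (coeff (m + Finsupp.single 2 2) f -
    open Classical in
    if h : expXY ≤ m then quadricQuot c f (m - expXY + Finsupp.single 2 2) else 0)
termination_by m 0
decreasing_by
  have := h 0
  simp [expXY_apply_zero] at *
  omega

/-- Since c is invertible, z² can be eliminated: modulo the quadric, power series are spanned by 1
and z over the series without z. -/
theorem exists_quadric_division {c : k} (hc : c ≠ 0) (f : MvPowerSeries (Fin 3) k) :
    ∃ g, ∃ a ∈ zFree k, ∃ b ∈ zFree k, f = quadric c * g + (a + X 2 * b) := by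
  classical
  let g : MvPowerSeries (Fin 3) k := fun m => quadricQuot c f m
  have hg : ∀ m, coeff m g = quadricQuot c f m := fun m => rfl
  set r := f - quadric c * g with hr
  have hr2 : ∀ m : Fin 3 →₀ ℕ, 2 ≤ m 2 → coeff m r = 0 := by
    intro m hm
    obtain ⟨m, rfl⟩ : ∃ m', m = m' + Finsupp.single 2 2 :=
      ⟨m - Finsupp.single 2 2, (tsub_add_cancel_of_le (by simpa using hm)).symm⟩
    rw [hr, map_sub, coeff_quadric_mul, if_pos (by simp : Finsupp.single (2 : Fin 3) 2 ≤ m +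
      Finsupp.single 2 2), add_tsub_cancel_right, hg m, quadricQuot, mul_inv_cancel_left₀ hc]
    by_cases h : expXY ≤ m
    · rw [if_pos ((expXY_le_add_single m).2 h), dif_pos h, hg, tsub_add_eq_add_tsub h]
      ring
    · rw [if_neg (mt (expXY_le_add_single m).1 h), dif_neg h]
      ring
  let a : MvPowerSeries (Fin 3) k := fun m => if m 2 = 0 then coeff m r else 0
  let b : MvPowerSeries (Fin 3) k := fun m =>
    if m 2 = 0 then coeff (m + Finsupp.single 2 1) r else 0
  have ha : ∀ m, coeff m a = if m 2 = 0 then coeff m r else 0 := fun m => rfl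
  have hb : ∀ m, coeff m b = if m 2 = 0 then coeff (m + Finsupp.single 2 1) r else 0 :=
    fun m => rfl
  refine ⟨g, a, fun m hm => by rw [ha, if_neg hm], b, fun m hm => by rw [hb, if_neg hm], ?_⟩
  rw [← sub_eq_iff_eq_add', ← hr]
  ext m
  rw [map_add, X_def, coeff_monomial_mul, ha, hb]
  by_cases h0 : m 2 = 0
  · rw [if_pos h0, if_neg, add_zero]
    intro h
    simpa [h0] using h 2
  · have h1 : Finsupp.single (2 : Fin 3) 1 ≤ m := by simpa [Nat.one_le_iff_ne_zero] using h0
    rw [if_neg h0, if_pos h1, zero_add, one_mul, tsub_add_cancel_of_le h1]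
    split_ifs with h2
    · rfl
    · simp at h2
      exact hr2 m (by omega)

/-- Uniqueness of the division. The right side has no monomial divisible by z², so c g_m is minus a
coefficient of g with smaller exponent of x, and induction on that exponent applies. -/
theorem eq_zero_of_quadric_mul_eq {c : k} (hc : c ≠ 0) {g a b : MvPowerSeries (Fin 3) k}
    (ha : a ∈ zFree k) (hb : b ∈ zFree k) (h : quadric c * g = a + X 2 * b) : g = 0 := by
  classical
  have hab : ∀ m : Fin 3 →₀ ℕ, coeff (m + Finsupp.single 2 2) (a + X 2 * b) = 0 := fun m => by
    have h1 : Finsupp.single (2 : Fin 3) 1 ≤ m + Finsupp.single 2 2 :=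
      fun i => by fin_cases i <;> simp
    rw [map_add, ha _ (by simp), X_def, coeff_monomial_mul, if_pos h1, hb, mul_zero, add_zero]
    simp
  have key : ∀ N, ∀ m : Fin 3 →₀ ℕ, m 0 = N → coeff m g = 0 := by
    intro N
    induction N using Nat.strong_induction_on with
    | _ N ih =>
      intro m hm
      have h1 := hab m
      rw [← h, coeff_quadric_mul, if_pos (by simp : Finsupp.single (2 : Fin 3) 2 ≤ m +
        Finsupp.single 2 2), add_tsub_cancel_right] at h1
      have h2 : (if expXY ≤ m + Finsupp.single 2 2 then
          coeff (m + Finsupp.single 2 2 - expXY) g else 0) = 0 := by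
        split_ifs with h3
        · have := h3 0
          refine ih _ ?_ _ rfl
          simp [expXY_apply_zero] at this ⊢
          omega
        · rfl
      rw [h2, zero_add] at h1
      exact (mul_eq_zero.mp h1).resolve_left hc
  ext m
  exact key _ m rfl

theorem not_quadric_dvd_of_mem_zFree {c : k} (hc : c ≠ 0) {a : MvPowerSeries (Fin 3) k}
    (ha : a ∈ zFree k) (h0 : a ≠ 0) : ¬ quadric c ∣ a := by
  rintro ⟨g, hg⟩
  have := eq_zero_of_quadric_mul_eq (g := g) hc ha (zFree k).zero_mem
    (by rw [mul_zero, add_zero, hg])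
  rw [this, mul_zero] at hg
  exact h0 hg

/-- The order in x alone is even for a² and odd for xy b², so e·xy is not a square even in the
fraction field. -/
theorem eq_zero_of_sq_eq_mul_sq {e : k} (he : e ≠ 0) {a b : MvPowerSeries (Fin 3) k}
    (h : a ^ 2 = C e * (X 0 * X 1) * b ^ 2) : b = 0 := by
  classical
  by_contra hb
  have h0 := congrArg (weightedOrder (![1, 0, 0] : Fin 3 → ℕ)) h
  have hmon : (C e * (X 0 * X 1) : MvPowerSeries (Fin 3) k) = monomial expXY e := by
    rw [X_def, X_def, monomial_mul_monomial, one_mul, ← monomial_zero_eq_C_apply,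
      monomial_mul_monomial, zero_add, mul_one, expXY]
  rw [hmon, sq, sq, weightedOrder_mul, weightedOrder_mul, weightedOrder_mul,
    weightedOrder_monomial_of_ne_zero _ he] at h0
  have hw : Finsupp.weight (![1, 0, 0] : Fin 3 → ℕ) expXY = 1 := by
    simp [expXY, Finsupp.weight_single]
  rw [hw] at h0
  have hbf := ne_zero_iff_weightedOrder_finite (w := (![1, 0, 0] : Fin 3 → ℕ)).mp hb
  rw [← hbf] at h0
  generalize (weightedOrder (![1, 0, 0] : Fin 3 → ℕ) b).toNat = u at h0
  generalize weightedOrder (![1, 0, 0] : Fin 3 → ℕ) a = v at h0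
  induction v using ENat.recTopCoe with
  | top => simp at h0; exact absurd h0 (by exact_mod_cast ENat.top_ne_natCast (1 + (u + u)))
  | coe v =>
    have : v + v = 1 + (u + u) := by exact_mod_cast h0
    omega

/-- The quotient is the quadratic extension of the z-free series by z = √d with d = -xy/c. Its norm
a² - d b² is multiplicative and, as d is not a square, vanishes only at 0; so the quotient is a
domain. -/
theorem prime_quadric {c : k} (hc : c ≠ 0) : Prime (quadric c) := by
  have hz : (X 2 ^ 2 : MvPowerSeries (Fin 3) k) =
      C c⁻¹ * quadric c + C (-c⁻¹) * (X 0 * X 1) := by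
    have : (C c⁻¹ * C c : MvPowerSeries (Fin 3) k) = 1 := by
      rw [← map_mul, inv_mul_cancel₀ hc, map_one]
    rw [quadric, map_neg]
    linear_combination -(X 2 ^ 2 : MvPowerSeries (Fin 3) k) * this
  set d : MvPowerSeries (Fin 3) k := C (-c⁻¹) * (X 0 * X 1) with hd
  have hdz : d ∈ zFree k := mul_mem (C_mem_zFree _)
    (mul_mem (X_mem_zFree (by decide)) (X_mem_zFree (by decide)))
  have hne : (-c⁻¹ : k) ≠ 0 := neg_ne_zero.mpr (inv_ne_zero hc)
  have hnorm : ∀ {a b : MvPowerSeries (Fin 3) k}, a ^ 2 - d * b ^ 2 = 0 → a + X 2 * b = 0 := by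
    intro a b h
    have hb := eq_zero_of_sq_eq_mul_sq hne (sub_eq_zero.mp h)
    subst hb
    have : a ^ 2 = 0 := by simpa using h
    rw [pow_eq_zero_iff two_ne_zero] at this
    rw [this, mul_zero, add_zero]
  refine ⟨?_, ?_, ?_⟩
  · intro h0
    have h1 : C c * X 2 ^ 2 = quadric c - X 0 * X 1 := by rw [quadric]; ring
    have := eq_zero_of_quadric_mul_eq (g := 1) (a := 0) (b := 0) hc (zFree k).zero_mem
      (zFree k).zero_mem (by rw [h0]; ring)
    exact one_ne_zero this
  · intro h
    have := h.map (constantCoeff (σ := Fin 3) (R := k))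
    simp [quadric] at this
  · intro f f' h
    obtain ⟨g, a, ha, b, hb, hf⟩ := exists_quadric_division hc f
    obtain ⟨g', a', ha', b', hb', hf'⟩ := exists_quadric_division hc f'
    have h1 : quadric c ∣ (a * a' + d * (b * b')) + X 2 * (a * b' + a' * b) := by
      have : (a * a' + d * (b * b')) + X 2 * (a * b' + a' * b) = f * f' - quadric c *
          (g * f' + (a + X 2 * b) * g' + C c⁻¹ * (b * b')) := by
        rw [hf, hf']
        linear_combination (-(b * b')) * hz
      rw [this]
      exact dvd_sub h (dvd_mul_right _ _)
    obtain ⟨g₀, hg₀⟩ := h1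
    have hA : a * a' + d * (b * b') ∈ zFree k :=
      add_mem (mul_mem ha ha') (mul_mem hdz (mul_mem hb hb'))
    have hB : a * b' + a' * b ∈ zFree k := add_mem (mul_mem ha hb') (mul_mem ha' hb)
    have hg0 := eq_zero_of_quadric_mul_eq hc hA hB hg₀.symm
    rw [hg0, mul_zero] at hg₀
    obtain ⟨e1, e2⟩ := eq_zero_of_add_X_mul_eq_zero hA hg₀
    have e3 : (a ^ 2 - d * b ^ 2) * (a' ^ 2 - d * b' ^ 2) = 0 := by
      linear_combination (a * a' + d * (b * b')) * e1 - d * (a * b' + a' * b) * e2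
    rcases mul_eq_zero.mp e3 with e | e
    · left; rw [hf, hnorm e, add_zero]; exact dvd_mul_right _ _
    · right; rw [hf', hnorm e, add_zero]; exact dvd_mul_right _ _

end Quadric

end

/-! ### Orders of vanishing and infinite sums -/

section

open MvPowerSeries

section OrderIdeal
variable {σ A : Type*} [CommRing A]

/-- The ideal of power series of order at least `n`. -/
def ordIdeal (σ A : Type*) [CommRing A] (n : ℕ) : Ideal (MvPowerSeries σ A) where
  carrier := {f | (n : ℕ∞) ≤ f.order}
  add_mem' {_ _} hf hg := (le_min hf hg).trans min_order_le_add
  zero_mem' := by simp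
  smul_mem' _ _ hf := (le_trans hf le_add_self).trans le_order_mul

theorem mem_ordIdeal {n : ℕ} {f : MvPowerSeries σ A} :
    f ∈ ordIdeal σ A n ↔ ∀ m : σ →₀ ℕ, m.degree < n → coeff m f = 0 :=
  ⟨fun h _ hm => coeff_of_lt_order (lt_of_lt_of_le (by exact_mod_cast hm) h), nat_le_order⟩

theorem ordIdeal_anti {m n : ℕ} (h : m ≤ n) {f : MvPowerSeries σ A} (hf : f ∈ ordIdeal σ A n) :
    f ∈ ordIdeal σ A m := le_trans (b := (n : ℕ∞)) (by exact_mod_cast h) hf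

theorem mul_mem_ordIdeal {m n : ℕ} {f g : MvPowerSeries σ A} (hf : f ∈ ordIdeal σ A m)
    (hg : g ∈ ordIdeal σ A n) : f * g ∈ ordIdeal σ A (m + n) := by
  refine le_trans ?_ le_order_mul
  push_cast
  exact add_le_add hf hg

theorem pow_mem_ordIdeal {m : ℕ} {f : MvPowerSeries σ A} (hf : f ∈ ordIdeal σ A m) (n : ℕ) :
    f ^ n ∈ ordIdeal σ A (n * m) := by
  refine le_trans ?_ (le_order_pow n)
  rw [nsmul_eq_mul, Nat.cast_mul]
  exact mul_le_mul_right hf _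

theorem mem_ordIdeal_one {f : MvPowerSeries σ A} :
    f ∈ ordIdeal σ A 1 ↔ constantCoeff f = 0 := by
  rw [← one_le_order_iff_constCoeff_eq_zero, ← Nat.cast_one]
  rfl

theorem X_mem_ordIdeal (i : σ) : (X i : MvPowerSeries σ A) ∈ ordIdeal σ A 1 :=
  mem_ordIdeal_one.mpr (constantCoeff_X i)

theorem X_pow_mem_ordIdeal (i : σ) (n : ℕ) :
    (X i ^ n : MvPowerSeries σ A) ∈ ordIdeal σ A n := by
  simpa using pow_mem_ordIdeal (X_mem_ordIdeal (A := A) i) n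

theorem mem_ordIdeal_zero (f : MvPowerSeries σ A) : f ∈ ordIdeal σ A 0 := by
  rw [mem_ordIdeal]; simp

theorem geom_sum_mem_ordIdeal {f g : MvPowerSeries σ A} (hf : f ∈ ordIdeal σ A 1)
    (hg : g ∈ ordIdeal σ A 1) (n : ℕ) :
    ∑ i ∈ Finset.range n, f ^ i * g ^ (n - 1 - i) ∈ ordIdeal σ A (n - 1) := by
  refine sum_mem fun i hi => ?_
  have h1 := mul_mem_ordIdeal (pow_mem_ordIdeal hf i) (pow_mem_ordIdeal hg (n - 1 - i))
  exact ordIdeal_anti (by rw [Finset.mem_range] at hi; omega) h1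

end OrderIdeal

section Sums
open scoped MvPowerSeries.WithPiTopology
variable {σ k ι : Type*} [CommRing k] [TopologicalSpace k]

theorem summable_of_finite_coeff {f : ι → MvPowerSeries σ k}
    (hf : ∀ m, {i | coeff m (f i) ≠ 0}.Finite) : Summable f :=
  WithPiTopology.summable_iff_summable_coeff.mpr fun m => summable_of_hasFiniteSupport (hf m)

/-- The series of the statement are coefficientwise finite sums. Viewing them as unconditional sums
makes reindexing, regrouping and continuous maps available. -/
theorem hasSum_of_finite_coeff {f : ι → MvPowerSeries σ k} {s : MvPowerSeries σ k}
    (hf : ∀ m, {i | coeff m (f i) ≠ 0}.Finite)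
    (hs : ∀ m, coeff m s = ∑ᶠ i, coeff m (f i)) : HasSum f s := by
  refine WithPiTopology.hasSum_iff_hasSum_coeff.mpr fun m => ?_
  have h : (Function.support fun i => coeff m (f i)).Finite := hf m
  rw [hs m, ← tsum_eq_finsum (L := SummationFilter.unconditional ι) h]
  exact (summable_of_hasFiniteSupport h).hasSum

theorem hasSum_constantCoeff {f : ι → MvPowerSeries σ k} {s : MvPowerSeries σ k}
    (h : HasSum f s) : HasSum (fun i => constantCoeff (f i)) (constantCoeff s) :=
  h.map (constantCoeff (σ := σ) (R := k)) (WithPiTopology.continuous_constantCoeff (R := k))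

theorem finite_coeff_of_mem_ordIdeal {A : Type*} [CommRing A] {f : ι → MvPowerSeries σ A}
    (w : ι → ℕ) (hw : ∀ n, {i | w i ≤ n}.Finite) (hf : ∀ i, f i ∈ ordIdeal σ A (w i))
    (m : σ →₀ ℕ) : {i | coeff m (f i) ≠ 0}.Finite := by
  refine (hw m.degree).subset fun i hi => ?_
  by_contra h
  exact hi (mem_ordIdeal.mp (hf i) m (not_le.mp h))

theorem summable_of_mem_ordIdeal {f : ι → MvPowerSeries σ k} (w : ι → ℕ)
    (hw : ∀ n, {i | w i ≤ n}.Finite) (hf : ∀ i, f i ∈ ordIdeal σ k (w i)) : Summable f :=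
  summable_of_finite_coeff (finite_coeff_of_mem_ordIdeal w hw hf)

theorem summable_nat_of_mem_ordIdeal {f : ℕ → MvPowerSeries σ k}
    (hf : ∀ i, f i ∈ ordIdeal σ k i) : Summable f :=
  summable_of_mem_ordIdeal id (fun n => Set.finite_Iic n) hf

theorem hasSum_mem_ordIdeal [T2Space k] {f : ι → MvPowerSeries σ k} {s : MvPowerSeries σ k}
    (h : HasSum f s) {n : ℕ} (hf : ∀ i, f i ∈ ordIdeal σ k n) : s ∈ ordIdeal σ k n := by
  rw [mem_ordIdeal]
  intro m hm
  have h1 := WithPiTopology.hasSum_iff_hasSum_coeff.mp h m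
  have h2 : (fun i => coeff m (f i)) = fun _ => 0 := funext fun i => mem_ordIdeal.mp (hf i) m hm
  rw [h2] at h1
  exact h1.unique hasSum_zero

theorem isUnit_of_constantCoeff_ne_zero {k : Type*} [Field k] {f : MvPowerSeries σ k}
    (h : constantCoeff f ≠ 0) : IsUnit f :=
  isUnit_iff_constantCoeff.mpr (isUnit_iff_ne_zero.mpr h)

instance instCharPMvPowerSeries {σ k : Type*} [CommRing k] (p : ℕ) [CharP k p] :
    CharP (MvPowerSeries σ k) p :=
  charP_of_injective_ringHom (f := C (σ := σ) (R := k)) C_injective p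

variable [DiscreteTopology k]

theorem finite_coeff_of_summable {f : ι → MvPowerSeries σ k} (hf : Summable f)
    (m : σ →₀ ℕ) : {i | coeff m (f i) ≠ 0}.Finite :=
  (WithPiTopology.summable_iff_summable_coeff.mp hf m).hasFiniteSupport_of_discreteTopology

theorem summable_comp_of_injective {κ : Type*} {f : ι → MvPowerSeries σ k} (hf : Summable f)
    {e : κ → ι} (he : Function.Injective e) : Summable (f ∘ e) :=
  summable_of_finite_coeff fun m =>
    (finite_coeff_of_summable hf m).preimage he.injOn

variable (p : ℕ) [Fact p.Prime] [CharP k p]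

theorem hasSum_pow_char_pow {f : ι → MvPowerSeries σ k} {s : MvPowerSeries σ k}
    (h : HasSum f s) (n : ℕ) : HasSum (fun i => f i ^ p ^ n) (s ^ p ^ n) :=
  h.map (iterateFrobenius (MvPowerSeries σ k) p n) (continuous_pow (p ^ n))

/-- Telescoping: the p²-th power is additive and continuous, and shifts the index r by one. -/
theorem sub_pow_eq_of_hasSum {T g : MvPowerSeries σ k}
    (h : HasSum (fun r : ℕ => T ^ p ^ (2 * r)) g) : g - g ^ p ^ 2 = T := by
  have h2 := (hasSum_nat_add_iff' 1).mpr h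
  have h3 := hasSum_pow_char_pow p h 2
  have h4 : (fun r => (T ^ p ^ (2 * r)) ^ p ^ 2) = fun r => T ^ p ^ (2 * (r + 1)) := by
    funext r
    rw [← pow_mul, ← pow_add, mul_add]
  rw [h4] at h3
  have h5 := h2.unique h3
  simp only [Finset.range_one, Finset.sum_singleton, mul_zero, pow_zero, pow_one] at h5
  rw [← h5, sub_sub_cancel]

/-- The index r stands for a first block starting at 2r, whose contribution is the p^{2r}-th power
of the one starting at 0. Passing to g - g^{p²} keeps only r = 0. -/
theorem hasSum_sub_pow_of_hasSum_pow {f : ι → MvPowerSeries σ k} {g : MvPowerSeries σ k}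
    (h : HasSum (fun x : ℕ × ι => f x.2 ^ p ^ (2 * x.1)) g) : HasSum f (g - g ^ p ^ 2) := by
  have hf : Summable f := by
    have := summable_comp_of_injective h.summable (e := fun i : ι => ((0 : ℕ), i))
      (fun a b hab => (Prod.mk.inj hab).2)
    simpa [Function.comp_def] using this
  obtain ⟨T, hT⟩ := hf
  rwa [sub_pow_eq_of_hasSum p (h.prod_fiberwise fun r => hasSum_pow_char_pow p hT (2 * r))]

end Sums

end

/-! ### The invariant form and its Frobenius twists -/

section

open MvPowerSeries

section Tower
open scoped MvPowerSeries.WithPiTopology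
variable {k : Type*} [Field k] (p : ℕ) (lam : k)

/-- The quadratic form `β = x y + z² / (4 ε)` with `ε = λ²`. -/
def betaSeries : MvPowerSeries (Fin 3) k := quadric (4 * lam ^ 2)⁻¹

/-- The pairing of `(x, y, z)` with its `i`-th Frobenius twist. -/
def pairing (i : ℕ) : MvPowerSeries (Fin 3) k :=
  X 0 * X 1 ^ p ^ i + X 1 * X 0 ^ p ^ i + C (2 * lam ^ 2)⁻¹ * X 2 ^ (p ^ i + 1)

/-- The coefficients of the recursion: `β` for `i = 0`, and the pairings with signs for `i > 0`. -/
def recCoeff (i : ℕ) : MvPowerSeries (Fin 3) k :=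
  if i = 0 then betaSeries lam else (-1) ^ i * pairing p lam i

theorem recCoeff_zero : recCoeff p lam 0 = betaSeries lam := if_pos rfl

theorem recCoeff_succ (i : ℕ) :
    recCoeff p lam (i + 1) = (-1) ^ (i + 1) * pairing p lam (i + 1) := if_neg i.succ_ne_zero

theorem betaSeries_mem_ordIdeal : betaSeries lam ∈ ordIdeal (Fin 3) k 2 :=
  add_mem (mul_mem_ordIdeal (X_mem_ordIdeal _) (X_mem_ordIdeal _))
    (Ideal.mul_mem_left _ _ (X_pow_mem_ordIdeal _ _))

variable {lam}

theorem prime_betaSeries (h2 : (2 : k) ≠ 0) (hlam : lam ≠ 0) : Prime (betaSeries lam) := by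
  refine prime_quadric (inv_ne_zero (mul_ne_zero ?_ (pow_ne_zero _ hlam)))
  have : (4 : k) = 2 * 2 := by norm_num
  rw [this]
  exact mul_ne_zero h2 h2

variable (lam)

theorem pairing_mem_ordIdeal (i : ℕ) : pairing p lam i ∈ ordIdeal (Fin 3) k (p ^ i + 1) := by
  have h := fun a b : Fin 3 => mul_mem_ordIdeal (X_mem_ordIdeal (A := k) a)
    (X_pow_mem_ordIdeal (A := k) b (p ^ i))
  refine add_mem (add_mem ?_ ?_) (Ideal.mul_mem_left _ _ (X_pow_mem_ordIdeal _ _))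
  · rw [add_comm (p ^ i)]; exact h 0 1
  · rw [add_comm (p ^ i)]; exact h 1 0

variable [Fact p.Prime]

theorem recCoeff_mem_ordIdeal (i : ℕ) : recCoeff p lam i ∈ ordIdeal (Fin 3) k (i + 2) := by
  rcases i with _ | i
  · exact betaSeries_mem_ordIdeal lam
  · rw [recCoeff_succ]
    refine ordIdeal_anti ?_ (Ideal.mul_mem_left _ _ (pairing_mem_ordIdeal p lam _))
    have := Nat.lt_pow_self (Fact.out : p.Prime).one_lt (n := i + 1)
    omega

variable {lam}

/-- The factor of `pairing (i + 1)` modulo `β` whose square is the cofactor of `pairing 1`. -/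
theorem exists_pairing_succ_eq (hp : p ≠ 2) [CharP k p] (hl0 : lam ≠ 0)
    (hlam : lam ^ p = -lam) :
    ∃ a ∈ zFree k, a ≠ 0 ∧ ∃ r s : ℕ → MvPowerSeries (Fin 3) k, r 0 = 1 ∧
      (∀ i, r i ∈ ordIdeal (Fin 3) k i) ∧ (∀ i, s i ∈ ordIdeal (Fin 3) k i) ∧
      ∀ i, pairing p lam (i + 1) = a * r i ^ 2 + betaSeries lam * s i := by
  have hpp : p.Prime := Fact.out
  obtain ⟨h, hh⟩ := hpp.odd_of_ne_two hp
  have h1 : 1 ≤ h := by have := hpp.two_le; omega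
  have h2 : (2 : k) ≠ 0 := Ring.two_ne_zero (by rwa [ringChar.eq k p])
  have h4 : (4 : k) = 2 * 2 := by norm_num
  have h4' : (4 : k) ≠ 0 := h4 ▸ mul_ne_zero h2 h2
  set δ : k := (-(4 * lam ^ 2)) ^ h with hδ
  have hl : lam ^ (2 * h) = -1 := by
    have : lam ^ (2 * h) * lam = -1 * lam := by rw [← pow_succ, ← hh, hlam, neg_one_mul]
    exact mul_right_cancel₀ hl0 this
  have h22 : (2 : k) ^ (2 * h) = 1 := by
    have : (2 : k) ^ (2 * h) * 2 = 1 * 2 := by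
      rw [← pow_succ, ← hh, one_mul]
      have := map_ofNat (frobenius k p) 2
      rwa [frobenius_def] at this
    exact mul_right_cancel₀ h2 this
  have hδ2 : δ ^ 2 = 1 := by
    rw [hδ, ← pow_mul, mul_comm h 2, neg_pow, mul_pow, h4, mul_pow, h22, ← pow_mul,
      mul_comm 2 (2 * h),
      pow_mul lam, hl]
    norm_num [pow_mul]
  let N : ℕ → ℕ := fun i => ∑ j ∈ Finset.range (i + 1), p ^ j
  have hN : ∀ i, p ^ (i + 1) = 2 * (h * N i) + 1 := fun i => by
    have := Nat.geomSum_eq hpp.two_le (i + 1)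
    have h3 := geom_sum_mul_add (2 * h) (i + 1)
    rw [← hh] at h3
    rw [← h3]; ring
  have hNi : ∀ i, i + 1 ≤ N i := fun i => by
    have : ∑ j ∈ Finset.range (i + 1), 1 ≤ N i :=
      Finset.sum_le_sum fun j _ => Nat.one_le_pow _ _ hpp.pos
    simpa using this
  let x : MvPowerSeries (Fin 3) k := X 0
  let y : MvPowerSeries (Fin 3) k := X 1
  let z : MvPowerSeries (Fin 3) k := X 2
  let u := x ^ h
  let v := C δ * y ^ h
  have hu : u ∈ ordIdeal (Fin 3) k 1 := ordIdeal_anti h1 (X_pow_mem_ordIdeal _ _)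
  have hv : v ∈ ordIdeal (Fin 3) k 1 :=
    Ideal.mul_mem_left _ _ (ordIdeal_anti h1 (X_pow_mem_ordIdeal _ _))
  let w : MvPowerSeries (Fin 3) k := C (-(4 * lam ^ 2)) * (x * y)
  have hw : w ∈ ordIdeal (Fin 3) k 1 :=
    Ideal.mul_mem_left _ _ (Ideal.mul_mem_left _ _ (X_mem_ordIdeal _))
  have hz : z ^ 2 ∈ ordIdeal (Fin 3) k 1 := ordIdeal_anti one_le_two (X_pow_mem_ordIdeal _ _)
  have hzw : z ^ 2 - w = C (4 * lam ^ 2) * betaSeries lam := by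
    have : (C (4 * lam ^ 2) * C (4 * lam ^ 2)⁻¹ : MvPowerSeries (Fin 3) k) = 1 := by
      rw [← map_mul, mul_inv_cancel₀ (mul_ne_zero h4' (pow_ne_zero _ hl0)), map_one]
    simp only [w, betaSeries, quadric, map_neg]
    linear_combination (-z ^ 2) * this
  -- With u = x^h and v = δ y^h the square is (u^N - v^N)². The common factor is (u - v)², and r_i
  -- is the geometric sum (u^N - v^N)/(u - v). The cofactor of β comes from dividing (z²)^{hN+1} -
  -- w^{hN+1} by z² - w = 4λ²β.
  refine ⟨x * y * (u - v) ^ 2, ?_, ?_,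
    fun i => ∑ j ∈ Finset.range (N i), u ^ j * v ^ (N i - 1 - j),
    fun i => C 2 * ∑ j ∈ Finset.range (h * N i + 1), (z ^ 2) ^ j * w ^ (h * N i + 1 - 1 - j),
    ?_, ?_, ?_, ?_⟩
  · have hx : x ∈ zFree k := X_mem_zFree (by decide)
    have hy : y ∈ zFree k := X_mem_zFree (by decide)
    exact mul_mem (mul_mem hx hy) (pow_mem (sub_mem (pow_mem hx _)
      (mul_mem (C_mem_zFree _) (pow_mem hy _))) _)
  · refine mul_ne_zero (mul_ne_zero (nonZeroDivisors.ne_zero X_mem_nonzeroDivisors)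
      (nonZeroDivisors.ne_zero X_mem_nonzeroDivisors))
      (pow_ne_zero _ fun h0 => ?_)
    classical
    have := congrArg (coeff (Finsupp.single 0 h)) h0
    rw [map_sub, coeff_C_mul, coeff_X_pow, coeff_X_pow, if_pos rfl, if_neg] at this
    · simp at this
    · intro h3
      have := DFunLike.congr_fun h3 0
      simp at this
      omega
  · simp [N]
  · intro i
    exact ordIdeal_anti (by have := hNi i; omega) (geom_sum_mem_ordIdeal hu hv (N i))
  · intro i
    refine Ideal.mul_mem_left _ _ (ordIdeal_anti ?_ (geom_sum_mem_ordIdeal hz hw (h * N i + 1)))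
    have := hNi i
    have : 1 * N i ≤ h * N i := Nat.mul_le_mul_right _ h1
    omega
  · intro i
    have g1 := geom_sum₂_mul u v (N i)
    have g2 := geom_sum₂_mul (z ^ 2) w (h * N i + 1)
    have e1 : x * y * (u - v) ^ 2 * (∑ j ∈ Finset.range (N i), u ^ j * v ^ (N i - 1 - j)) ^ 2 =
        x * y * (u ^ N i - v ^ N i) ^ 2 := by rw [← g1]; ring
    have e2 : betaSeries lam * (C 2 * ∑ j ∈ Finset.range (h * N i + 1),
        (z ^ 2) ^ j * w ^ (h * N i + 1 - 1 - j)) =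
        C (2 * lam ^ 2)⁻¹ * ((z ^ 2) ^ (h * N i + 1) - w ^ (h * N i + 1)) := by
      rw [← g2, hzw]
      have : (C (2 * lam ^ 2)⁻¹ * C (4 * lam ^ 2) : MvPowerSeries (Fin 3) k) = C 2 := by
        rw [← map_mul]
        congr 1
        rw [h4]
        field_simp
      rw [← this]; ring
    rw [e1, e2]
    have e3 : w ^ (h * N i + 1) = C (-(4 * lam ^ 2)) * C (δ ^ N i) * (x * y) *
        (x ^ (h * N i) * y ^ (h * N i)) := by
      simp only [w]
      rw [pow_succ, mul_pow, mul_pow, ← map_pow, pow_mul, ← hδ]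
      ring
    have e4 : C (2 * lam ^ 2)⁻¹ * C (-(4 * lam ^ 2)) = (-2 : MvPowerSeries (Fin 3) k) := by
      rw [← map_mul]
      have : (2 * lam ^ 2)⁻¹ * -(4 * lam ^ 2) = (-2 : k) := by rw [h4]; field_simp
      rw [this, map_neg, map_ofNat]
    have e5 : u ^ N i = x ^ (h * N i) := (pow_mul _ _ _).symm
    have e6 : v ^ N i = C (δ ^ N i) * y ^ (h * N i) := by
      simp only [v]; rw [mul_pow, ← map_pow, ← pow_mul y]
    have e7 : (C (δ ^ N i) : MvPowerSeries (Fin 3) k) ^ 2 = 1 := by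
      rw [← map_pow, ← pow_mul, mul_comm, pow_mul, hδ2, one_pow, map_one]
    rw [e3, e5, e6, pairing, hN i]
    change x * y ^ _ + y * x ^ _ + _ * z ^ _ = _
    have e8 : z ^ (2 * (h * N i) + 1 + 1) = (z ^ 2) ^ (h * N i + 1) := by rw [← pow_mul]; ring_nf
    rw [e8]
    generalize (z ^ 2) ^ (h * N i + 1) = Z
    have e9 : y ^ (2 * (h * N i) + 1) = y * (y ^ (h * N i)) ^ 2 := by rw [← pow_mul]; ring
    have e10 : x ^ (2 * (h * N i) + 1) = x * (x ^ (h * N i)) ^ 2 := by rw [← pow_mul]; ring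
    rw [e9, e10]
    generalize x ^ (h * N i) = x', y ^ (h * N i) = y', (C (δ ^ N i)) = D at *
    linear_combination (D * (x * y) * (x' * y')) * e4 + (-(x * y * y' ^ 2)) * e7
end Tower

end

/-! ### The recursion step modulo `p` -/

section

open MvPowerSeries

section TowerSteps
open scoped MvPowerSeries.WithPiTopology
variable {k : Type*} [Field k] {p : ℕ} [Fact p.Prime] {lam : k}

theorem isUnit_one_sub_pow {G : MvPowerSeries (Fin 3) k} (hG : constantCoeff G = 0) :
    IsUnit (1 - G ^ (p ^ 2 - 1)) := by
  refine isUnit_of_constantCoeff_ne_zero ?_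
  have := Nat.one_lt_pow two_ne_zero (Fact.out : p.Prime).one_lt
  rw [map_sub, map_one, map_pow, hG, zero_pow (by omega), sub_zero]
  exact one_ne_zero

theorem sub_pow_eq_mul (G : MvPowerSeries (Fin 3) k) :
    G - G ^ p ^ 2 = G * (1 - G ^ (p ^ 2 - 1)) := by
  rw [mul_sub, mul_one, ← pow_succ',
    Nat.sub_add_cancel (Nat.one_le_pow _ _ (Fact.out : p.Prime).pos)]

/-- The two series differ by the factor 1 - G^{p²-1}, a unit because G vanishes at the closed point.
-/
theorem mem_iff_sub_pow_mem {G : MvPowerSeries (Fin 3) k} (hG : constantCoeff G = 0)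
    (I : Ideal (MvPowerSeries (Fin 3) k)) : G ∈ I ↔ G - G ^ p ^ 2 ∈ I := by
  rw [sub_pow_eq_mul, Ideal.mul_unit_mem_iff_mem I (isUnit_one_sub_pow hG)]

variable [CharP k p]

-- Modulo β the pairing is the nonzero z-free series a, and no such series is a multiple of β.
variable (p) in
theorem not_beta_dvd_pairing_one (hp : p ≠ 2) (hl0 : lam ≠ 0) (hlam : lam ^ p = -lam) :
    ¬ betaSeries lam ∣ pairing p lam 1 := by
  obtain ⟨a, ha, ha0, r, s, hr0, -, -, hrs⟩ := exists_pairing_succ_eq p hp hl0 hlam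
  have h2 : (2 : k) ≠ 0 := Ring.two_ne_zero (by rwa [ringChar.eq k p])
  rw [hrs 0, hr0, one_pow, mul_one, dvd_add_left (dvd_mul_right _ _)]
  refine not_quadric_dvd_of_mem_zFree (inv_ne_zero (mul_ne_zero ?_ (pow_ne_zero _ hl0))) ha ha0
  rw [show (4 : k) = 2 * 2 by norm_num]
  exact mul_ne_zero h2 h2

variable [TopologicalSpace k] [DiscreteTopology k]

/-- The step of the recursion that relates two consecutive series. -/
def IsStep (p : ℕ) (lam : k) (G G' : MvPowerSeries (Fin 3) k) : Prop :=
  HasSum (fun i => recCoeff p lam i * G ^ p ^ (i + 1)) (G' - G' ^ p ^ 2)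

-- The term i = 0 is β G^p, and for i > 0 the exponent p^{i+1} is at least p + 1, so these terms
-- contain a further factor G.
omit [CharP k p] in
theorem IsStep.exists_factor {G G' : MvPowerSeries (Fin 3) k} (h : IsStep p lam G G') :
    ∃ t, G' - G' ^ p ^ 2 = G ^ p * (betaSeries lam + G * t) := by
  have hpp : p.Prime := Fact.out
  have hs : Summable fun i => recCoeff p lam (i + 1) * G ^ (p ^ (i + 2) - p - 1) :=
    summable_nat_of_mem_ordIdeal fun i => Ideal.mul_mem_right _ _
      (ordIdeal_anti (by omega) (recCoeff_mem_ordIdeal p lam (i + 1)))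
  obtain ⟨t, ht⟩ := hs
  refine ⟨t, h.unique ((hasSum_nat_add_iff' 1).mp ?_)⟩
  have h1 := ht.mul_left (G ^ (p + 1))
  convert! h1 using 1
  · funext i
    have : p + 1 ≤ p ^ (i + 2) := by
      have h2 := hpp.two_le
      calc p + 1 ≤ p * p := by nlinarith
        _ = p ^ 2 := (sq p).symm
        _ ≤ p ^ (i + 2) := Nat.pow_le_pow_right hpp.pos (by omega)
    rw [mul_left_comm, ← pow_add]
    congr 2
    change p ^ (i + 2) = p + 1 + (p ^ (i + 2) - p - 1)
    omega
  · simp only [Finset.range_one, Finset.sum_singleton, recCoeff_zero, zero_add, pow_one]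
    ring

-- Modulo β all pairings are multiples a r_i² of one z-free series. As r_0 = 1 and the later r_i
-- have no constant term, the constant term of V sees only h 0, with the sign (-1)^1 of the first
-- pairing.
variable (p) in
theorem exists_hasSum_recCoeff_succ_mul (hp : p ≠ 2) (hl0 : lam ≠ 0) (hlam : lam ^ p = -lam) :
    ∃ a ∈ zFree k, a ≠ 0 ∧ (∃ s, pairing p lam 1 = a + betaSeries lam * s) ∧
      ∀ h : ℕ → MvPowerSeries (Fin 3) k, ∃ A V, constantCoeff V = -constantCoeff (h 0) ∧
        HasSum (fun i => recCoeff p lam (i + 1) * h i) (betaSeries lam * A + a * V) := by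
  obtain ⟨a, ha, ha0, r, s, hr0, hr, hs, hrs⟩ := exists_pairing_succ_eq p hp hl0 hlam
  refine ⟨a, ha, ha0, ⟨s 0, by rw [hrs 0, hr0, one_pow, mul_one]⟩, fun h => ?_⟩
  obtain ⟨A, hA⟩ : Summable fun i => (-1) ^ (i + 1) * s i * h i :=
    summable_nat_of_mem_ordIdeal fun i =>
      Ideal.mul_mem_right _ _ (Ideal.mul_mem_left _ _ (hs i))
  obtain ⟨V, hV⟩ : Summable fun i => (-1) ^ (i + 1) * r i ^ 2 * h i :=
    summable_nat_of_mem_ordIdeal fun i => Ideal.mul_mem_right _ _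
      (Ideal.mul_mem_left _ _ (ordIdeal_anti (by omega) (pow_mem_ordIdeal (hr i) 2)))
  refine ⟨A, V, ?_, ?_⟩
  · refine (hasSum_constantCoeff hV).unique ?_
    convert! hasSum_single (f := fun i => constantCoeff ((-1) ^ (i + 1) * r i ^ 2 * h i))
      0 ?_ using 1
    · simp [hr0]
    · intro i hi
      have : constantCoeff (r i) = 0 :=
        mem_ordIdeal_one.mp (ordIdeal_anti (Nat.one_le_iff_ne_zero.mpr hi) (hr i))
      simp [this]
  · convert! (hA.mul_left (betaSeries lam)).add (hV.mul_left a) using 1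
    funext i
    rw [recCoeff_succ, hrs]
    ring

/-- Taking out G^{p²}, the least power of G in the terms with i > 0, leaves 1 as the first
coefficient of the tail; so V has constant term -1 and is a unit. -/
theorem IsStep.exists_eq_of_pairing (hp : p ≠ 2) (hl0 : lam ≠ 0) (hlam : lam ^ p = -lam) :
    ∃ a ∈ zFree k, a ≠ 0 ∧ (∃ s, pairing p lam 1 = a + betaSeries lam * s) ∧
      ∀ G G' : MvPowerSeries (Fin 3) k, IsStep p lam G G' → constantCoeff G = 0 → ∃ A V, IsUnit V ∧
        G' - G' ^ p ^ 2 = betaSeries lam * A + a * G ^ p ^ 2 * V := by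
  obtain ⟨a, ha, ha0, has, H⟩ := exists_hasSum_recCoeff_succ_mul p hp hl0 hlam
  refine ⟨a, ha, ha0, has, fun G G' h hG => ?_⟩
  obtain ⟨A, V, hV, hs⟩ := H fun i => G ^ (p ^ (i + 2) - p ^ 2)
  refine ⟨A * G ^ p ^ 2 + G ^ p, V, isUnit_of_constantCoeff_ne_zero ?_,
    h.unique ((hasSum_nat_add_iff' 1).mp ?_)⟩
  · rw [hV]; simp
  · convert! hs.mul_left (G ^ p ^ 2) using 1
    · funext i
      have : p ^ 2 ≤ p ^ (i + 2) := Nat.pow_le_pow_right (Fact.out : p.Prime).pos (by omega)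
      rw [mul_left_comm, ← pow_add]
      congr 2
      change p ^ (i + 2) = p ^ 2 + (p ^ (i + 2) - p ^ 2)
      omega
    · simp only [Finset.range_one, Finset.sum_singleton, recCoeff_zero, zero_add, pow_one]
      ring

section Consequences
variable {G G' : MvPowerSeries (Fin 3) k} (h : IsStep p lam G G') (hG' : constantCoeff G' = 0)
  (I : Ideal (MvPowerSeries (Fin 3) k))
include h hG'

omit [CharP k p] in
theorem IsStep.mem_of_mem (hG : G ∈ I) : G' ∈ I := by
  obtain ⟨t, ht⟩ := h.exists_factor
  rw [mem_iff_sub_pow_mem (p := p) hG' I, ht]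
  exact I.mul_mem_right _ (I.pow_mem_of_mem hG _ (Fact.out : p.Prime).pos)

variable (hp : p ≠ 2) (hl0 : lam ≠ 0) (hG : constantCoeff G = 0)
include hp hl0 hG

/-- If every prime containing G' contained G, then G, and with it β, would lie in the radical of θ =
β + G t. So θ divides a power of β and, β being prime, is itself such a power up to a unit. The
exponent is positive because θ vanishes at the closed point, so β divides θ, which divides a power
of G. -/
theorem IsStep.exists_prime (hb : ¬ betaSeries lam ∣ G) :
    ∃ q : PrimeSpectrum (MvPowerSeries (Fin 3) k), G' ∈ q.asIdeal ∧ G ∉ q.asIdeal := by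
  by_contra! hcon
  have h2 : (2 : k) ≠ 0 := Ring.two_ne_zero (by rwa [ringChar.eq k p])
  have hβ := prime_betaSeries h2 hl0
  obtain ⟨t, ht⟩ := h.exists_factor
  set θ := betaSeries lam + G * t with hθ
  have hrad : G ∈ (Ideal.span {θ}).radical := by
    rw [Ideal.radical_eq_sInf, Ideal.mem_sInf]
    rintro J ⟨hJ, hJp⟩
    refine hcon ⟨J, hJp⟩ ((mem_iff_sub_pow_mem (p := p) hG' J).mpr ?_)
    rw [ht]
    exact J.mul_mem_left _ (hJ (Ideal.mem_span_singleton_self θ))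
  have hrad' : betaSeries lam ∈ (Ideal.span {θ}).radical := by
    rw [show betaSeries lam = θ - G * t by rw [hθ]; ring]
    exact sub_mem (Ideal.le_radical (Ideal.mem_span_singleton_self θ))
      (Ideal.mul_mem_right _ _ hrad)
  obtain ⟨M, hM⟩ := hrad'
  obtain ⟨i, -, hi⟩ := (dvd_prime_pow hβ M).mp (Ideal.mem_span_singleton.mp hM)
  have hθ0 : constantCoeff θ = 0 := by
    have := mem_ordIdeal_one.mp (ordIdeal_anti one_le_two (betaSeries_mem_ordIdeal lam))
    rw [hθ, map_add, map_mul, hG, this]; simp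
  rcases i with _ | i
  · rw [pow_zero, associated_one_iff_isUnit] at hi
    have := hi.map (constantCoeff (σ := Fin 3) (R := k))
    rw [hθ0] at this
    exact not_isUnit_zero this
  · obtain ⟨N, hN⟩ := hrad
    refine hb (hβ.dvd_of_dvd_pow (((dvd_pow_self _ i.succ_ne_zero).trans hi.symm.dvd).trans
      (Ideal.mem_span_singleton.mp hN)))

variable (hlam : lam ^ p = -lam)
include hlam

-- On the locus β = 0 the step reads G' · unit = a G^{p²} · unit, where a agrees with the first
-- pairing.
variable [I.IsPrime] in
theorem IsStep.mem_iff_of_beta_mem (hb : betaSeries lam ∈ I) :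
    G' ∈ I ↔ pairing p lam 1 ∈ I ∨ G ∈ I := by
  obtain ⟨a, -, -, ⟨s, hs⟩, H⟩ := IsStep.exists_eq_of_pairing hp hl0 hlam
  obtain ⟨A, V, hV, hAV⟩ := H G G' h hG
  have h1 : pairing p lam 1 ∈ I ↔ a ∈ I := by
    rw [hs, I.add_mem_iff_left (I.mul_mem_right _ hb)]
  rw [mem_iff_sub_pow_mem (p := p) hG' I, hAV, I.add_mem_iff_right (I.mul_mem_right _ hb),
    Ideal.mul_unit_mem_iff_mem I hV, h1, ‹I.IsPrime›.mul_mem_iff_mem_or_mem,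
    ‹I.IsPrime›.pow_mem_iff_mem _ (pow_pos (Fact.out : p.Prime).pos 2)]

/-- The ideal (β) is prime and contains neither the first pairing nor G. -/
theorem IsStep.not_beta_dvd (hb : ¬ betaSeries lam ∣ G) : ¬ betaSeries lam ∣ G' := by
  have h2 : (2 : k) ≠ 0 := Ring.two_ne_zero (by rwa [ringChar.eq k p])
  have hβ := prime_betaSeries h2 hl0
  have := (Ideal.span_singleton_prime hβ.ne_zero).mpr hβ
  intro hd
  rcases (h.mem_iff_of_beta_mem hG' (Ideal.span {betaSeries lam}) hp hl0 hG hlam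
    (Ideal.mem_span_singleton_self _)).mp (Ideal.mem_span_singleton.mpr hd) with h1 | h1
  · exact not_beta_dvd_pairing_one p hp hl0 hlam (Ideal.mem_span_singleton.mp h1)
  · exact hb (Ideal.mem_span_singleton.mp h1)

end Consequences

/-- The start of the induction on the length. A nonzero linear form cannot be compensated, since β
and all c_i have order at least 2. Without linear form, the sum is modulo β equal to a times a
series with constant term -H_1(0), a unit, and β does not divide a. -/
theorem not_beta_dvd_of_hasSum (hp : p ≠ 2) (hl0 : lam ≠ 0) (hlam : lam ^ p = -lam)
    {G S : MvPowerSeries (Fin 3) k} {H : ℕ → MvPowerSeries (Fin 3) k} (κ : Fin 3 → k)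
    (hS : HasSum (fun i => recCoeff p lam i * H i) S)
    (hG : G - G ^ p ^ 2 = S + ∑ i, C (κ i) * X i)
    (hne : (∃ i, κ i ≠ 0) ∨ constantCoeff (H 1) ≠ 0) : ¬ betaSeries lam ∣ G := by
  classical
  intro hd
  have h2 : (2 : k) ≠ 0 := Ring.two_ne_zero (by rwa [ringChar.eq k p])
  have hβ := prime_betaSeries h2 hl0
  have hd1 : betaSeries lam ∣ S + ∑ i, C (κ i) * X i := by
    rw [← hG]
    exact dvd_sub hd (hd.trans (dvd_pow_self _ (pow_pos (Fact.out : p.Prime).pos 2).ne'))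
  have hS2 : S ∈ ordIdeal (Fin 3) k 2 := hasSum_mem_ordIdeal hS fun i =>
    Ideal.mul_mem_right _ _ (ordIdeal_anti (by omega) (recCoeff_mem_ordIdeal p lam i))
  have hκ : ∀ i, κ i = 0 := by
    intro i
    obtain ⟨t, ht⟩ := hd1
    have h3 : S + ∑ i, C (κ i) * X i ∈ ordIdeal (Fin 3) k 2 := by
      rw [ht]; exact Ideal.mul_mem_right _ _ (betaSeries_mem_ordIdeal lam)
    have h4 : ∑ i, C (κ i) * X i ∈ ordIdeal (Fin 3) k 2 := by
      rwa [Ideal.add_mem_iff_right _ hS2] at h3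
    have h5 := mem_ordIdeal.mp h4 (Finsupp.single i 1) (by simp)
    simpa [coeff_index_single_X] using h5
  have hτ := hne.resolve_left fun ⟨i, hi⟩ => hi (hκ i)
  simp only [hκ, map_zero, zero_mul, Finset.sum_const_zero, add_zero] at hd1
  obtain ⟨a, ha, ha0, -, hH⟩ := exists_hasSum_recCoeff_succ_mul p hp hl0 hlam (k := k)
  obtain ⟨A, V, hV, hs⟩ := hH fun i => H (i + 1)
  have h6 := ((hasSum_nat_add_iff' 1).mpr hS).unique hs
  simp only [Finset.range_one, Finset.sum_singleton, recCoeff_zero] at h6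
  rw [sub_eq_iff_eq_add] at h6
  have h7 : betaSeries lam ∣ a * V := by
    rw [show a * V = S - betaSeries lam * (A + H 0) by rw [h6]; ring]
    exact dvd_sub hd1 (dvd_mul_right _ _)
  have hVu : IsUnit V := isUnit_of_constantCoeff_ne_zero (by rw [hV]; exact neg_ne_zero.mpr hτ)
  rw [hVu.dvd_mul_right] at h7
  refine not_quadric_dvd_of_mem_zFree (inv_ne_zero (mul_ne_zero ?_ (pow_ne_zero _ hl0))) ha ha0 h7
  rw [show (4 : k) = 2 * 2 by norm_num]
  exact mul_ne_zero h2 h2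

end TowerSteps

end

/-! ### Prepending a block to an admissible system -/

section

/-! ### The first block of an admissible index system -/

/-- The translate of a set of indices by `d`. -/
def shift (d : ℕ) (S : Finset ℕ) : Finset ℕ := S.map (addRightEmbedding d)

theorem mem_shift {d a : ℕ} {S : Finset ℕ} : a ∈ shift d S ↔ ∃ b ∈ S, b + d = a := by
  simp [shift]

theorem add_mem_shift {d a : ℕ} {S : Finset ℕ} : a + d ∈ shift d S ↔ a ∈ S := by
  simp [shift]

theorem le_of_mem_shift {d a : ℕ} {S : Finset ℕ} (h : a ∈ shift d S) : d ≤ a := by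
  obtain ⟨b, -, rfl⟩ := mem_shift.mp h
  omega

theorem card_shift (d : ℕ) (S : Finset ℕ) : (shift d S).card = S.card := Finset.card_map _

theorem shift_insert (d a : ℕ) (S : Finset ℕ) :
    shift d (insert a S) = insert (a + d) (shift d S) := Finset.map_insert _ _ _

theorem exists_shift_eq {d : ℕ} {S : Finset ℕ} (h : ∀ a ∈ S, d ≤ a) : ∃ T, shift d T = S := by
  refine ⟨S.image (· - d), ?_⟩
  ext a
  simp only [mem_shift, Finset.mem_image]
  constructor
  · rintro ⟨_, ⟨b, hb, rfl⟩, rfl⟩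
    rwa [Nat.sub_add_cancel (h b hb)]
  · exact fun ha => ⟨a - d, ⟨a, ha, rfl⟩, Nat.sub_add_cancel (h a ha)⟩

theorem card_filter_lt_shift (d a : ℕ) (S : Finset ℕ) :
    ((shift d S).filter (· < a + d)).card = (S.filter (· < a)).card := by
  rw [shift, Finset.filter_map, Finset.card_map]
  congr 2
  funext b
  simp

/-- The elements of `I` in a block that starts at `m` and ends at `m + i`. -/
def blockI (m i : ℕ) : Finset ℕ := if i = 0 then ∅ else {m, m + i}

/-- The elements of `J` in a block that starts at `m` and ends at `m + i`. -/
def blockJ (m i : ℕ) : Finset ℕ := if i = 0 then {m} else ∅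

/-- The set of indices obtained by putting a block in front. -/
def prepend (m i : ℕ) (B S : Finset ℕ) : Finset ℕ := B ∪ shift (m + i + 1) S

theorem mem_blockI {m i a : ℕ} : a ∈ blockI m i ↔ i ≠ 0 ∧ (a = m ∨ a = m + i) := by
  unfold blockI; split_ifs with h <;> simp [h]

theorem mem_blockJ {m i a : ℕ} : a ∈ blockJ m i ↔ i = 0 ∧ a = m := by
  unfold blockJ; split_ifs with h <;> simp [h]

theorem mem_prepend {m i a : ℕ} {B S : Finset ℕ} :
    a ∈ prepend m i B S ↔ a ∈ B ∨ ∃ b ∈ S, b + (m + i + 1) = a := by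
  rw [prepend, Finset.mem_union, mem_shift]

theorem mem_prepend_union {m i a : ℕ} {I J : Finset ℕ} :
    a ∈ prepend m i (blockI m i) I ∪ prepend m i (blockJ m i) J ↔
      a = m ∨ a = m + i ∨ ∃ b ∈ I ∪ J, b + (m + i + 1) = a := by
  simp only [Finset.mem_union, mem_prepend, mem_blockI, mem_blockJ]
  constructor
  · rintro ((⟨-, h | h⟩ | ⟨b, hb, h⟩) | (⟨-, h⟩ | ⟨b, hb, h⟩))
    · exact .inl h
    · exact .inr (.inl h)
    · exact .inr (.inr ⟨b, .inl hb, h⟩)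
    · exact .inl h
    · exact .inr (.inr ⟨b, .inr hb, h⟩)
  · rcases Nat.eq_zero_or_pos i with h0 | h0
    · rintro (h | h | ⟨b, hb | hb, h⟩)
      · exact .inr (.inl ⟨h0, h⟩)
      · exact .inr (.inl ⟨h0, by omega⟩)
      · exact .inl (.inr ⟨b, hb, h⟩)
      · exact .inr (.inr ⟨b, hb, h⟩)
    · rintro (h | h | ⟨b, hb | hb, h⟩)
      · exact .inl (.inl ⟨h0.ne', .inl h⟩)
      · exact .inl (.inl ⟨h0.ne', .inr h⟩)
      · exact .inl (.inr ⟨b, hb, h⟩)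
      · exact .inr (.inr ⟨b, hb, h⟩)

theorem card_blockI (m i : ℕ) : (blockI m i).card = if i = 0 then 0 else 2 := by
  unfold blockI
  split_ifs with h
  · rfl
  · exact Finset.card_pair (by omega)

theorem disjoint_block_shift {m i : ℕ} {B S : Finset ℕ} (hB : ∀ a ∈ B, a ≤ m + i) :
    Disjoint B (shift (m + i + 1) S) := by
  rw [Finset.disjoint_left]
  intro a ha ha'
  have := hB a ha
  have := le_of_mem_shift ha'
  omega

theorem blockI_le {m i : ℕ} : ∀ a ∈ blockI m i, a ≤ m + i := fun a ha => by
  rcases mem_blockI.mp ha with ⟨-, h | h⟩ <;> omega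

theorem blockJ_le {m i : ℕ} : ∀ a ∈ blockJ m i, a ≤ m + i := fun a ha => by
  have := mem_blockJ.mp ha; omega

theorem card_prepend_blockI (m i : ℕ) (I : Finset ℕ) :
    (prepend m i (blockI m i) I).card = (if i = 0 then 0 else 2) + I.card := by
  rw [prepend, Finset.card_union_of_disjoint (disjoint_block_shift blockI_le), card_blockI,
    card_shift]

theorem card_prepend_blockJ (m i : ℕ) (J : Finset ℕ) :
    (prepend m i (blockJ m i) J).card = (if i = 0 then 1 else 0) + J.card := by
  rw [prepend, Finset.card_union_of_disjoint (disjoint_block_shift blockJ_le), card_shift]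
  unfold blockJ
  split_ifs <;> simp

theorem len_prepend (m i : ℕ) (I J : Finset ℕ) :
    len (prepend m i (blockI m i) I) (prepend m i (blockJ m i) J) = len I J + 1 := by
  rw [len, len, card_prepend_blockI, card_prepend_blockJ]
  split_ifs <;> omega

theorem card_filter_prepend_add (m i a : ℕ) (I : Finset ℕ) :
    ((prepend m i (blockI m i) I).filter (· < a + (m + i + 1))).card =
      (if i = 0 then 0 else 2) + (I.filter (· < a)).card := by
  rw [prepend, Finset.filter_union, Finset.card_union_of_disjoint
    (Finset.disjoint_filter_filter (disjoint_block_shift blockI_le)), card_filter_lt_shift,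
    Finset.filter_true_of_mem, card_blockI]
  intro b hb
  have := blockI_le b hb
  omega

theorem filter_lt_prepend_self (m i : ℕ) (I : Finset ℕ) :
    ((prepend m i (blockI m i) I).filter (· < m)) = ∅ := by
  refine Finset.filter_eq_empty_iff.mpr fun a ha => ?_
  rcases mem_prepend.mp ha with h | ⟨b, -, rfl⟩
  · rcases mem_blockI.mp h with ⟨-, h | h⟩ <;> omega
  · omega

theorem filter_lt_prepend_end {m i : ℕ} (hi : i ≠ 0) (I : Finset ℕ) :
    ((prepend m i (blockI m i) I).filter (· < m + i)) = {m} := by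
  ext a
  simp only [Finset.mem_filter, mem_prepend, mem_blockI, Finset.mem_singleton]
  constructor
  · rintro ⟨⟨-, h | h⟩ | ⟨b, -, rfl⟩, h'⟩ <;> omega
  · rintro rfl
    exact ⟨.inl ⟨hi, .inl rfl⟩, by omega⟩

theorem even_add_block_iff (i n : ℕ) : Even ((if i = 0 then 0 else 2) + n) ↔ Even n := by
  split_ifs <;> simp [Nat.even_add]

theorem odd_add_block_iff (i n : ℕ) : Odd ((if i = 0 then 0 else 2) + n) ↔ Odd n := by
  rw [← Nat.not_even_iff_odd, even_add_block_iff, Nat.not_even_iff_odd]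

/-- The smallest element, if there is one, is even. -/
def LeastEven (S : Finset ℕ) : Prop := ∀ s ∈ S, (∀ t ∈ S, s ≤ t) → Even s

theorem add_mem_prepend_blockI {m i a : ℕ} {I : Finset ℕ} :
    a + (m + i + 1) ∈ prepend m i (blockI m i) I ↔ a ∈ I := by
  rw [mem_prepend]
  refine ⟨?_, fun h => .inr ⟨a, h, rfl⟩⟩
  rintro (h | ⟨b, hb, h⟩)
  · have := blockI_le _ h; omega
  · rwa [← Nat.add_right_cancel h]

theorem add_mem_prepend_blockJ {m i a : ℕ} {J : Finset ℕ} :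
    a + (m + i + 1) ∈ prepend m i (blockJ m i) J ↔ a ∈ J := by
  rw [mem_prepend]
  refine ⟨?_, fun h => .inr ⟨a, h, rfl⟩⟩
  rintro (h | ⟨b, hb, h⟩)
  · have := blockJ_le _ h; omega
  · rwa [← Nat.add_right_cancel h]

/-- The block ends at m + i, so a next index b + (m + i + 1) has the other parity exactly when b is
even. A block puts zero or two elements into I, so no parity count of elements of I changes. -/
theorem Admissible.prepend_block {m i : ℕ} {I J : Finset ℕ} (h : Admissible I J)
    (he : LeastEven (I ∪ J)) :
    Admissible (prepend m i (blockI m i) I) (prepend m i (blockJ m i) J) := by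
  obtain ⟨h1, h2, h3, h4⟩ := h
  refine ⟨?_, ?_, ?_, ?_⟩
  · rw [Finset.disjoint_left]
    intro a ha ha'
    rcases mem_prepend.mp ha with h | ⟨b, hb, rfl⟩
    · rcases mem_prepend.mp ha' with h' | ⟨b, hb, rfl⟩
      · exact (mem_blockI.mp h).1 (mem_blockJ.mp h').1
      · have := blockI_le _ h; omega
    · exact Finset.disjoint_left.mp h1 hb (add_mem_prepend_blockJ.mp ha')
  · rw [card_prepend_blockI, even_add_block_iff]; exact h2
  · intro j hj
    rcases mem_prepend.mp hj with h | ⟨b, hb, rfl⟩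
    · rw [(mem_blockJ.mp h).2, filter_lt_prepend_self]; simp
    · rw [card_filter_prepend_add, even_add_block_iff]; exact h3 b hb
  · intro a ha b hb hab hc hodd
    rw [mem_prepend_union] at ha hb
    simp only [mem_prepend_union] at hc
    have hlast : a = m + i → Odd (a + b) := by
      rintro rfl
      obtain ⟨b, hbm, rfl⟩ : ∃ b' ∈ I ∪ J, b' + (m + i + 1) = b := by
        rcases hb with h | h | h
        · omega
        · omega
        · exact h
      have hb0 : Even b := he b hbm fun t ht => by
        by_contra hlt
        exact hc (t + (m + i + 1)) (.inr (.inr ⟨t, ht, rfl⟩)) (by omega)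
      obtain ⟨c, rfl⟩ := hb0
      exact ⟨m + i + c, by omega⟩
    rcases ha with rfl | h | ⟨a, ha, rfl⟩
    · rcases Nat.eq_zero_or_pos i with h0 | h0
      · exact hlast (by omega)
      -- The opening index of a pair has no element of I below it, so it falls under the exception
      -- to the parity condition.
      · have := hodd (mem_prepend.mpr (.inl (mem_blockI.mpr ⟨h0.ne', .inl rfl⟩)))
        rw [filter_lt_prepend_self] at this
        simp at this
    · exact hlast h
    · obtain ⟨b, hbm, rfl⟩ : ∃ b' ∈ I ∪ J, b' + (m + i + 1) = b := by
        rcases hb with h | h | h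
        · omega
        · omega
        · exact h
      have := h4 a ha b hbm (by omega) (fun c hcI hac => hc (c + (m + i + 1))
        (.inr (.inr ⟨c, hcI, rfl⟩)) (by omega)) (fun haI => by
          have := hodd (add_mem_prepend_blockI.mpr haI)
          rwa [card_filter_prepend_add, odd_add_block_iff] at this)
      obtain ⟨c, hc⟩ := this
      exact ⟨c + (m + i + 1), by omega⟩

theorem Admissible.of_prepend {m i : ℕ} {I J : Finset ℕ}
    (h : Admissible (prepend m i (blockI m i) I)
      (prepend m i (blockJ m i) J)) :
    Admissible I J ∧ LeastEven (I ∪ J) := by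
  obtain ⟨h1, h2, h3, h4⟩ := h
  simp only [mem_prepend_union] at h4
  refine ⟨⟨?_, ?_, ?_, ?_⟩, ?_⟩
  · rw [Finset.disjoint_left] at h1 ⊢
    intro a ha ha'
    exact h1 (add_mem_prepend_blockI.mpr ha) (add_mem_prepend_blockJ.mpr ha')
  · rwa [card_prepend_blockI, even_add_block_iff] at h2
  · intro j hj
    have := h3 _ (add_mem_prepend_blockJ.mpr hj)
    rwa [card_filter_prepend_add, even_add_block_iff] at this
  · intro a ha b hb hab hc hodd
    obtain ⟨c, hc⟩ := h4 (a + (m + i + 1)) (.inr (.inr ⟨a, ha, rfl⟩)) (b + (m + i + 1))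
      (.inr (.inr ⟨b, hb, rfl⟩)) (by omega) (by
        rintro c (rfl | rfl | ⟨c, hcI, rfl⟩) hac
        · omega
        · omega
        · exact hc c hcI (by omega)) (fun haI => by
          rw [card_filter_prepend_add, odd_add_block_iff]
          exact hodd (add_mem_prepend_blockI.mp haI))
    rw [← Nat.not_even_iff_odd]
    rintro ⟨d, hd⟩
    omega
  · intro s hs hmin
    obtain ⟨c, hc⟩ := h4 (m + i) (.inr (.inl rfl)) (s + (m + i + 1))
      (.inr (.inr ⟨s, hs, rfl⟩)) (by omega) (by
        rintro c (rfl | rfl | ⟨c, hcI, rfl⟩) hac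
        · omega
        · omega
        · have := hmin c hcI
          omega) (fun haI => by
          rw [filter_lt_prepend_end]
          · simp
          · rintro rfl
            rcases mem_prepend.mp haI with h | ⟨b, -, h⟩
            · exact (mem_blockI.mp h).1 rfl
            · omega)
    rw [← Nat.not_odd_iff_even]
    rintro ⟨d, hd⟩
    omega

theorem leastEven_prepend_iff {m i : ℕ} {I J : Finset ℕ} :
    LeastEven (prepend m i (blockI m i) I ∪ prepend m i (blockJ m i) J) ↔ Even m := by
  constructor
  · intro h
    refine h m (mem_prepend_union.mpr (.inl rfl)) fun t ht => ?_
    rcases mem_prepend_union.mp ht with rfl | rfl | ⟨b, -, rfl⟩ <;> omega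
  · intro h s hs hmin
    have h1 := hmin m (mem_prepend_union.mpr (.inl rfl))
    rcases mem_prepend_union.mp hs with rfl | rfl | ⟨b, -, rfl⟩
    · exact h
    · rwa [show m + i = m by omega]
    · omega

/-- If the minimum lies in J, it is a block by itself. If it lies in I, its partner is the next
element of I; no element of J comes before the partner, since exactly one element of I would lie
below it. -/
theorem Admissible.exists_prepend {I' J' : Finset ℕ} (h : Admissible I' J')
    (hne : (I' ∪ J').Nonempty) : ∃ m i I J, I' = prepend m i (blockI m i) I ∧
      J' = prepend m i (blockJ m i) J := by
  obtain ⟨h1, h2, h3, -⟩ := h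
  obtain ⟨m, hmem, hle⟩ : ∃ m ∈ I' ∪ J', ∀ a ∈ I' ∪ J', m ≤ a :=
    ⟨_, Finset.min'_mem _ hne, fun a ha => Finset.min'_le _ _ ha⟩
  have hI : ∀ a ∈ I', m ≤ a := fun a ha => hle a (Finset.mem_union_left _ ha)
  have hJ : ∀ a ∈ J', m ≤ a := fun a ha => hle a (Finset.mem_union_right _ ha)
  by_cases hmJ : m ∈ J'
  · have hmI : m ∉ I' := Finset.disjoint_right.mp h1 hmJ
    obtain ⟨I, rfl⟩ : ∃ I, shift (m + 0 + 1) I = I' := exists_shift_eq fun a ha => by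
      have := hI a ha
      have : a ≠ m := fun h => hmI (h ▸ ha)
      omega
    obtain ⟨J, hJe⟩ : ∃ J, shift (m + 0 + 1) J = J'.erase m := exists_shift_eq fun a ha => by
      have := hJ a (Finset.mem_of_mem_erase ha)
      have := Finset.ne_of_mem_erase ha
      omega
    refine ⟨m, 0, I, J, ?_, ?_⟩
    · simp [prepend, blockI]
    · rw [prepend, hJe, blockJ, if_pos rfl, ← Finset.insert_eq, Finset.insert_erase hmJ]
  · have hmI : m ∈ I' := (Finset.mem_union.mp hmem).resolve_right hmJ
    have hne' : (I'.erase m).Nonempty := by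
      rw [← Finset.card_pos, Finset.card_erase_of_mem hmI]
      have := Finset.card_pos.mpr ⟨m, hmI⟩
      obtain ⟨c, hc⟩ := h2
      omega
    obtain ⟨b, hbmem, hbmin⟩ : ∃ b ∈ I'.erase m, ∀ a ∈ I'.erase m, b ≤ a :=
      ⟨_, Finset.min'_mem _ hne', fun a ha => Finset.min'_le _ _ ha⟩
    have hbI := Finset.mem_of_mem_erase hbmem
    have hbm := Finset.ne_of_mem_erase hbmem
    have hmb := hI b hbI
    obtain ⟨i, rfl⟩ := Nat.exists_eq_add_of_le hmb
    have hi : i ≠ 0 := by rintro rfl; exact hbm rfl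
    obtain ⟨I, hIe⟩ : ∃ I, shift (m + i + 1) I = (I'.erase m).erase (m + i) :=
      exists_shift_eq fun a ha => by
        have := hbmin a (Finset.mem_of_mem_erase ha)
        have := Finset.ne_of_mem_erase ha
        omega
    obtain ⟨J, hJe⟩ : ∃ J, shift (m + i + 1) J = J' := exists_shift_eq fun a ha => by
      by_contra hlt
      have h5 := h3 a ha
      have h6 : I'.filter (· < a) = {m} := by
        ext c
        simp only [Finset.mem_filter, Finset.mem_singleton]
        constructor
        · rintro ⟨hc, hca⟩
          by_contra hcm
          have h7 := hbmin c (Finset.mem_erase.mpr ⟨hcm, hc⟩)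
          omega
        · intro hcm
          rw [hcm]
          have h8 := hJ a ha
          have : a ≠ m := fun h => hmJ (h ▸ ha)
          exact ⟨hmI, by omega⟩
      rw [h6] at h5
      simp at h5
    refine ⟨m, i, I, J, ?_, ?_⟩
    · rw [prepend, hIe, blockI, if_neg hi, Finset.insert_union, ← Finset.insert_eq,
        Finset.insert_erase hbmem, Finset.insert_erase hmI]
    · simp [prepend, blockJ, hi, hJe]

theorem prepend_injective {m i m' i' : ℕ} {I J I' J' : Finset ℕ}
    (hI : prepend m i (blockI m i) I = prepend m' i' (blockI m' i') I')
    (hJ : prepend m i (blockJ m i) J = prepend m' i' (blockJ m' i') J') :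
    m = m' ∧ i = i' ∧ I = I' ∧ J = J' := by
  have hm : m = m' := by
    have h1 := (mem_prepend_union (m := m) (i := i) (a := m) (I := I) (J := J)).mpr (.inl rfl)
    have h2 := (mem_prepend_union (m := m') (i := i') (a := m') (I := I') (J := J')).mpr (.inl rfl)
    rw [hI, hJ, mem_prepend_union] at h1
    rw [← hI, ← hJ, mem_prepend_union] at h2
    rcases h1 with h | h | ⟨b, -, h⟩ <;> rcases h2 with h' | h' | ⟨b', -, h'⟩ <;> omega
  subst hm
  -- A shorter block of the second system would end strictly inside the first block, where the first
  -- system has no index; for i' = 0 the minimum would lie in J on one side only.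
  have key : ∀ {i i' : ℕ} {I J I' J' : Finset ℕ},
      prepend m i (blockI m i) I = prepend m i' (blockI m i') I' →
      prepend m i (blockJ m i) J = prepend m i' (blockJ m i') J' → i ≤ i' := by
    intro i i' I J I' J' hI hJ
    by_contra! hlt
    rcases Nat.eq_zero_or_pos i' with h0 | h0
    · subst h0
      have h1 : m ∈ prepend m 0 (blockJ m 0) J' :=
        mem_prepend.mpr (.inl (mem_blockJ.mpr ⟨rfl, rfl⟩))
      rw [← hJ] at h1
      rcases mem_prepend.mp h1 with h | ⟨b, -, h⟩
      · have := (mem_blockJ.mp h).1; omega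
      · omega
    · have h1 : m + i' ∈ prepend m i' (blockI m i') I' :=
        mem_prepend.mpr (.inl (mem_blockI.mpr ⟨h0.ne', .inr rfl⟩))
      rw [← hI] at h1
      rcases mem_prepend.mp h1 with h | ⟨b, -, h⟩
      · have := (mem_blockI.mp h).2; omega
      · omega
  have hi : i = i' := le_antisymm (key hI hJ) (key hI.symm hJ.symm)
  subst hi
  refine ⟨rfl, rfl, ?_, ?_⟩
  · ext a; rw [← add_mem_prepend_blockI (m := m) (i := i), hI, add_mem_prepend_blockI]
  · ext a; rw [← add_mem_prepend_blockJ (m := m) (i := i), hJ, add_mem_prepend_blockJ]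

/-- For the parity conditions the last index j behaves like an element of J. So triples inherit the
decomposition of pairs into blocks. -/
theorem admissibleTriple_iff {I J : Finset ℕ} {j : ℕ} :
    AdmissibleTriple I J j ↔ Admissible I (insert j J) ∧ ∀ a ∈ I ∪ J, a < j := by
  constructor
  · rintro ⟨⟨h1, h2, h3, h4⟩, hlt, hodd⟩
    have hjI : j ∉ I := fun h => (hlt j (Finset.mem_union_left _ h)).false
    refine ⟨⟨Finset.disjoint_insert_right.mpr ⟨hjI, h1⟩, h2, ?_, ?_⟩, hlt⟩
    · intro a ha
      rcases Finset.mem_insert.mp ha with rfl | ha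
      · rwa [Finset.filter_true_of_mem fun b hb => hlt b (Finset.mem_union_left _ hb)]
      · exact h3 a ha
    · rw [Finset.union_insert]
      intro a ha b hb hab hc hex
      rcases Finset.mem_insert.mp ha with rfl | ha'
      · rcases Finset.mem_insert.mp hb with rfl | hb
        · omega
        · have := hlt b hb; omega
      · rcases Finset.mem_insert.mp hb with rfl | hb
        · refine hodd a ha' fun c hcI => ?_
          by_contra! hac
          exact hc c (Finset.mem_insert_of_mem hcI) ⟨hac, hlt c hcI⟩
        · exact h4 a ha' b hb hab (fun c hcI => hc c (Finset.mem_insert_of_mem hcI)) hex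
  · rintro ⟨⟨h1, h2, h3, h4⟩, hlt⟩
    rw [Finset.union_insert] at h4
    refine ⟨⟨(Finset.disjoint_insert_right.mp h1).2, h2,
      fun a ha => h3 a (Finset.mem_insert_of_mem ha), ?_⟩, hlt, ?_⟩
    · intro a ha b hb hab hc hex
      refine h4 a (Finset.mem_insert_of_mem ha) b (Finset.mem_insert_of_mem hb) hab ?_ hex
      intro c hcI
      rcases Finset.mem_insert.mp hcI with rfl | hcI
      · have := hlt b hb; omega
      · exact hc c hcI
    · intro a ha hmax
      refine h4 a (Finset.mem_insert_of_mem ha) j (Finset.mem_insert_self _ _) (hlt a ha) ?_ ?_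
      · intro c hcI
        rcases Finset.mem_insert.mp hcI with rfl | hcI
        · omega
        · have := hmax c hcI; omega
      · intro haI
        have : I.filter (· < a) = I.erase a := by
          ext c
          simp only [Finset.mem_filter, Finset.mem_erase]
          refine ⟨fun ⟨h, h'⟩ => ⟨h'.ne, h⟩, fun ⟨h, h'⟩ => ⟨h', ?_⟩⟩
          have := hmax c (Finset.mem_union_left _ h')
          omega
        -- The maximum a has #I - 1 elements of I below it, an odd number: it closes its pair, so
        -- the exception for opening indices does not apply.
        rw [this, Finset.card_erase_of_mem haI]
        have := Finset.card_pos.mpr ⟨a, haI⟩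
        obtain ⟨c, hc⟩ := h2
        exact ⟨c - 1, by omega⟩

theorem minEven_iff {S : Finset ℕ} : MinEven S ↔ S.Nonempty ∧ LeastEven S := by
  constructor
  · rintro ⟨s, hs, he, hmin⟩
    refine ⟨⟨s, hs⟩, fun t ht htmin => ?_⟩
    rwa [le_antisymm (htmin s hs) (hmin t ht)]
  · rintro ⟨hne, h⟩
    exact ⟨S.min' hne, S.min'_mem hne, h _ (S.min'_mem hne) fun t ht => S.min'_le t ht,
      fun t ht => S.min'_le t ht⟩

end

/-! ### Admissible systems of given length -/

section

/-- The admissible pairs of length `n` that are empty or have even minimum. -/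
def Pairs (n : ℕ) : Type :=
  {S : Finset ℕ × Finset ℕ // Admissible S.1 S.2 ∧ len S.1 S.2 = n ∧ LeastEven (S.1 ∪ S.2)}

theorem len_eq_zero_iff {I J : Finset ℕ} (h : Admissible I J) : len I J = 0 ↔ I ∪ J = ∅ := by
  rw [Finset.union_eq_empty, ← Finset.card_eq_zero, ← Finset.card_eq_zero, len]
  obtain ⟨c, hc⟩ := h.2.1
  omega

theorem union_nonempty_of_len {I J : Finset ℕ} (h : Admissible I J) {n : ℕ}
    (hn : len I J = n + 1) : (I ∪ J).Nonempty := by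
  rw [Finset.nonempty_iff_ne_empty, Ne, ← len_eq_zero_iff h]
  omega

theorem len_le_card {I J : Finset ℕ} (h : Admissible I J) : len I J ≤ (I ∪ J).card := by
  rw [Finset.card_union_of_disjoint h.1, len]
  omega

/-- A system of length n + 1 has at least n + 1 indices, so they do not all lie below n. This makes
the series of length n vanish to order at least n, which is what lets the sum over the digits
converge. -/
theorem exists_len_le {I J : Finset ℕ} (h : Admissible I J) {n : ℕ}
    (hn : len I J = n + 1) : ∃ s ∈ I ∪ J, n ≤ s := by
  by_contra! hcon
  have h1 : I ∪ J ⊆ Finset.range n := fun s hs => Finset.mem_range.mpr (hcon s hs)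
  have h2 := Finset.card_le_card h1
  have h3 := len_le_card h
  rw [Finset.card_range] at h2
  omega

theorem admissible_empty : Admissible ∅ ∅ := by simp [Admissible]

theorem leastEven_empty : LeastEven ∅ := by simp [LeastEven]

/-- The empty pair. -/
def emptyPair : Pairs 0 :=
  ⟨(∅, ∅), admissible_empty, by simp [len], by rw [Finset.union_empty]; exact leastEven_empty⟩

theorem eq_emptyPair (S : Pairs 0) : S = emptyPair := by
  obtain ⟨⟨I, J⟩, h, hn, -⟩ := S
  have h1 := (len_eq_zero_iff h).mp hn
  rw [Finset.union_eq_empty] at h1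
  obtain ⟨h2, h3⟩ := h1
  simp only at h2 h3
  subst h2 h3
  rfl

/-- The admissible pair obtained by putting a block in front. -/
def prependPair (n : ℕ) (x : ℕ × ℕ × Pairs n) : Pairs (n + 1) :=
  ⟨(prepend (2 * x.1) x.2.1 (blockI (2 * x.1) x.2.1) x.2.2.1.1,
    prepend (2 * x.1) x.2.1 (blockJ (2 * x.1) x.2.1) x.2.2.1.2),
   x.2.2.2.1.prepend_block x.2.2.2.2.2, by rw [len_prepend, x.2.2.2.2.1],
   leastEven_prepend_iff.mpr (even_two_mul _)⟩

/-- The combinatorial form of the recursion: the start 2r and the width i of the first block are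
free, and what remains is an arbitrary shorter system, empty or with even minimum. -/
theorem prependPair_bijective (n : ℕ) : Function.Bijective (prependPair n) := by
  constructor
  · rintro ⟨r, i, ⟨I, J⟩, hS⟩ ⟨r', i', ⟨I', J'⟩, hS'⟩ h
    have h0 := congrArg Subtype.val h
    obtain ⟨h1, h2⟩ := Prod.mk.inj h0
    obtain ⟨h3, rfl, rfl, rfl⟩ := prepend_injective h1 h2
    obtain rfl : r = r' := by simpa using h3
    rfl
  · rintro ⟨⟨I', J'⟩, hS, hn, he⟩
    obtain ⟨m, i, I, J, h1, h2⟩ := hS.exists_prepend (union_nonempty_of_len hS hn)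
    simp only at h1 h2
    subst h1 h2
    obtain ⟨r, hr⟩ := leastEven_prepend_iff.mp he
    obtain rfl : m = 2 * r := by omega
    rw [len_prepend] at hn
    obtain ⟨h3, h4⟩ := Admissible.of_prepend hS
    exact ⟨(r, i, ⟨(I, J), h3, Nat.add_right_cancel hn, h4⟩), rfl⟩

/-- The two descriptions of the nonempty admissible pairs. -/
def pairsEquiv (n : ℕ) : PairsEven (n + 1) ≃ Pairs (n + 1) :=
  Equiv.subtypeEquivRight fun S => by
    constructor
    · exact fun ⟨h1, h2, h3⟩ => ⟨h1, h2, (minEven_iff.mp h3).2⟩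
    · exact fun ⟨h1, h2, h3⟩ => ⟨h1, h2, minEven_iff.mpr ⟨union_nonempty_of_len h1 h2, h3⟩⟩

theorem insert_last_prepend {m i j : ℕ} {J : Finset ℕ} :
    insert (j + (m + i + 1)) (prepend m i (blockJ m i) J) =
      prepend m i (blockJ m i) (insert j J) := by
  rw [prepend, prepend, shift_insert, Finset.union_insert]

theorem len_insert {I J : Finset ℕ} {j : ℕ} (h : ∀ a ∈ I ∪ J, a < j) :
    len I (insert j J) = 1 + len I J := by
  rw [len, len, Finset.card_insert_of_notMem fun hj =>
    (h j (Finset.mem_union_right _ hj)).false]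
  omega

/-- A triple `(I, J, j)` is an admissible pair `(I, J ∪ {j})` in which `j` is the maximum. -/
theorem triplesEven_iff {I J : Finset ℕ} {j n : ℕ} :
    (AdmissibleTriple I J j ∧ 1 + len I J = n ∧ MinEven (insert j (I ∪ J))) ↔
      (∀ a ∈ I ∪ J, a < j) ∧ Admissible I (insert j J) ∧ len I (insert j J) = n ∧
        LeastEven (I ∪ insert j J) := by
  rw [admissibleTriple_iff, minEven_iff, Finset.union_insert]
  constructor
  · rintro ⟨⟨h1, h2⟩, h3, -, h4⟩
    exact ⟨h2, h1, by rw [len_insert h2, h3], h4⟩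
  · rintro ⟨h2, h1, h3, h4⟩
    exact ⟨⟨h1, h2⟩, by rw [← len_insert h2, h3], Finset.insert_nonempty _ _, h4⟩

/-- The admissible triple obtained by putting a block in front. -/
def prependTriple (n : ℕ) (x : ℕ × ℕ × TriplesEven n) : TriplesEven (n + 1) :=
  ⟨(prepend (2 * x.1) x.2.1 (blockI (2 * x.1) x.2.1) x.2.2.1.1,
    prepend (2 * x.1) x.2.1 (blockJ (2 * x.1) x.2.1) x.2.2.1.2.1,
    x.2.2.1.2.2 + (2 * x.1 + x.2.1 + 1)), by
  obtain ⟨r, i, ⟨I, J, j⟩, hS⟩ := x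
  simp only
  rw [triplesEven_iff] at hS ⊢
  obtain ⟨h1, h2, h3, h4⟩ := hS
  rw [insert_last_prepend]
  refine ⟨fun a ha => ?_, h2.prepend_block h4, by rw [len_prepend, h3],
    leastEven_prepend_iff.mpr (even_two_mul _)⟩
  rcases mem_prepend_union.mp ha with rfl | rfl | ⟨b, hb, rfl⟩
  · omega
  · omega
  · have := h1 b hb; simp only at this; omega⟩

/-- Only lengths at least 2 occur on the right: then the first block is not the last index j, and j
moves along with the rest. Length 1 is `singleTriple_bijective`. -/
theorem prependTriple_bijective (n : ℕ) : Function.Bijective (prependTriple (n + 1)) := by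
  constructor
  · rintro ⟨r, i, ⟨I, J, j⟩, hS⟩ ⟨r', i', ⟨I', J', j'⟩, hS'⟩ h
    have h0 := congrArg Subtype.val h
    obtain ⟨h1, h2⟩ := Prod.mk.inj h0
    obtain ⟨h2, h5⟩ := Prod.mk.inj h2
    obtain ⟨h3, rfl, rfl, rfl⟩ := prepend_injective h1 h2
    obtain rfl : r = r' := by simpa using h3
    obtain rfl : j = j' := by simpa using h5
    rfl
  · rintro ⟨⟨I', J', j'⟩, hS0⟩
    have hS := hS0
    rw [triplesEven_iff] at hS
    obtain ⟨hlt, hadm, hlen, heven⟩ := hS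
    obtain ⟨m, i, I, K, h1, h2⟩ := hadm.exists_prepend (union_nonempty_of_len hadm hlen)
    simp only at h1 h2 hlt
    rw [h1, h2] at hadm hlen heven
    obtain ⟨r, hr⟩ := leastEven_prepend_iff.mp heven
    obtain rfl : m = 2 * r := by omega
    rw [len_prepend] at hlen
    obtain ⟨h3, h4⟩ := Admissible.of_prepend hadm
    -- The rest is nonempty, so j' exceeds an index above the first block and belongs to the
    -- translated part.
    obtain ⟨s, hs⟩ := union_nonempty_of_len h3 (Nat.add_right_cancel hlen)
    have hj' : ∀ a ∈ I' ∪ insert j' J', a ≤ j' := by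
      rw [Finset.union_insert]
      intro a ha
      rcases Finset.mem_insert.mp ha with rfl | ha
      · exact le_rfl
      · exact (hlt a ha).le
    have hle : ∀ a ∈ I ∪ K, a + (2 * r + i + 1) ≤ j' := fun a ha => hj' _ (by
      rw [h1, h2]; exact mem_prepend_union.mpr (.inr (.inr ⟨a, ha, rfl⟩)))
    have hjmem : j' ∈ prepend (2 * r) i (blockJ (2 * r) i) K := by
      rw [← h2]; exact Finset.mem_insert_self _ _
    obtain ⟨j, hjK, rfl⟩ : ∃ j ∈ K, j + (2 * r + i + 1) = j' := by
      rcases mem_prepend.mp hjmem with h | h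
      · have := blockJ_le _ h
        have := hle s hs
        omega
      · exact h
    have hjJ : j + (2 * r + i + 1) ∉ J' := fun h =>
      (hlt _ (Finset.mem_union_right _ h)).false
    have hK : insert j (K.erase j) = K := Finset.insert_erase hjK
    have hJ' : J' = prepend (2 * r) i (blockJ (2 * r) i) (K.erase j) := by
      rw [← hK, ← insert_last_prepend] at h2
      rw [← Finset.erase_insert hjJ, h2, Finset.erase_insert]
      rw [add_mem_prepend_blockJ]
      exact Finset.notMem_erase _ _
    have hT : AdmissibleTriple I (K.erase j) j ∧ 1 + len I (K.erase j) = n + 1 ∧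
        MinEven (insert j (I ∪ K.erase j)) := by
      rw [triplesEven_iff, hK]
      refine ⟨fun a ha => ?_, h3, Nat.add_right_cancel hlen, h4⟩
      have hak : a ∈ I ∪ K := Finset.union_subset_union_right (Finset.erase_subset _ _) ha
      have h5 := hle a hak
      have h6 : a ≠ j := by
        rintro rfl
        rcases Finset.mem_union.mp ha with h | h
        · exact Finset.disjoint_left.mp h3.1 h hjK
        · exact Finset.notMem_erase _ _ h
      omega
    refine ⟨(r, i, ⟨(I, K.erase j, j), hT⟩), Subtype.ext ?_⟩
    exact Prod.ext h1.symm (Prod.ext hJ'.symm rfl)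

/-- The triple `(∅, ∅, 2 r)`. -/
def singleTriple (r : ℕ) : TriplesEven 1 :=
  ⟨(∅, ∅, 2 * r), ⟨admissible_empty, by simp, by simp⟩, by simp [len],
    ⟨2 * r, by simp, even_two_mul _, by simp⟩⟩

theorem singleTriple_bijective : Function.Bijective singleTriple := by
  constructor
  · intro r r' h
    have := congrArg (fun S => S.1.2.2) h
    simpa [singleTriple] using this
  · rintro ⟨⟨I, J, j⟩, h, hlen, hm⟩
    have h1 := (len_eq_zero_iff h.1).mp (by simp only at hlen ⊢; omega)
    rw [Finset.union_eq_empty] at h1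
    obtain ⟨h2, h3⟩ := h1
    simp only at h2 h3
    subst h2 h3
    obtain ⟨s, hs, he, -⟩ := hm
    obtain rfl : s = j := by simpa using hs
    obtain ⟨r, rfl⟩ := he
    refine ⟨r, Subtype.ext ?_⟩
    simp [singleTriple, two_mul]

end

/-! ### Reduction modulo `p` and blocks -/

section

open MvPowerSeries

theorem map_ringInverse {A B : Type*} [CommRing A] [CommRing B] (f : A →+* B) {a : A}
    (ha : IsUnit a) : f (Ring.inverse a) = Ring.inverse (f a) := by
  obtain ⟨u, rfl⟩ := ha
  rw [Ring.inverse_unit]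
  exact (Ring.inverse_unit (Units.map (f : A →* B) u)).symm

section Sigma
variable (p : ℕ) [Fact p.Prime]

theorem sigma_C (a : W p) : sigma p (C a) = C (WittVector.frobenius a) := by
  simp [sigma, expand_C]

theorem modP_C (a : W p) : modP p (C a) = C (WittVector.constantCoeff a) := by
  simp [modP]

theorem modP_X (i : Fin 3) : modP p (X i) = X i := by simp [modP]

theorem coeff_modP (f : WXYZ p) (m : Fin 3 →₀ ℕ) :
    coeff m (modP p f) = WittVector.constantCoeff (coeff m f) := by
  simp [modP]

theorem modP_sigma (f : WXYZ p) : modP p (sigma p f) = modP p f ^ p := by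
  have h : (WittVector.constantCoeff : W p →+* BaseField p).comp WittVector.frobenius =
      (frobenius (BaseField p) p).comp WittVector.constantCoeff := by
    ext a
    simp [WittVector.constantCoeff_apply, WittVector.coeff_frobenius_charP, frobenius_def]
  rw [← map_frobenius_expand p (Fact.out : p.Prime).ne_zero, modP, sigma, RingHom.comp_apply,
    MvPowerSeries.map_map, h, ← MvPowerSeries.map_map, RingHom.coe_coe, map_expand]

theorem modP_sigma_iterate (f : WXYZ p) (n : ℕ) :
    modP p ((sigma p)^[n] f) = modP p f ^ p ^ n := by
  induction n with
  | zero => simp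
  | succ n ih => rw [Function.iterate_succ_apply', modP_sigma, ih, ← pow_mul, pow_succ]

theorem sigma_mem_ordIdeal {f : WXYZ p} {n : ℕ} (hf : f ∈ ordIdeal (Fin 3) (W p) n) :
    sigma p f ∈ ordIdeal (Fin 3) (W p) (p * n) := by
  have h1 : ((p * n : ℕ) : ℕ∞) ≤ (expand p (Fact.out : p.Prime).ne_zero f).order := by
    rw [order_expand, nsmul_eq_mul, Nat.cast_mul]
    exact mul_le_mul_right hf _
  exact h1.trans (le_order_map (WittVector.frobenius (p := p) (R := BaseField p)))

theorem sigma_iterate_mem_ordIdeal {f : WXYZ p} {n : ℕ} (hf : f ∈ ordIdeal (Fin 3) (W p) n)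
    (s : ℕ) : (sigma p)^[s] f ∈ ordIdeal (Fin 3) (W p) (p ^ s * n) := by
  induction s with
  | zero => simpa using hf
  | succ s ih =>
    rw [Function.iterate_succ_apply', pow_succ', mul_assoc]
    exact sigma_mem_ordIdeal p ih

/-- The crude bound s + 1 ≤ p^s is enough: a system using the index s contributes only in degrees
above s, so finitely many systems meet a given monomial. -/
theorem sigma_iterate_mem_ordIdeal_succ {f : WXYZ p} (hf : f ∈ ordIdeal (Fin 3) (W p) 1)
    (s : ℕ) : (sigma p)^[s] f ∈ ordIdeal (Fin 3) (W p) (s + 1) := by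
  refine ordIdeal_anti ?_ (sigma_iterate_mem_ordIdeal p hf s)
  have := Nat.lt_pow_self (Fact.out : p.Prime).one_lt (n := s)
  omega

variable [TopologicalSpace (BaseField p)]
open scoped MvPowerSeries.WithPiTopology

theorem hasSum_modP_formalSum {ι : Type*} {f : ι → WXYZ p}
    (hf : ∀ m, {i | coeff m (f i) ≠ 0}.Finite) :
    HasSum (fun i => modP p (f i)) (modP p (formalSum p f)) := by
  refine hasSum_of_finite_coeff (fun m => (hf m).subset fun i hi h0 => hi ?_) fun m => ?_
  · rw [coeff_modP, h0, map_zero]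
  · simp only [coeff_modP]
    exact (WittVector.constantCoeff : W p →+* BaseField p).toAddMonoidHom.map_finsum (hf m)

end Sigma

section Blocks
variable (p : ℕ) [Fact p.Prime] (lam : W p)

theorem mem_matrix_prod {A ι : Type*} [CommRing A] [Fintype ι] [DecidableEq ι] (I : Ideal A)
    {L : List (Matrix ι ι A)} {M : Matrix ι ι A} (hM : M ∈ L) (h : ∀ r c, M r c ∈ I) (r c : ι) :
    L.prod r c ∈ I := by
  obtain ⟨s, t, rfl⟩ := List.append_of_mem hM
  rw [List.prod_append, List.prod_cons, Matrix.mul_apply]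
  refine sum_mem fun j _ => I.mul_mem_left _ ?_
  rw [Matrix.mul_apply]
  exact sum_mem fun j' _ => I.mul_mem_right _ (h _ _)

theorem beta_mem_ordIdeal : beta (C lam) (X 0) (X 1) (X 2) ∈ ordIdeal (Fin 3) (W p) 1 :=
  add_mem (Ideal.mul_mem_right _ _ (X_mem_ordIdeal _))
    (Ideal.mul_mem_right _ _ (ordIdeal_anti one_le_two (X_pow_mem_ordIdeal _ _)))

theorem twE_mem_ordIdeal (s : ℕ) (r c : Fin 2) :
    twE p lam s r c ∈ ordIdeal (Fin 3) (W p) (s + 1) := by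
  refine sigma_iterate_mem_ordIdeal_succ p ?_ s
  rw [blockE, Matrix.smul_apply, smul_eq_mul]
  exact Ideal.mul_mem_right _ _ (beta_mem_ordIdeal p lam)

theorem twC_mem_ordIdeal (s : ℕ) (r : Fin 2) (c : Fin 3) :
    twC p lam s r c ∈ ordIdeal (Fin 3) (W p) (s + 1) := by
  refine sigma_iterate_mem_ordIdeal_succ p ?_ s
  fin_cases r <;> fin_cases c
  · exact Ideal.mul_mem_right _ _ (X_mem_ordIdeal _)
  · exact Ideal.mul_mem_right _ _ (X_mem_ordIdeal _)
  · exact Ideal.mul_mem_right _ _ (X_mem_ordIdeal _)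
  · exact X_mem_ordIdeal _
  · exact X_mem_ordIdeal _
  · exact X_mem_ordIdeal _

theorem twB_mem_ordIdeal (s : ℕ) (r : Fin 3) (c : Fin 2) :
    twB p lam s r c ∈ ordIdeal (Fin 3) (W p) (s + 1) := by
  refine sigma_iterate_mem_ordIdeal_succ p ?_ s
  fin_cases r <;> fin_cases c
  · exact Ideal.mul_mem_left _ _ (X_mem_ordIdeal _)
  · exact neg_mem (X_mem_ordIdeal _)
  · exact Ideal.mul_mem_left _ _ (X_mem_ordIdeal _)
  · exact neg_mem (X_mem_ordIdeal _)
  · exact Ideal.mul_mem_right _ _ (Ideal.mul_mem_left _ _ (X_mem_ordIdeal _))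
  · exact neg_mem (Ideal.mul_mem_right _ _ (X_mem_ordIdeal _))

theorem factor_mem_ordIdeal (I J : Finset ℕ) (s : ℕ) (r c : Fin 2 ⊕ Fin 3) :
    factor p lam I J s r c ∈ ordIdeal (Fin 3) (W p) (s + 1) := by
  unfold factor
  split_ifs <;> rcases r with r | r <;> rcases c with c | c <;>
    simp [twE_mem_ordIdeal, twC_mem_ordIdeal, twB_mem_ordIdeal]

theorem matA_mem_ordIdeal {I J : Finset ℕ} {s : ℕ} (hs : s ∈ I ∪ J) (r c : Fin 2) :
    matA p lam I J r c ∈ ordIdeal (Fin 3) (W p) (s + 1) :=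
  mem_matrix_prod _ (List.mem_map.mpr ⟨s, (Finset.mem_sort _).mpr hs, rfl⟩)
    (factor_mem_ordIdeal p lam I J s) _ _

theorem tw_add {ι κ : Type*} (M : Matrix ι κ (WXYZ p)) (s d : ℕ) :
    M.map ((sigma p)^[s + d]) = (M.map ((sigma p)^[s])).map ((sigma p)^[d]) := by
  ext i j : 2
  simp only [Matrix.map_apply]
  rw [add_comm, Function.iterate_add_apply]

theorem factor_prepend (m i : ℕ) (I J : Finset ℕ) (s : ℕ) :
    factor p lam (prepend m i (blockI m i) I) (prepend m i (blockJ m i) J) (s + (m + i + 1)) =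
      (factor p lam I J s).map ((sigma p)^[m + i + 1]) := by
  unfold factor
  rw [card_filter_prepend_add]
  simp only [add_mem_prepend_blockJ, even_add_block_iff]
  split_ifs <;>
    simp [Matrix.fromBlocks_map, twE, twC, twB, tw_add p]

/-- The product of the factors of a block that starts at `m` and ends at `m + i`. -/
def blockMat (m i : ℕ) : Matrix (Fin 2) (Fin 2) (WXYZ p) :=
  if i = 0 then twE p lam m else twC p lam m * twB p lam (m + i)

theorem sort_shift (d : ℕ) (S : Finset ℕ) :
    (shift d S).sort (· ≤ ·) = (S.sort (· ≤ ·)).map (· + d) := by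
  induction S using Finset.induction_on_min with
  | empty => rw [shift, Finset.map_empty, Finset.sort_empty, List.map_nil]
  | insert a S ha ih =>
    rw [shift_insert, Finset.sort_insert _ (fun b hb => (ha b hb).le) fun h => (ha a h).false,
      Finset.sort_insert, ih, List.map_cons]
    · intro b hb
      obtain ⟨c, hc, rfl⟩ := mem_shift.mp hb
      have := ha c hc
      omega
    · rw [add_mem_shift]
      exact fun h => (ha a h).false

theorem prepend_union_eq (m i : ℕ) (I J : Finset ℕ) :
    prepend m i (blockI m i) I ∪ prepend m i (blockJ m i) J =
      insert m (insert (m + i) (shift (m + i + 1) (I ∪ J))) := by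
  ext a
  rw [mem_prepend_union, Finset.mem_insert, Finset.mem_insert, mem_shift]

/-- Translating all indices by d applies σ^d to every factor, hence to the product. -/
theorem matA_prepend (m i : ℕ) (I J : Finset ℕ) :
    matA p lam (prepend m i (blockI m i) I) (prepend m i (blockJ m i) J) =
      blockMat p lam m i * (matA p lam I J).map ((sigma p)^[m + i + 1]) := by
  classical
  have hsort : (insert (m + i) (shift (m + i + 1) (I ∪ J))).sort (· ≤ ·) =
      (m + i) :: ((I ∪ J).sort (· ≤ ·)).map (· + (m + i + 1)) := by
    rw [Finset.sort_insert, sort_shift]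
    · intro b hb
      have := le_of_mem_shift hb; omega
    · intro hb
      have := le_of_mem_shift hb; omega
  have hprod : ((((I ∪ J).sort (· ≤ ·)).map (· + (m + i + 1))).map
      (factor p lam (prepend m i (blockI m i) I) (prepend m i (blockJ m i) J))).prod =
      ((((I ∪ J).sort (· ≤ ·)).map (factor p lam I J)).prod).map ((sigma p)^[m + i + 1]) := by
    have h1 := map_list_prod ((sigma p ^ (m + i + 1)).mapMatrix
      (m := Fin 2 ⊕ Fin 3)) (((I ∪ J).sort (· ≤ ·)).map (factor p lam I J))
    rw [RingHom.mapMatrix_apply, RingHom.coe_pow] at h1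
    rw [h1, List.map_map, List.map_map]
    congr 2
    funext s
    simp only [Function.comp_apply, factor_prepend, RingHom.mapMatrix_apply, RingHom.coe_pow]
  unfold matA
  rw [prepend_union_eq]
  generalize hP : (((I ∪ J).sort (· ≤ ·)).map (factor p lam I J)).prod = P at hprod
  rw [← Matrix.fromBlocks_toBlocks P, Matrix.fromBlocks_map] at hprod
  by_cases hi : i = 0
  · subst hi
    rw [add_zero] at hsort hprod ⊢
    rw [Finset.insert_idem, hsort, List.map_cons, List.prod_cons, hprod, factor, if_pos]
    · rw [Matrix.fromBlocks_multiply, Matrix.toBlocks_fromBlocks₁₁, blockMat, if_pos rfl,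
        Matrix.zero_mul, add_zero]
    · exact mem_prepend.mpr (.inl (mem_blockJ.mpr ⟨rfl, rfl⟩))
  · have hJ : ∀ a, a ≤ m + i → a ∉ prepend m i (blockJ m i) J := by
      intro a ha hmem
      rcases mem_prepend.mp hmem with h | ⟨b, -, h⟩
      · exact hi (mem_blockJ.mp h).1
      · omega
    rw [Finset.sort_insert, hsort, List.map_cons, List.map_cons, List.prod_cons, List.prod_cons,
      hprod, factor, if_neg (hJ m (by omega)), if_pos, factor, if_neg (hJ _ le_rfl), if_neg]
    · simp [Matrix.fromBlocks_multiply, blockMat, hi, Matrix.mul_assoc]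
    · rw [filter_lt_prepend_end hi]; simp
    · rw [filter_lt_prepend_self]; simp
    · intro b hb
      rcases Finset.mem_insert.mp hb with rfl | hb
      · omega
      · have := le_of_mem_shift hb; omega
    · intro hb
      rcases Finset.mem_insert.mp hb with h | hb
      · omega
      · have := le_of_mem_shift hb; omega

theorem matA_empty : matA p lam ∅ ∅ = 1 := by
  rw [matA, Finset.union_empty, Finset.sort_empty, List.map_nil, List.prod_nil,
    ← Matrix.fromBlocks_one, Matrix.toBlocks_fromBlocks₁₁]

end Blocks

end

/-! ### Blocks of rank one -/

section

open MvPowerSeries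

/-! ### The recursion for the series -/

section Entries
variable (p : ℕ) [Fact p.Prime] (lam : W p)

/-- The scalar of a block that starts at `0` and ends at `i`, over `W`. -/
def blockScalar (i : ℕ) : WXYZ p :=
  if i = 0 then beta (C lam) (X 0) (X 1) (X 2) else
    Ring.inverse (C lam) * (sigma p)^[i] (C lam) *
      (X 0 * (sigma p)^[i] (X 1) + X 1 * (sigma p)^[i] (X 0) +
        X 2 * (sigma p)^[i] (X 2 * Ring.inverse (2 * C lam ^ 2)))

variable {p lam}

theorem isUnit_C (hu : IsUnit lam) : IsUnit (C lam : WXYZ p) := hu.map C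

/-- Both E and the product of C with a twist of B are a column (1, λ) times a row (1, -1/λ),
suitably twisted, times a scalar: β in the first case, and in the second the pairing of (x, y, z)
with its twist, up to the factor σ^i(λ)/λ. -/
theorem blockMat_mul {κ : Type*} (hu : IsUnit lam) (m i : ℕ)
    (N : Matrix (Fin 2) κ (WXYZ p)) (c : κ) :
    (blockMat p lam m i * N) 0 c = (sigma p)^[m] (blockScalar p lam i) *
      (N 0 c - (sigma p)^[m + i] (Ring.inverse (C lam)) * N 1 c) ∧
    (blockMat p lam m i * N) 1 c = (sigma p)^[m] (C lam) * (blockMat p lam m i * N) 0 c := by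
  have hL := Ring.mul_inverse_cancel _ (isUnit_C hu)
  have hm : (sigma p)^[m] (C lam) * (sigma p)^[m] (Ring.inverse (C lam)) = 1 := by
    simp only [← RingHom.coe_pow]; rw [← map_mul, hL, map_one]
  have hmi : (sigma p)^[m + i] (C lam) * (sigma p)^[m + i] (Ring.inverse (C lam)) = 1 := by
    simp only [← RingHom.coe_pow]; rw [← map_mul, hL, map_one]
  by_cases hi : i = 0
  · subst hi
    simp only [blockMat, if_pos, blockScalar, add_zero, twE, blockE, Matrix.mul_apply,
      Fin.sum_univ_two, Matrix.map_apply, Matrix.smul_apply, smul_eq_mul, ← RingHom.coe_pow,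
      map_mul] at *
    simp only [Matrix.of_apply, Matrix.cons_val', Matrix.cons_val_zero, Matrix.cons_val_one,
      Matrix.cons_val_fin_one, map_neg, map_one]
    constructor
    · ring
    · linear_combination ((sigma p ^ m) (beta (C lam) (X 0) (X 1) (X 2)) * N 1 c) * hm
  · simp only [blockMat, if_neg hi, blockScalar, twC, blockC, twB, blockB, Matrix.mul_apply,
      Fin.sum_univ_two, Fin.sum_univ_three, Matrix.map_apply] at *
    simp only [Matrix.of_apply, Matrix.cons_val', Matrix.cons_val_zero, Matrix.cons_val_one,
      Matrix.cons_val_fin_one, Matrix.cons_val, Function.iterate_add_apply,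
      ← RingHom.coe_pow, map_mul, map_neg, map_add] at *
    generalize (sigma p ^ m) ((sigma p ^ i) (C lam)) = L' at *
    generalize (sigma p ^ m) ((sigma p ^ i) (Ring.inverse (C lam))) = l' at *
    generalize (sigma p ^ m) (C lam) = L at *
    generalize (sigma p ^ m) (Ring.inverse (C lam)) = l at *
    generalize (sigma p ^ m) ((sigma p ^ i) (Ring.inverse (2 * C lam ^ 2))) = t at *
    generalize (sigma p ^ m) ((sigma p ^ i) (X 0)) = b0 at *
    generalize (sigma p ^ m) ((sigma p ^ i) (X 1)) = b1 at *
    generalize (sigma p ^ m) ((sigma p ^ i) (X 2)) = b2 at *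
    generalize (sigma p ^ m) (X 0) = a0 at *
    generalize (sigma p ^ m) (X 1) = a1 at *
    generalize (sigma p ^ m) (X 2) = a2 at *
    constructor
    · linear_combination (l * (a0 * b1 + a1 * b0 + a2 * b2 * t) * N 1 c) * hmi
    · linear_combination (-(a0 * b1 + a1 * b0 + a2 * b2 * t) * (L' * N 0 c - N 1 c)) * hm

/-- The second row is `λ` times the first one. -/
def RowRel {κ : Type*} (lam : W p) (N : Matrix (Fin 2) κ (WXYZ p)) : Prop :=
  ∀ c, N 1 c = C lam * N 0 c

variable (hu : IsUnit lam) (hfr : WittVector.frobenius lam = -lam)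
include hfr

theorem sigma_iterate_C (n : ℕ) : (sigma p)^[n] (C lam) = (-1) ^ n * C lam := by
  induction n with
  | zero => simp
  | succ n ih =>
    rw [Function.iterate_succ_apply', ih, map_mul, map_pow, map_neg, map_one, sigma_C, hfr,
      map_neg]
    ring

theorem sigma_iterate_two_mul_C (r : ℕ) : (sigma p)^[2 * r] (C lam) = C lam := by
  rw [sigma_iterate_C hfr, pow_mul]; simp

include hu

theorem sigma_iterate_inverse (n : ℕ) :
    (sigma p)^[n] (Ring.inverse (C lam)) = (-1) ^ n * Ring.inverse (C lam) := by
  have hL := Ring.mul_inverse_cancel _ (isUnit_C hu)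
  have h := congrArg ((sigma p)^[n]) hL
  rw [← RingHom.coe_pow, map_mul, map_one, RingHom.coe_pow, sigma_iterate_C hfr] at h
  have h1 : ((-1 : WXYZ p) ^ n) * (-1) ^ n = 1 := by rw [← mul_pow]; simp
  linear_combination ((-1) ^ n * Ring.inverse (C lam)) * h -
    ((sigma p)^[n] (Ring.inverse (C lam))) * h1 -
    ((-1 : WXYZ p) ^ n * (-1) ^ n * (sigma p)^[n] (Ring.inverse (C lam))) * hL

/-- The column of a block starting at an even index is the untwisted (1, λ), because σ² fixes λ. -/
theorem rowRel_blockMat_mul {κ : Type*} (r i : ℕ) (N : Matrix (Fin 2) κ (WXYZ p)) :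
    RowRel lam (blockMat p lam (2 * r) i * N) := fun c => by
  rw [(blockMat_mul hu (2 * r) i N c).2, sigma_iterate_two_mul_C hfr]

theorem rowRel_twC (r : ℕ) : RowRel lam (twC p lam (2 * r)) := fun c => by
  have hL := Ring.mul_inverse_cancel _ (isUnit_C hu)
  have h1 : (sigma p)^[2 * r] (C lam) * (sigma p)^[2 * r] (Ring.inverse (C lam)) = 1 := by
    simp only [← RingHom.coe_pow]; rw [← map_mul, hL, map_one]
  rw [sigma_iterate_two_mul_C hfr] at h1
  have h2 : ∀ w : WXYZ p, (sigma p)^[2 * r] w =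
      C lam * (sigma p)^[2 * r] (w * Ring.inverse (C lam)) := fun w => by
    rw [← RingHom.coe_pow, map_mul, RingHom.coe_pow, mul_left_comm, h1, mul_one]
  fin_cases c <;> exact h2 _

/-- The row of the block carries σ^{2r+i} and the column of N one more twist. The extra sign from
σ(λ) = -λ turns 1 - (1/λ)·λ into 1 + 1. -/
theorem blockMat_mul_map {κ : Type*} (r i : ℕ) {N : Matrix (Fin 2) κ (WXYZ p)}
    (hN : RowRel lam N) (c : κ) :
    (blockMat p lam (2 * r) i * N.map ((sigma p)^[2 * r + i + 1])) 0 c =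
      (sigma p)^[2 * r] (blockScalar p lam i) * (2 * (sigma p)^[2 * r + i + 1] (N 0 c)) := by
  rw [(blockMat_mul hu (2 * r) i _ c).1, Matrix.map_apply, Matrix.map_apply, hN c]
  have h : (sigma p)^[2 * r + i + 1] (C lam * N 0 c) =
      (sigma p)^[2 * r + i + 1] (C lam) * (sigma p)^[2 * r + i + 1] (N 0 c) := by
    rw [← RingHom.coe_pow, map_mul]
  rw [h, sigma_iterate_C hfr, sigma_iterate_inverse hu hfr]
  have hL := Ring.mul_inverse_cancel _ (isUnit_C hu)
  have h1 : ((-1 : WXYZ p) ^ (2 * r + i)) * (-1) ^ (2 * r + i) = 1 := by rw [← mul_pow]; simp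
  rw [pow_succ]
  generalize (sigma p)^[2 * r + i + 1] (N 0 c) = n
  generalize (-1 : WXYZ p) ^ (2 * r + i) = e at *
  linear_combination ((sigma p)^[2 * r] (blockScalar p lam i) * n) * (e * e * hL + h1)

end Entries

/-- The vector `v = (1, -1/λ)` and its twists modulo `p`. -/
def vVec {k : Type*} [Field k] (p : ℕ) (l : k) (i : ℕ) (c : Fin 2) : k :=
  if c = 0 then 1 else -(l⁻¹ ^ p ^ i)

/-! ### Reduction of the blocks modulo `p`. -/

section Reduction
variable {p : ℕ} [Fact p.Prime] {lam : W p}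

theorem two_ne_zero_baseField (hp : p ≠ 2) : (2 : BaseField p) ≠ 0 :=
  Ring.two_ne_zero (by rwa [ringChar.eq (BaseField p) p])

theorem isUnit_two (hp : p ≠ 2) : IsUnit (2 : W p) := by
  refine WittVector.isUnit_of_coeff_zero_ne_zero _ ?_
  rw [← WittVector.constantCoeff_apply, map_ofNat]
  exact two_ne_zero_baseField hp

variable (hu : IsUnit lam) (hfr : WittVector.frobenius lam = -lam)

include hu in
theorem constantCoeff_ne_zero : WittVector.constantCoeff lam ≠ 0 :=
  (hu.map (WittVector.constantCoeff : W p →+* BaseField p)).ne_zero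

include hfr in
theorem constantCoeff_pow :
    WittVector.constantCoeff lam ^ p = -WittVector.constantCoeff lam := by
  rw [← map_neg, ← hfr, WittVector.constantCoeff_apply, WittVector.constantCoeff_apply,
    WittVector.coeff_frobenius_charP]

theorem modP_inverse_C {a : W p} (ha : IsUnit a) :
    modP p (Ring.inverse (C a)) = C (WittVector.constantCoeff a)⁻¹ := by
  rw [← map_ringInverse C ha, modP_C, map_ringInverse _ ha, Ring.inverse_eq_inv']

include hfr in
theorem constantCoeff_pow_pow (i : ℕ) :
    WittVector.constantCoeff lam ^ p ^ i = (-1) ^ i * WittVector.constantCoeff lam := by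
  have h := congrArg (modP p) (sigma_iterate_C hfr i)
  rw [modP_sigma_iterate, modP_C, map_mul, modP_C, map_pow, map_neg, map_one] at h
  apply C_injective (σ := Fin 3)
  rw [map_pow, h, map_mul, map_pow, map_neg, map_one]

include hu in
theorem modP_twC (r : ℕ) (c : Fin 3) :
    modP p (twC p lam (2 * r) 0 c) = (C (WittVector.constantCoeff lam)⁻¹ * X c) ^ p ^ (2 * r) := by
  have : twC p lam (2 * r) 0 c = (sigma p)^[2 * r] (X c * Ring.inverse (C lam)) := by
    fin_cases c <;> rfl
  rw [this, modP_sigma_iterate, map_mul, modP_X, modP_inverse_C hu, mul_comm]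

include hu hfr

/-- The factor σ^i(λ)/λ is the sign (-1)^i of `recCoeff`, and 1/(2λ²) is fixed by Frobenius. -/
theorem modP_blockScalar (hp : p ≠ 2) (i : ℕ) :
    modP p (blockScalar p lam i) = recCoeff p (WittVector.constantCoeff lam) i := by
  have hl0 := constantCoeff_ne_zero hu
  have h2 := isUnit_two hp
  have h4 : IsUnit (4 * lam ^ 2) := by
    rw [show (4 : W p) = 2 * 2 by norm_num]
    exact (h2.mul h2).mul (hu.pow 2)
  by_cases hi : i = 0
  · subst hi
    have : (4 * C lam ^ 2 : WXYZ p) = C (4 * lam ^ 2) := by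
      rw [map_mul, map_pow, map_ofNat]
    rw [blockScalar, if_pos rfl, recCoeff_zero, betaSeries, quadric, beta, this, map_add, map_mul,
      map_mul, modP_inverse_C h4, modP_X, modP_X, map_pow, modP_X, map_mul, map_pow, map_ofNat]
    ring
  · obtain ⟨i, rfl⟩ := Nat.exists_eq_succ_of_ne_zero hi
    have : (2 * C lam ^ 2 : WXYZ p) = C (2 * lam ^ 2) := by
      rw [map_mul, map_pow, map_ofNat]
    have e3 : modP p (Ring.inverse (2 * C lam ^ 2)) =
        C (2 * WittVector.constantCoeff lam ^ 2)⁻¹ := by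
      rw [this, modP_inverse_C (h2.mul (hu.pow 2)), map_mul, map_pow, map_ofNat]
    rw [blockScalar, if_neg hi, Nat.succ_eq_add_one, recCoeff_succ]
    simp only [map_mul, map_add, modP_sigma_iterate, modP_X, modP_C, modP_inverse_C hu, e3]
    set l := WittVector.constantCoeff lam with hl
    have e1 : (C l⁻¹ * C l ^ p ^ (i + 1) : KXYZ p) = (-1) ^ (i + 1) := by
      rw [← map_pow, ← map_mul, constantCoeff_pow_pow hfr, mul_left_comm, inv_mul_cancel₀ hl0,
        mul_one, map_pow, map_neg, map_one]
    have e2 : (C (2 * l ^ 2)⁻¹ : KXYZ p) ^ p ^ (i + 1) = C (2 * l ^ 2)⁻¹ := by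
      rw [← map_pow, inv_pow, mul_pow, ← pow_mul, mul_comm 2 (p ^ (i + 1)), pow_mul,
        constantCoeff_pow_pow hfr, mul_pow, ← pow_mul, mul_comm (i + 1) 2, pow_mul]
      have h2f : (2 : BaseField p) ^ p ^ (i + 1) = 2 := by
        simpa [iterateFrobenius_def] using map_ofNat (iterateFrobenius (BaseField p) p (i + 1)) 2
      rw [h2f, neg_one_sq, one_pow, one_mul]
    rw [e1, pairing, mul_pow, e2, pow_succ (X 2)]
    ring

variable (hp : p ≠ 2)
include hp

theorem modP_blockMat_mul_map {κ : Type*} (r i : ℕ) {N : Matrix (Fin 2) κ (WXYZ p)}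
    (hN : RowRel lam N) (c : κ) :
    modP p ((blockMat p lam (2 * r) i * N.map ((sigma p)^[2 * r + i + 1])) 0 c) =
      2 * (recCoeff p (WittVector.constantCoeff lam) i * modP p (N 0 c) ^ p ^ (i + 1)) ^
        p ^ (2 * r) := by
  rw [blockMat_mul_map hu hfr r i hN c, map_mul, map_mul, modP_sigma_iterate, modP_sigma_iterate,
    modP_blockScalar hu hfr hp, map_ofNat, mul_pow, ← pow_mul, ← pow_add,
    show i + 1 + 2 * r = 2 * r + i + 1 by ring]
  ring

theorem modP_blockMat (r i : ℕ) (c : Fin 2) :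
    modP p (blockMat p lam (2 * r) i 0 c) =
      (recCoeff p (WittVector.constantCoeff lam) i *
        C (vVec p (WittVector.constantCoeff lam) i c)) ^ p ^ (2 * r) := by
  have h := (blockMat_mul hu (2 * r) i 1 c).1
  rw [Matrix.mul_one] at h
  rw [h, map_mul, modP_sigma_iterate, modP_blockScalar hu hfr hp, mul_pow]
  congr 1
  rw [map_sub, map_mul, modP_sigma_iterate, modP_inverse_C hu, vVec]
  obtain rfl | rfl : c = 0 ∨ c = 1 := by fin_cases c <;> simp
  · simp
  · have : Odd (p ^ (2 * r)) := ((Fact.out : p.Prime).odd_of_ne_two hp).pow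
    rw [Matrix.one_apply_ne (by decide), Matrix.one_apply_eq, if_neg (by decide), map_zero,
      map_one, zero_sub, mul_one, map_neg, this.neg_pow, map_pow, ← pow_mul, ← pow_add,
      add_comm i]

end Reduction

end

/-! ### The recursion for the rows -/

section

open MvPowerSeries

section LocalFiniteness
variable (p : ℕ) [Fact p.Prime] (lam : W p)

theorem matA_mul_twC_mem_ordIdeal {I J : Finset ℕ} {j s : ℕ} (hs : s ∈ insert j (I ∪ J))
    (r : Fin 2) (c : Fin 3) :
    (matA p lam I J * twC p lam j) r c ∈ ordIdeal (Fin 3) (W p) (s + 1) := by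
  rw [Matrix.mul_apply]
  refine sum_mem fun i _ => ?_
  rcases Finset.mem_insert.mp hs with rfl | hs
  · exact Ideal.mul_mem_left _ _ (twC_mem_ordIdeal p lam s i c)
  · exact Ideal.mul_mem_right _ _ (matA_mem_ordIdeal p lam hs r i)

theorem subset_range_of_coeff_ne_zero {S : Finset ℕ} {f : WXYZ p}
    (hf : ∀ s ∈ S, f ∈ ordIdeal (Fin 3) (W p) (s + 1)) {m : Fin 3 →₀ ℕ} (hm : coeff m f ≠ 0) :
    S ⊆ Finset.range (m.degree + 1) := fun s hs => by
  rw [Finset.mem_range]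
  by_contra h
  exact hm (mem_ordIdeal.mp (hf s hs) m (by omega))

theorem finite_coeff_matA (n : ℕ) (r c : Fin 2) (m : Fin 3 →₀ ℕ) :
    {S : PairsEven n | coeff m (matA p lam S.1.1 S.1.2 r c) ≠ 0}.Finite := by
  refine ((((Finset.range (m.degree + 1)).powerset ×ˢ
    (Finset.range (m.degree + 1)).powerset).finite_toSet).preimage
      (f := fun S : PairsEven n => S.1) Subtype.val_injective.injOn).subset fun S hS => ?_
  have h := subset_range_of_coeff_ne_zero p (fun s hs => matA_mem_ordIdeal p lam hs r c) hS
  simp only [Set.mem_preimage, Finset.mem_coe, Finset.mem_product, Finset.mem_powerset]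
  exact ⟨Finset.union_subset_left h, Finset.union_subset_right h⟩

theorem finite_coeff_matA_mul_twC (n : ℕ) (r : Fin 2) (c : Fin 3) (m : Fin 3 →₀ ℕ) :
    {S : TriplesEven n |
      coeff m ((matA p lam S.1.1 S.1.2.1 * twC p lam S.1.2.2) r c) ≠ 0}.Finite := by
  refine ((((Finset.range (m.degree + 1)).powerset ×ˢ ((Finset.range (m.degree + 1)).powerset ×ˢ
    Finset.range (m.degree + 1))).finite_toSet).preimage
      (f := fun S : TriplesEven n => S.1) Subtype.val_injective.injOn).subset fun S hS => ?_
  have h := subset_range_of_coeff_ne_zero p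
    (fun s hs => matA_mul_twC_mem_ordIdeal p lam (j := S.1.2.2) hs r c) hS
  have h1 := (Finset.subset_insert _ _).trans h
  simp only [Set.mem_preimage, Finset.mem_coe, Finset.mem_product, Finset.mem_powerset]
  exact ⟨Finset.union_subset_left h1, Finset.union_subset_right h1,
    h (Finset.mem_insert_self _ _)⟩

theorem formalSum_mem_ordIdeal {ι : Type*} {f : ι → WXYZ p} {n : ℕ}
    (hf : ∀ i, f i ∈ ordIdeal (Fin 3) (W p) n) : formalSum p f ∈ ordIdeal (Fin 3) (W p) n := by
  rw [mem_ordIdeal]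
  intro m hm
  change ∑ᶠ i, coeff m (f i) = 0
  simp only [fun i => mem_ordIdeal.mp (hf i) m hm, finsum_zero]

theorem rowF_mem_ordIdeal (n : ℕ) (j : Fin 2 ⊕ Fin 3) :
    rowF p lam n j ∈ ordIdeal (Fin 3) (W p) n := by
  rcases n with _ | n
  · exact mem_ordIdeal_zero _
  refine Ideal.mul_mem_left _ _ ?_
  rcases j with c | c
  · refine formalSum_mem_ordIdeal p fun S => ?_
    obtain ⟨s, hs, hns⟩ := exists_len_le S.2.1 S.2.2.1
    exact ordIdeal_anti (by omega) (matA_mem_ordIdeal p lam hs 0 c)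
  · refine formalSum_mem_ordIdeal p fun S => ?_
    obtain ⟨-, h2, h3, -⟩ := triplesEven_iff.mp S.2
    obtain ⟨s, hs, hns⟩ := exists_len_le h2 h3
    rw [Finset.union_insert] at hs
    exact ordIdeal_anti (by omega) (matA_mul_twC_mem_ordIdeal p lam hs 0 c)

theorem modP_mem_ordIdeal {f : WXYZ p} {n : ℕ} (hf : f ∈ ordIdeal (Fin 3) (W p) n) :
    modP p f ∈ ordIdeal (Fin 3) (BaseField p) n := by
  rw [mem_ordIdeal] at hf ⊢
  intro m hm
  rw [coeff_modP, hf m hm, map_zero]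

end LocalFiniteness

section Recursion
open scoped MvPowerSeries.WithPiTopology
variable {p : ℕ} [Fact p.Prime]

/-- A term is indexed by the start 2r and the width i of the first block and by the rest. The sum
over r telescopes, and the sum over the rest gives a power of G. -/
theorem isStep_of_hasSum {k ι : Type*} [Field k] [TopologicalSpace k] [DiscreteTopology k]
    [CharP k p] {l : k} {t : ι → MvPowerSeries (Fin 3) k} {G G' : MvPowerSeries (Fin 3) k}
    (ht : HasSum t G)
    (h : HasSum (fun x : ℕ × ℕ × ι => (recCoeff p l x.2.1 * t x.2.2 ^ p ^ (x.2.1 + 1)) ^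
      p ^ (2 * x.1)) G') : IsStep p l G G' := by
  have h1 : HasSum (fun x : ℕ × ι => recCoeff p l x.1 * t x.2 ^ p ^ (x.1 + 1))
      (G' - G' ^ p ^ 2) := hasSum_sub_pow_of_hasSum_pow p h
  have h2 : ∀ i, HasSum (fun s => recCoeff p l i * t s ^ p ^ (i + 1))
      (recCoeff p l i * G ^ p ^ (i + 1)) :=
    fun i => (hasSum_pow_char_pow p ht (i + 1)).mul_left _
  exact h1.prod_fiberwise h2

variable {lam : W p}

theorem modP_inv_two_pow (hp : p ≠ 2) (n : ℕ) :
    modP p (C (Ring.inverse (2 : W p) ^ n)) = C ((2 : BaseField p)⁻¹ ^ n) := by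
  rw [modP_C, map_pow, map_ringInverse _ (isUnit_two hp), map_ofNat, Ring.inverse_eq_inv']

theorem inv_two_pow_self (i : ℕ) : (2 : BaseField p)⁻¹ ^ p ^ i = 2⁻¹ := by
  have := map_ofNat (iterateFrobenius (BaseField p) p i) 2
  rw [iterateFrobenius_def] at this
  rw [inv_pow]
  congr 1

theorem inv_two_pow_pow (n i : ℕ) : ((2 : BaseField p)⁻¹ ^ n) ^ p ^ i = 2⁻¹ ^ n := by
  rw [← pow_mul, mul_comm, pow_mul, inv_two_pow_self]

/-- The terms of the first two entries of the rows. -/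
def pairTerm (lam : W p) (n : ℕ) (c : Fin 2) (I J : Finset ℕ) : KXYZ p :=
  C ((2 : BaseField p)⁻¹ ^ n) * modP p (matA p lam I J 0 c)

/-- The terms of the last three entries of the rows. -/
def tripleTerm (lam : W p) (n : ℕ) (c : Fin 3) (I J : Finset ℕ) (j : ℕ) : KXYZ p :=
  C ((2 : BaseField p)⁻¹ ^ n) * modP p ((matA p lam I J * twC p lam j) 0 c)

variable (hp : p ≠ 2) (hu : IsUnit lam) (hfr : WittVector.frobenius lam = -lam)

include hu hfr in
theorem rowRel_matA {n : ℕ} (S : Pairs (n + 1)) : RowRel lam (matA p lam S.1.1 S.1.2) := by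
  obtain ⟨⟨r, i, S⟩, rfl⟩ := (prependPair_bijective n).2 S
  simp only [prependPair]
  rw [matA_prepend]
  exact rowRel_blockMat_mul hu hfr r i _

theorem matA_mul_twC_prepend (m i : ℕ) (I J : Finset ℕ) (j : ℕ) :
    matA p lam (prepend m i (blockI m i) I) (prepend m i (blockJ m i) J) *
      twC p lam (j + (m + i + 1)) =
    blockMat p lam m i * (matA p lam I J * twC p lam j).map ((sigma p)^[m + i + 1]) := by
  have h : twC p lam (j + (m + i + 1)) = (twC p lam j).map ((sigma p)^[m + i + 1]) :=
    tw_add p _ _ _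
  rw [matA_prepend, h, Matrix.mul_assoc]
  congr 1
  have := Matrix.map_mul (f := sigma p ^ (m + i + 1)) (L := matA p lam I J) (M := twC p lam j)
  rw [RingHom.coe_pow] at this
  exact this.symm

include hu hfr in
theorem rowRel_matA_mul_twC {n : ℕ} (S : TriplesEven (n + 1)) :
    RowRel lam (matA p lam S.1.1 S.1.2.1 * twC p lam S.1.2.2) := by
  rcases n with _ | n
  · obtain ⟨r, rfl⟩ := singleTriple_bijective.2 S
    simp only [singleTriple]
    rw [matA_empty, Matrix.one_mul]
    exact rowRel_twC hu hfr r
  · obtain ⟨⟨r, i, S⟩, rfl⟩ := (prependTriple_bijective n).2 S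
    simp only [prependTriple]
    rw [matA_mul_twC_prepend]
    exact rowRel_blockMat_mul hu hfr r i _

-- The 2 from the meeting of two blocks uses up one factor 1/2; the remaining power of 1/2 lies in
-- the prime field and passes through all p-powers.
include hp hu hfr in
theorem half_pow_mul_modP_blockMat {κ : Type*} (n r i : ℕ) {N : Matrix (Fin 2) κ (WXYZ p)}
    (hN : RowRel lam N) (c : κ) :
    C ((2 : BaseField p)⁻¹ ^ (n + 1)) *
      modP p ((blockMat p lam (2 * r) i * N.map ((sigma p)^[2 * r + i + 1])) 0 c) =
    (recCoeff p (WittVector.constantCoeff lam) i *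
      (C ((2 : BaseField p)⁻¹ ^ n) * modP p (N 0 c)) ^ p ^ (i + 1)) ^ p ^ (2 * r) := by
  rw [modP_blockMat_mul_map hu hfr hp r i hN c]
  have h2 : (C ((2 : BaseField p)⁻¹ ^ (n + 1)) * 2 : KXYZ p) = C ((2 : BaseField p)⁻¹ ^ n) := by
    rw [← map_ofNat (C (σ := Fin 3) (R := BaseField p)) 2, ← map_mul, pow_succ, mul_assoc,
      inv_mul_cancel₀ (two_ne_zero_baseField hp), mul_one]
  rw [← mul_assoc, h2, mul_pow (C _) _ (p ^ (i + 1)), ← map_pow C, inv_two_pow_pow,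
    mul_left_comm (recCoeff _ _ _), mul_pow (C _) _ (p ^ (2 * r)), ← map_pow C, inv_two_pow_pow]

variable [TopologicalSpace (BaseField p)] [DiscreteTopology (BaseField p)]

theorem hasSum_pairTerm (hp : p ≠ 2) (n : ℕ) (c : Fin 2) :
    HasSum (fun S : Pairs (n + 1) => pairTerm lam (n + 1) c S.1.1 S.1.2)
      (modP p (rowF p lam (n + 1) (.inl c))) := by
  rw [← (pairsEquiv n).hasSum_iff, rowF, map_mul, modP_inv_two_pow hp]
  exact (hasSum_modP_formalSum p (finite_coeff_matA p lam (n + 1) 0 c)).mul_left _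

theorem hasSum_tripleTerm (hp : p ≠ 2) (n : ℕ) (c : Fin 3) :
    HasSum (fun S : TriplesEven n => tripleTerm lam n c S.1.1 S.1.2.1 S.1.2.2)
      (modP p (rowF p lam n (.inr c))) := by
  rw [rowF, map_mul, modP_inv_two_pow hp]
  exact (hasSum_modP_formalSum p (finite_coeff_matA_mul_twC p lam n 0 c)).mul_left _

include hp hu hfr

theorem isStep_rowF (n : ℕ) (j : Fin 2 ⊕ Fin 3) :
    IsStep p (WittVector.constantCoeff lam) (modP p (rowF p lam (n + 1) j))
      (modP p (rowF p lam (n + 2) j)) := by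
  rcases j with c | c
  · refine isStep_of_hasSum (hasSum_pairTerm hp n c) ?_
    have h := (Equiv.ofBijective _ (prependPair_bijective (n + 1))).hasSum_iff.mpr
      (hasSum_pairTerm (lam := lam) hp (n + 1) c)
    convert! h using 1
    funext ⟨r, i, S⟩
    simp only [Function.comp_apply, Equiv.ofBijective_apply, prependPair, pairTerm]
    rw [matA_prepend, half_pow_mul_modP_blockMat hp hu hfr (n + 1) r i (rowRel_matA hu hfr S)]
  · refine isStep_of_hasSum (hasSum_tripleTerm hp (n + 1) c) ?_
    have h := (Equiv.ofBijective _ (prependTriple_bijective n)).hasSum_iff.mpr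
      (hasSum_tripleTerm (lam := lam) hp (n + 2) c)
    convert! h using 1
    funext ⟨r, i, S⟩
    simp only [Function.comp_apply, Equiv.ofBijective_apply, prependTriple, tripleTerm]
    rw [matA_mul_twC_prepend, half_pow_mul_modP_blockMat hp hu hfr (n + 1) r i
      (rowRel_matA_mul_twC hu hfr S)]

/-- For length 1 the block is followed by the identity, which does not have the shape (1, λ). The
row (1, -1/λ) of the block therefore remains, in place of the factor 2. -/
theorem hasSum_rowF_one_inl (c : Fin 2) :
    HasSum (fun i => recCoeff p (WittVector.constantCoeff lam) i *
      C (2⁻¹ * vVec p (WittVector.constantCoeff lam) i c))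
      (modP p (rowF p lam 1 (.inl c)) - modP p (rowF p lam 1 (.inl c)) ^ p ^ 2) := by
  refine hasSum_sub_pow_of_hasSum_pow p ?_
  have h := (Equiv.ofBijective _ (prependPair_bijective 0)).hasSum_iff.mpr
      (hasSum_pairTerm (lam := lam) hp 0 c)
  have e : Function.Bijective fun x : ℕ × ℕ => (x.1, x.2, emptyPair) :=
    ⟨fun x y hxy => by simpa [Prod.ext_iff] using hxy,
      fun ⟨r, i, S⟩ => ⟨(r, i), by rw [eq_emptyPair S]⟩⟩
  have h' := (Equiv.ofBijective _ e).hasSum_iff.mpr h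
  convert! h' using 1
  funext ⟨r, i⟩
  simp only [Function.comp_apply, Equiv.ofBijective_apply, prependPair, pairTerm, emptyPair]
  rw [matA_prepend, matA_empty]
  have : (1 : Matrix (Fin 2) (Fin 2) (WXYZ p)).map ((sigma p)^[2 * r + i + 1]) = 1 := by
    rw [← RingHom.coe_pow]
    exact Matrix.map_one _ (map_zero _) (map_one _)
  rw [this, Matrix.mul_one, modP_blockMat hu hfr hp, map_mul, mul_left_comm,
    mul_pow (C _) _ (p ^ (2 * r)),
    ← map_pow C, inv_two_pow_self, zero_add, pow_one]

-- The only triples of length 1 are (∅, ∅, 2r), so the entry is the sum of the p^{2r}-th powers of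
-- x_c/(2λ), up to the 2 in 𝔽_p.
omit hfr in
theorem rowF_one_inr (c : Fin 3) :
    modP p (rowF p lam 1 (.inr c)) - modP p (rowF p lam 1 (.inr c)) ^ p ^ 2 =
      C (2⁻¹ * (WittVector.constantCoeff lam)⁻¹) * X c := by
  refine sub_pow_eq_of_hasSum p ?_
  have h := (Equiv.ofBijective _ singleTriple_bijective).hasSum_iff.mpr
      (hasSum_tripleTerm (lam := lam) hp 1 c)
  convert! h using 1
  funext r
  simp only [Function.comp_apply, Equiv.ofBijective_apply, singleTriple, tripleTerm]
  rw [matA_empty, Matrix.one_mul, modP_twC hu, map_mul, mul_assoc,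
    mul_pow (C _) _ (p ^ (2 * r)), ← map_pow C, inv_two_pow_self, pow_one]

end Recursion

end

/-! ### The series of a special endomorphism -/

section

open MvPowerSeries

section Rows
open scoped MvPowerSeries.WithPiTopology
variable {p : ℕ} [Fact p.Prime] {k : Type*} [Field k] [Algebra (ZMod p) k]

theorem algebraMap_pow_pow (a : ZMod p) (i : ℕ) :
    algebraMap (ZMod p) k a ^ p ^ i = algebraMap (ZMod p) k a := by
  rw [← map_pow, ZMod.pow_card_pow]

/-- The term of index `k` of `G¹_n`, modulo `p`, for a sequence of digits. -/
def digitTerm (g : ℕ → Fin 2 ⊕ Fin 3 → MvPowerSeries (Fin 3) k)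
    (a : Fin 2 ⊕ Fin 3 → ℕ → ZMod p) (n i : ℕ) : MvPowerSeries (Fin 3) k :=
  ∑ j, C (algebraMap (ZMod p) k (a j i)) * g (n + i) j

theorem digitTerm_shift (g : ℕ → Fin 2 ⊕ Fin 3 → MvPowerSeries (Fin 3) k)
    (a : Fin 2 ⊕ Fin 3 → ℕ → ZMod p) (n d i : ℕ) :
    digitTerm g a n (i + d) = digitTerm g (fun j i => a j (i + d)) (n + d) i := by
  simp only [digitTerm]
  rw [show n + (i + d) = n + d + i by ring]

variable [TopologicalSpace k] [DiscreteTopology k] [CharP k p]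

/-- The properties of the rows of the series modulo `p`, as a function of the length. -/
structure IsRowSystem (p : ℕ) (l : k) (g : ℕ → Fin 2 ⊕ Fin 3 → MvPowerSeries (Fin 3) k) :
    Prop where
  order : ∀ n j, g n j ∈ ordIdeal (Fin 3) k n
  step : ∀ n j, IsStep p l (g (n + 1) j) (g (n + 2) j)
  inl : ∀ c, HasSum (fun i => recCoeff p l i * C (2⁻¹ * vVec p l i c))
    (g 1 (.inl c) - g 1 (.inl c) ^ p ^ 2)
  inr : ∀ c, g 1 (.inr c) - g 1 (.inr c) ^ p ^ 2 = C (2⁻¹ * l⁻¹) * X c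

variable {l : k} {g : ℕ → Fin 2 ⊕ Fin 3 → MvPowerSeries (Fin 3) k} (hg : IsRowSystem p l g)

omit [CharP k p] in
theorem hasSum_digitTerm_shift {a : Fin 2 ⊕ Fin 3 → ℕ → ZMod p} {n : ℕ}
    {G : MvPowerSeries (Fin 3) k} (hG : HasSum (digitTerm g a n) G) (d : ℕ) :
    HasSum (digitTerm g (fun j i => a j (i + d)) (n + d))
      (G - ∑ i ∈ Finset.range d, digitTerm g a n i) := by
  have h := (hasSum_nat_add_iff' d).mpr hG
  simp only [digitTerm_shift g a n d] at h
  exact h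

include hg

omit [DiscreteTopology k] [CharP k p] in
theorem digitTerm_mem_ordIdeal (a : Fin 2 ⊕ Fin 3 → ℕ → ZMod p) (n i : ℕ) :
    digitTerm g a n i ∈ ordIdeal (Fin 3) k (n + i) :=
  sum_mem fun j _ => Ideal.mul_mem_left _ _ (hg.order _ j)

omit [DiscreteTopology k] [CharP k p] in
theorem summable_digitTerm (a : Fin 2 ⊕ Fin 3 → ℕ → ZMod p) (n : ℕ) :
    Summable (digitTerm g a n) :=
  summable_nat_of_mem_ordIdeal fun i =>
    ordIdeal_anti (by omega) (digitTerm_mem_ordIdeal hg a n i)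

omit [CharP k p] in
theorem constantCoeff_of_hasSum_digitTerm {a : Fin 2 ⊕ Fin 3 → ℕ → ZMod p} {n : ℕ}
    {G : MvPowerSeries (Fin 3) k} (hG : HasSum (digitTerm g a (n + 1)) G) :
    constantCoeff G = 0 :=
  mem_ordIdeal_one.mp (hasSum_mem_ordIdeal hG fun i =>
    ordIdeal_anti (by omega) (digitTerm_mem_ordIdeal hg a (n + 1) i))

/-- The relation is additive in both series, and elements of 𝔽_p are fixed by Frobenius; so the step
is 𝔽_p-linear. -/
theorem isStep_digitTerm (a : Fin 2 ⊕ Fin 3 → ℕ → ZMod p) (n i : ℕ) :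
    IsStep p l (digitTerm g a (n + 1) i) (digitTerm g a (n + 2) i) := by
  have h : ∀ j, HasSum (fun m => recCoeff p l m *
      (C (algebraMap (ZMod p) k (a j i)) * g (n + 1 + i) j) ^ p ^ (m + 1))
      (C (algebraMap (ZMod p) k (a j i)) * g (n + 2 + i) j -
        (C (algebraMap (ZMod p) k (a j i)) * g (n + 2 + i) j) ^ p ^ 2) := by
    intro j
    have h1 : HasSum _ _ := hg.step (n + i) j
    rw [show n + i + 1 = n + 1 + i by ring, show n + i + 2 = n + 2 + i by ring] at h1
    convert! h1.mul_left (C (algebraMap (ZMod p) k (a j i))) using 1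
    · funext m
      rw [mul_pow, ← map_pow C, algebraMap_pow_pow]
      ring
    · rw [mul_pow, ← map_pow C, algebraMap_pow_pow]
      ring
  have h2 := hasSum_sum (s := Finset.univ) fun j _ => h j
  unfold IsStep
  convert! h2 using 1
  · funext m
    rw [← Finset.mul_sum, digitTerm, sum_pow_char_pow]
  · rw [Finset.sum_sub_distrib]
    simp only [digitTerm]
    rw [sum_pow_char_pow]

/-- A double sum over digits and coefficients of the recursion, evaluated in both orders. It
converges because the order of a term grows with both indices. -/
theorem isStep_of_hasSum_digitTerm {a : Fin 2 ⊕ Fin 3 → ℕ → ZMod p} {n : ℕ}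
    {G G' : MvPowerSeries (Fin 3) k}
    (hG : HasSum (digitTerm g a (n + 1)) G) (hG' : HasSum (digitTerm g a (n + 2)) G') :
    IsStep p l G G' := by
  have hs : Summable fun x : ℕ × ℕ =>
      recCoeff p l x.1 * digitTerm g a (n + 1) x.2 ^ p ^ (x.1 + 1) := by
    refine summable_of_mem_ordIdeal (fun x => x.1 + x.2) (fun N => ?_) fun x => ?_
    · refine ((Set.finite_Iic N).prod (Set.finite_Iic N)).subset fun x hx => ?_
      simp only [Set.mem_ofPred_eq, Set.mem_prod, Set.mem_Iic] at hx ⊢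
      omega
    · refine ordIdeal_anti ?_ (mul_mem_ordIdeal (recCoeff_mem_ordIdeal p l x.1)
        (pow_mem_ordIdeal (digitTerm_mem_ordIdeal hg a (n + 1) x.2) _))
      have : 1 * (n + 1 + x.2) ≤ p ^ (x.1 + 1) * (n + 1 + x.2) :=
        Nat.mul_le_mul_right _ (Nat.one_le_pow _ _ (Fact.out : p.Prime).pos)
      omega
  obtain ⟨T, hT⟩ := hs
  have h0 : ∀ i, HasSum (fun m => recCoeff p l i * digitTerm g a (n + 1) m ^ p ^ (i + 1))
      (recCoeff p l i * G ^ p ^ (i + 1)) :=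
    fun i => (hasSum_pow_char_pow p hG (i + 1)).mul_left _
  have h1 : HasSum (fun i => recCoeff p l i * G ^ p ^ (i + 1)) T := hT.prod_fiberwise h0
  have hT' : HasSum (fun x : ℕ × ℕ =>
      recCoeff p l x.2 * digitTerm g a (n + 1) x.1 ^ p ^ (x.2 + 1)) T :=
    (Equiv.prodComm ℕ ℕ).hasSum_iff.mpr hT
  have h2 := hT'.prod_fiberwise fun i => isStep_digitTerm hg a n i
  rw [h2.unique (hG'.sub (hasSum_pow_char_pow p hG' 2))] at h1
  exact h1

-- Frobenius fixes a and b and changes the sign of 1/l; subtracting the conjugate equation isolates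
-- twice the second term.
omit hg [TopologicalSpace k] [DiscreteTopology k] in
theorem eq_zero_of_add_mul_eq_zero (hp : p ≠ 2) (hlp : l ^ p = -l) {a b : ZMod p}
    (h : algebraMap (ZMod p) k a + algebraMap (ZMod p) k b * l⁻¹ = 0) :
    algebraMap (ZMod p) k b * l⁻¹ = 0 := by
  have h1 : (algebraMap (ZMod p) k a + algebraMap (ZMod p) k b * l⁻¹) ^ p ^ 1 = 0 ^ p ^ 1 := by
    rw [h]
  rw [add_pow_char_pow, mul_pow, algebraMap_pow_pow, algebraMap_pow_pow, pow_one, inv_pow, hlp,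
    zero_pow (Fact.out : p.Prime).ne_zero, inv_neg] at h1
  have h2 : (2 : k) ≠ 0 := Ring.two_ne_zero (by rwa [ringChar.eq k p])
  have h3 : 2 * (algebraMap (ZMod p) k b * l⁻¹) = 0 := by
    linear_combination h - h1
  exact (mul_eq_zero.mp h3).resolve_left h2

variable (hp : p ≠ 2) (hl0 : l ≠ 0) (hlp : l ^ p = -l)
include hp hl0 hlp

/-- The leading digits enter through the explicit series of length 1 and the later ones through a
series G₂ of length 2, itself one step above G₁. A nonzero digit at ω₃, ω₄, ω₅ gives a linear form;
otherwise the digits at ω₁, ω₂ give a constant term, nonzero because 1 and 1/λ are independent over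
𝔽_p. -/
theorem not_beta_dvd_of_digit_ne_zero {a : Fin 2 ⊕ Fin 3 → ℕ → ZMod p} {j₀ : Fin 2 ⊕ Fin 3}
    (ha : a j₀ 0 ≠ 0) {G : MvPowerSeries (Fin 3) k} (hG : HasSum (digitTerm g a 1) G) :
    ¬ betaSeries l ∣ G := by
  obtain ⟨G₁, hG₁⟩ := summable_digitTerm hg (fun j i => a j (i + 1)) 1
  obtain ⟨G₂, hG₂⟩ := summable_digitTerm hg (fun j i => a j (i + 1)) 2
  have hstep : HasSum _ _ := isStep_of_hasSum_digitTerm hg (n := 0) hG₁ hG₂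
  have hsplit : G = digitTerm g a 1 0 + G₂ := by
    rw [← sub_eq_iff_eq_add', ← Finset.sum_range_one (digitTerm g a 1)]
    exact (hasSum_digitTerm_shift hG 1).unique hG₂
  let b : Fin 2 ⊕ Fin 3 → k := fun j => algebraMap (ZMod p) k (a j 0)
  have hb : ∀ j i, b j ^ p ^ i = b j := fun j i => algebraMap_pow_pow _ i
  have hinl : HasSum (fun i => ∑ c, C (b (.inl c)) * (recCoeff p l i * C (2⁻¹ * vVec p l i c)))
      (∑ c, C (b (.inl c)) * (g 1 (.inl c) - g 1 (.inl c) ^ p ^ 2)) :=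
    hasSum_sum fun c _ => (hg.inl c).mul_left _
  -- κ collects the linear parts of the last three entries. H_i joins the twisted row (1, -1/λ) of
  -- the first two with the power of G₁ from the step to G₂.
  refine not_beta_dvd_of_hasSum hp hl0 hlp (fun c => b (.inr c) * (2⁻¹ * l⁻¹))
    (H := fun i => ∑ c, C (b (.inl c) * (2⁻¹ * vVec p l i c)) + G₁ ^ p ^ (i + 1))
    (S := ∑ c, C (b (.inl c)) * (g 1 (.inl c) - g 1 (.inl c) ^ p ^ 2) + (G₂ - G₂ ^ p ^ 2))
    ?_ ?_ ?_
  · convert! hinl.add hstep using 1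
    funext i
    rw [mul_add, Finset.mul_sum]
    congr 1
    refine Finset.sum_congr rfl fun c _ => ?_
    rw [map_mul, mul_left_comm]
  · have h0 : digitTerm g a 1 0 = ∑ c, C (b (.inl c)) * g 1 (.inl c) +
        ∑ c, C (b (.inr c)) * g 1 (.inr c) := by
      rw [digitTerm, Fintype.sum_sum_type]
    have e1 : ∀ j, (C (b j) * g 1 j) ^ p ^ 2 = C (b j) * g 1 j ^ p ^ 2 := fun j => by
      rw [mul_pow, ← map_pow C, hb]
    have e2 : ∀ c, C (b (.inr c) * (2⁻¹ * l⁻¹)) * X c =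
        C (b (.inr c)) * g 1 (.inr c) - C (b (.inr c)) * g 1 (.inr c) ^ p ^ 2 := fun c => by
      rw [map_mul, mul_assoc, ← hg.inr c, mul_sub]
    rw [hsplit, h0, add_pow_char_pow, add_pow_char_pow, sum_pow_char_pow, sum_pow_char_pow]
    simp only [e1, e2, mul_sub, Finset.sum_sub_distrib]
    ring
  · by_cases hκ : ∃ c, b (.inr c) * (2⁻¹ * l⁻¹) ≠ 0
    · exact .inl hκ
    · push Not at hκ
      right
      have h2 : (2⁻¹ : k) ≠ 0 := inv_ne_zero (Ring.two_ne_zero (by rwa [ringChar.eq k p]))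
      have hbr : ∀ c, b (.inr c) = 0 := fun c =>
        (mul_eq_zero.mp (hκ c)).resolve_right (mul_ne_zero h2 (inv_ne_zero hl0))
      have hG₁0 : constantCoeff G₁ = 0 := constantCoeff_of_hasSum_digitTerm hg hG₁
      intro h
      -- At i = 1 the twist is λ^p = -λ, so the constant term is half of b_1 + b_2/λ, for the digits
      -- b_1, b_2 at ω₁, ω₂.
      rw [map_add, map_pow, hG₁0, zero_pow (pow_pos (Fact.out : p.Prime).pos _).ne', add_zero,
        map_sum, Fin.sum_univ_two, constantCoeff_C, constantCoeff_C, vVec, vVec, if_pos rfl,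
        if_neg (by decide), inv_pow, pow_one, hlp, inv_neg, neg_neg] at h
      have h3 : b (.inl 0) + b (.inl 1) * l⁻¹ = 0 := by
        have : 2⁻¹ * (b (.inl 0) + b (.inl 1) * l⁻¹) = 0 := by linear_combination h
        exact (mul_eq_zero.mp this).resolve_left h2
      have h4 := eq_zero_of_add_mul_eq_zero hp hlp h3
      have h5 : b (.inl 1) = 0 := (mul_eq_zero.mp h4).resolve_right (inv_ne_zero hl0)
      have h6 : b (.inl 0) = 0 := by rwa [h5, zero_mul, add_zero] at h3
      have h7 : b j₀ = 0 := by
        rcases j₀ with c | c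
        · obtain rfl | rfl : c = 0 ∨ c = 1 := by fin_cases c <;> simp
          · exact h6
          · exact h5
        · exact hbr c
      exact ha ((map_eq_zero_iff _ (algebraMap (ZMod p) k).injective).mp h7)

theorem not_beta_dvd_of_hasSum_digitTerm {a : Fin 2 ⊕ Fin 3 → ℕ → ZMod p} {j₀ : Fin 2 ⊕ Fin 3}
    (ha : a j₀ 0 ≠ 0) (n : ℕ) {G : MvPowerSeries (Fin 3) k}
    (hG : HasSum (digitTerm g a (n + 1)) G) : ¬ betaSeries l ∣ G := by
  induction n generalizing G with
  | zero => exact not_beta_dvd_of_digit_ne_zero hg hp hl0 hlp ha hG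
  | succ n ih =>
    obtain ⟨G₁, hG₁⟩ := summable_digitTerm hg a (n + 1)
    exact (isStep_of_hasSum_digitTerm hg hG₁ hG).not_beta_dvd
      (constantCoeff_of_hasSum_digitTerm hg hG) hp hl0
      (constantCoeff_of_hasSum_digitTerm hg hG₁) hlp (ih hG₁)

/-- Initial zero digits of all coordinates only raise the length, by the index of the first nonzero
digit. -/
theorem not_beta_dvd_of_exists_digit_ne_zero {a : Fin 2 ⊕ Fin 3 → ℕ → ZMod p}
    (ha : ∃ i, ∃ j, a j i ≠ 0) (n : ℕ) {G : MvPowerSeries (Fin 3) k}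
    (hG : HasSum (digitTerm g a (n + 1)) G) : ¬ betaSeries l ∣ G := by
  classical
  obtain ⟨j₀, hj₀⟩ := Nat.find_spec ha
  have h := hasSum_digitTerm_shift hG (Nat.find ha)
  rw [Finset.sum_eq_zero, sub_zero] at h
  · rw [show n + 1 + Nat.find ha = n + Nat.find ha + 1 by ring] at h
    exact not_beta_dvd_of_hasSum_digitTerm hg hp hl0 hlp (j₀ := j₀) (by rwa [zero_add]) _ h
  · intro i hi
    have hmin : ∀ j, a j i = 0 := fun j => by
      by_contra h
      exact Nat.find_min ha (Finset.mem_range.mp hi) ⟨j, h⟩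
    simp [digitTerm, hmin]

end Rows

/-! ### The `p`-adic digits of a special endomorphism. -/

section Digits
open scoped MvPowerSeries.WithPiTopology
variable {p : ℕ} [Fact p.Prime] (lam : W p)

/-- The digits of a `p`-adic integer, as elements of `𝔽_p`. -/
def residueDigit (a : ℤ_[p]) (k : ℕ) : ZMod p := ((WittVector.equiv p).symm a).coeff k

theorem residueDigit_p_mul_zero (a : ℤ_[p]) : residueDigit ((p : ℤ_[p]) * a) 0 = 0 := by
  rw [residueDigit, map_mul, map_natCast, mul_comm, WittVector.mul_charP_coeff_zero]

theorem residueDigit_p_mul_succ (a : ℤ_[p]) (k : ℕ) :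
    residueDigit ((p : ℤ_[p]) * a) (k + 1) = residueDigit a k := by
  rw [residueDigit, map_mul, map_natCast, mul_comm, WittVector.mul_charP_coeff_succ,
    ZMod.pow_card, residueDigit]

theorem exists_residueDigit_ne_zero {a : ℤ_[p]} (ha : a ≠ 0) : ∃ k, residueDigit a k ≠ 0 := by
  by_contra! h
  apply ha
  rw [← (WittVector.equiv p).symm.map_eq_zero_iff]
  ext k
  rw [WittVector.zero_coeff]
  exact h k

variable [TopologicalSpace (BaseField p)] [DiscreteTopology (BaseField p)]

theorem hasSum_seriesG (n : ℕ) (ω : Fin 2 ⊕ Fin 3 → ℤ_[p]) :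
    HasSum (digitTerm (fun n j => modP p (rowF p lam n j)) (fun j i => residueDigit (ω j) i) n)
      (modP p (seriesG p lam n ω)) := by
  unfold digitTerm
  rw [seriesG, map_sum]
  refine hasSum_sum fun j _ => ?_
  have h := hasSum_modP_formalSum p
    (f := fun k : ℕ => C (digit p (ω j) k) * rowF p lam (n + k) j)
    (finite_coeff_of_mem_ordIdeal id (fun n => Set.finite_Iic n) fun k =>
      Ideal.mul_mem_left _ _ (ordIdeal_anti (Nat.le_add_left k n) (rowF_mem_ordIdeal p lam _ j)))
  convert! h using 1
  funext k
  rw [map_mul, modP_C, digit, WittVector.constantCoeff_apply, WittVector.teichmuller_coeff_zero]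
  rfl

/-- The digits of p a are those of a moved up by one place, with 0 in front; moving digits is the
same as raising the length. -/
theorem modP_seriesG_p_smul (n : ℕ) (ω : Fin 2 ⊕ Fin 3 → ℤ_[p]) :
    modP p (seriesG p lam n ((p : ℤ_[p]) • ω)) = modP p (seriesG p lam (n + 1) ω) := by
  have h := hasSum_digitTerm_shift (hasSum_seriesG lam n ((p : ℤ_[p]) • ω)) 1
  have h0 : digitTerm (fun n j => modP p (rowF p lam n j))
      (fun j k => residueDigit (((p : ℤ_[p]) • ω) j) k) n 0 = 0 := by
    simp [digitTerm, residueDigit_p_mul_zero]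
  rw [Finset.sum_range_one, h0, sub_zero] at h
  simp only [Pi.smul_apply, smul_eq_mul, residueDigit_p_mul_succ] at h
  exact h.unique (hasSum_seriesG lam (n + 1) ω)

variable {lam} (hp : p ≠ 2) (hu : IsUnit lam) (hfr : WittVector.frobenius lam = -lam)
include hp hu hfr

theorem isRowSystem_rowF : IsRowSystem p (WittVector.constantCoeff lam)
    (fun n j => modP p (rowF p lam n j)) where
  order n j := modP_mem_ordIdeal p (rowF_mem_ordIdeal p lam n j)
  step n j := isStep_rowF hp hu hfr n j
  inl c := hasSum_rowF_one_inl hp hu hfr c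
  inr c := rowF_one_inr hp hu c

theorem isStep_seriesG (n : ℕ) (ω : Fin 2 ⊕ Fin 3 → ℤ_[p]) :
    IsStep p (WittVector.constantCoeff lam) (modP p (seriesG p lam (n + 1) ω))
      (modP p (seriesG p lam (n + 2) ω)) :=
  isStep_of_hasSum_digitTerm (isRowSystem_rowF hp hu hfr)
    (hasSum_seriesG lam (n + 1) ω) (hasSum_seriesG lam (n + 2) ω)

theorem constantCoeff_modP_seriesG (n : ℕ) (ω : Fin 2 ⊕ Fin 3 → ℤ_[p]) :
    constantCoeff (modP p (seriesG p lam (n + 1) ω)) = 0 :=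
  constantCoeff_of_hasSum_digitTerm (isRowSystem_rowF hp hu hfr) (hasSum_seriesG lam (n + 1) ω)

theorem not_beta_dvd_seriesG {ω : Fin 2 ⊕ Fin 3 → ℤ_[p]} (hω : ω ≠ 0) (n : ℕ) :
    ¬ betaSeries (WittVector.constantCoeff lam) ∣ modP p (seriesG p lam (n + 1) ω) := by
  refine not_beta_dvd_of_exists_digit_ne_zero (isRowSystem_rowF hp hu hfr) hp
    (constantCoeff_ne_zero hu) (constantCoeff_pow hfr) ?_ n (hasSum_seriesG lam (n + 1) ω)
  obtain ⟨j, hj⟩ := Function.ne_iff.mp hω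
  obtain ⟨k, hk⟩ := exists_residueDigit_ne_zero hj
  exact ⟨k, j, hk⟩

end Digits

end

/-! ### Slopes of the Frobenius matrix -/

section

section Entries
variable {A : Type*} [CommRing A]

/-- The matrix of `p` times the Frobenius, in terms of the vectors whose products are its blocks:
`i` and `h` stand for the inverses of `L` and `2`. -/
structure IsFrobMatrix (p : ℕ) (L i h b : A) (x w : Fin 3 → A)
    (T : Matrix (Fin 2 ⊕ Fin 3) (Fin 2 ⊕ Fin 3) A) : Prop where
  mul_inv : L * i = 1
  two_mul : 2 * h = 1
  dot : ∑ c, x c * w c = 2 * b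
  inl_inl : ∀ a c, T (.inl a) (.inl c) = (if a = c then (p : A) else 0) +
    h * b * ((![1, L] : Fin 2 → A) a * (![1, -i] : Fin 2 → A) c)
  inl_inr : ∀ a c, T (.inl a) (.inr c) = h * i * ((![1, L] : Fin 2 → A) a * x c)
  inr_inl : ∀ a c, T (.inr a) (.inl c) = p * (L * (w a * (![1, -i] : Fin 2 → A) c))
  inr_inr : ∀ a c, T (.inr a) (.inr c) = if a = c then (p : A) else 0

theorem isFrobMatrix_frobMatrix {L : A} (hL : IsUnit L) (h2 : IsUnit (2 : A)) (x y z : A) (p : ℕ) :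
    IsFrobMatrix p L (Ring.inverse L) (Ring.inverse 2) (beta L x y z) ![x, y, z]
      ![y, x, Ring.inverse (2 * L ^ 2) * z] (frobMatrix L x y z p) := by
  have h2' := Ring.mul_inverse_cancel _ h2
  have hL' := Ring.mul_inverse_cancel _ hL
  have e2 : Ring.inverse (2 * L ^ 2) = Ring.inverse 2 * Ring.inverse L ^ 2 := by
    rw [Ring.inverse_mul (.inl h2), Ring.inverse_pow, mul_comm]
  have e4 : Ring.inverse (4 * L ^ 2) = Ring.inverse 2 ^ 2 * Ring.inverse L ^ 2 := by
    rw [show (4 : A) = 2 ^ 2 by norm_num, Ring.inverse_mul (.inl (h2.pow 2)), Ring.inverse_pow,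
      Ring.inverse_pow, mul_comm]
  refine ⟨hL', h2', ?_, ?_, ?_, ?_, ?_⟩
  · rw [Fin.sum_univ_three, beta, e2, e4]
    simp only [Matrix.cons_val_zero, Matrix.cons_val_one, Matrix.cons_val]
    linear_combination (-Ring.inverse 2 * Ring.inverse L ^ 2 * z ^ 2) * h2'
  · intro a c
    fin_cases a <;> fin_cases c <;> simp [frobMatrix, blockE] <;>
      first | ring1 | linear_combination (-Ring.inverse 2 * beta L x y z) * hL'
  · intro a c
    fin_cases a <;> fin_cases c <;> simp [frobMatrix, blockC]
    · ring
    · ring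
    · ring
    · linear_combination (-Ring.inverse 2 * x) * hL'
    · linear_combination (-Ring.inverse 2 * y) * hL'
    · linear_combination (-Ring.inverse 2 * z) * hL'
  · intro a c
    fin_cases a <;> fin_cases c <;> simp [frobMatrix, blockB]
    · linear_combination (-p * y) * hL'
    · linear_combination (-p * x) * hL'
    · ring
    · linear_combination (-p * Ring.inverse (2 * L ^ 2) * z) * hL'
  · intro a c
    fin_cases a <;> fin_cases c <;> simp [frobMatrix]

end Entries

section Column

/-- The iterates of a matrix that is block upper triangular with a block of rank one have a nonzero
entry as long as the vector spanning the image of the block is not in the kernel of its twist. -/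
theorem iterate_entry_ne_zero {Ω : Type*} [Field Ω] {q : ℕ} (hq : q ≠ 0) {g l s : Ω}
    (G : ℕ → Matrix (Fin 2 ⊕ Fin 3) (Fin 2 ⊕ Fin 3) Ω)
    (t : Matrix (Fin 2 ⊕ Fin 3) (Fin 2 ⊕ Fin 3) Ω)
    (h0 : G 0 = 1) (hG : ∀ n, G (n + 1) = t * (G n).map (· ^ q)) (hg : g ≠ 0)
    (hs : 1 + s * l ^ q ≠ 0)
    (h1 : ∀ a c, t (.inl a) (.inl c) = g * ((![1, l] : Fin 2 → Ω) a * (![1, s] : Fin 2 → Ω) c))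
    (h2 : ∀ a c, t (.inr a) (.inl c) = 0) (n : ℕ) : G (n + 1) (.inl 0) (.inl 0) ≠ 0 := by
  -- The invariant is the row (1, s) applied to the q-th powers of the first column. One step
  -- multiplies it by g, raises it to the q-th power and multiplies it by 1 + s l^q.
  have key : ∀ n, G n (.inl 0) (.inl 0) ^ q + s * G n (.inl 1) (.inl 0) ^ q ≠ 0 ∧
      ∀ a, G n (.inr a) (.inl 0) = 0 := by
    have hstep : ∀ n, (∀ a, G n (.inr a) (.inl 0) = 0) → ∀ j, G (n + 1) j (.inl 0) =
        t j (.inl 0) * G n (.inl 0) (.inl 0) ^ q + t j (.inl 1) * G n (.inl 1) (.inl 0) ^ q := by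
      intro n hn j
      rw [hG, Matrix.mul_apply, Fintype.sum_sum_type, Fin.sum_univ_two]
      simp [hn, hq]
    intro n
    induction n with
    | zero => simp [h0, hq]
    | succ n ih =>
      refine ⟨?_, fun a => by rw [hstep n ih.2, h2, h2, zero_mul, zero_mul, add_zero]⟩
      rw [hstep n ih.2, hstep n ih.2, h1, h1, h1, h1]
      have : (g * (G n (.inl 0) (.inl 0) ^ q + s * G n (.inl 1) (.inl 0) ^ q)) ^ q *
          (1 + s * l ^ q) ≠ 0 :=
        mul_ne_zero (pow_ne_zero _ (mul_ne_zero hg ih.1)) hs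
      convert! this using 1
      simp only [Matrix.cons_val_zero, Matrix.cons_val_one]
      rw [mul_add, mul_one, mul_left_comm _ s, ← mul_pow]
      congr 2 <;> ring
  rw [hG, Matrix.mul_apply, Fintype.sum_sum_type, Fin.sum_univ_two, h1, h1]
  have hk := key n
  simp only [Matrix.map_apply, hk.2, zero_pow hq, mul_zero, Finset.sum_const_zero, add_zero,
    Matrix.cons_val_zero, Matrix.cons_val_one, one_mul, mul_one]
  rw [mul_assoc, ← mul_add]
  exact mul_ne_zero hg hk.1

end Column

section Slopes
variable {p : ℕ} [Fact p.Prime] {Ω : Type*} [Field Ω]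

section Matrices
variable {L i h b : WittVector p Ω} {x w : Fin 3 → WittVector p Ω}
  {T : Matrix (Fin 2 ⊕ Fin 3) (Fin 2 ⊕ Fin 3) (WittVector p Ω)}
  (hT : IsFrobMatrix p L i h b x w T) (hL : WittVector.frobenius L = -L)

include hT hL in
theorem IsFrobMatrix.frobenius_inv : WittVector.frobenius i = -i := by
  have h1 := congrArg (WittVector.frobenius (p := p) (R := Ω)) hT.mul_inv
  rw [map_mul, map_one, hL] at h1
  linear_combination (-i) * h1 - WittVector.frobenius i * hT.mul_inv

include hT in
theorem IsFrobMatrix.frobenius_half : WittVector.frobenius h = h := by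
  have h1 := congrArg (WittVector.frobenius (p := p) (R := Ω)) hT.two_mul
  rw [map_mul, map_one, map_ofNat] at h1
  linear_combination h * h1 - WittVector.frobenius h * hT.two_mul

include hT in
theorem IsFrobMatrix.constantCoeff_half_ne_zero : WittVector.constantCoeff h ≠ 0 := by
  have h1 := congrArg (WittVector.constantCoeff (p := p) (R := Ω)) hT.two_mul
  rw [map_mul, map_one] at h1
  exact right_ne_zero_of_mul_eq_one h1

include hT in
theorem IsFrobMatrix.two_ne_zero : (2 : Ω) ≠ 0 := by
  have h1 := congrArg (WittVector.constantCoeff (p := p) (R := Ω)) hT.two_mul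
  rw [map_mul, map_one, map_ofNat] at h1
  exact left_ne_zero_of_mul_eq_one h1

include hT in
theorem IsFrobMatrix.constantCoeff_mul_inv :
    WittVector.constantCoeff L * WittVector.constantCoeff i = 1 := by
  rw [← map_mul, hT.mul_inv, map_one]

end Matrices

variable {ι : Type*} [Fintype ι] [DecidableEq ι]

theorem iterMatrix_succ' (T : Matrix ι ι (WittVector p Ω)) (n : ℕ) :
    iterMatrix p T (n + 1) = iterMatrix p T n * T.map (WittVector.frobenius^[n]) := by
  induction n with
  | zero => simp [iterMatrix]
  | succ n ih =>
    rw [iterMatrix, ih, Matrix.map_mul, ← Matrix.mul_assoc, ← iterMatrix, ih, Matrix.map_map,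
      ← Function.iterate_succ']

/-- The iterates of a matrix whose square is divisible by `p`. -/
def halfIter (S : Matrix ι ι (WittVector p Ω)) : ℕ → Matrix ι ι (WittVector p Ω)
  | 0 => 1
  | n + 1 => S * (halfIter S n).map (WittVector.frobenius ∘ WittVector.frobenius)

theorem iterMatrix_add_two {T S : Matrix ι ι (WittVector p Ω)}
    (hS : T * T.map WittVector.frobenius = (p : WittVector p Ω) • S) (n : ℕ) :
    iterMatrix p T (n + 2) =
      (p : WittVector p Ω) •
        (S * (iterMatrix p T n).map (WittVector.frobenius ∘ WittVector.frobenius)) := by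
  rw [iterMatrix, iterMatrix, Matrix.map_mul, ← Matrix.mul_assoc, hS, Matrix.smul_mul,
    Matrix.map_map]

theorem iterMatrix_two_mul {T S : Matrix ι ι (WittVector p Ω)}
    (hS : T * T.map WittVector.frobenius = (p : WittVector p Ω) • S) (n : ℕ) :
    iterMatrix p T (2 * n) = (p : WittVector p Ω) ^ n • halfIter S n := by
  induction n with
  | zero => simp [iterMatrix, halfIter]
  | succ n ih =>
    rw [mul_add, mul_one, iterMatrix_add_two hS, ih, halfIter, pow_succ', mul_smul]
    congr 1
    ext a b : 1
    simp only [Matrix.mul_apply, Matrix.map_apply, Matrix.smul_apply, smul_eq_mul, Finset.mul_sum,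
      Function.comp_apply, map_mul, map_pow, map_natCast]
    exact Finset.sum_congr rfl fun _ _ => by ring

variable [CharP Ω p]

theorem constantCoeff_frobenius (a : WittVector p Ω) :
    WittVector.constantCoeff (WittVector.frobenius a) = WittVector.constantCoeff a ^ p := by
  rw [WittVector.constantCoeff_apply, WittVector.constantCoeff_apply,
    WittVector.coeff_frobenius_charP]

theorem constantCoeff_pow_of_frobenius {L : WittVector p Ω}
    (hL : WittVector.frobenius L = -L) :
    WittVector.constantCoeff L ^ p = -WittVector.constantCoeff L := by
  rw [← constantCoeff_frobenius, hL, map_neg]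

variable [PerfectRing Ω p]

theorem p_dvd_iff {a : WittVector p Ω} :
    (p : WittVector p Ω) ∣ a ↔ WittVector.constantCoeff a = 0 := by
  rw [← Ideal.mem_span_singleton, ← WittVector.ker_constantCoeff, RingHom.mem_ker]

theorem constantCoeff_p : WittVector.constantCoeff (p : WittVector p Ω) = 0 := p_dvd_iff.mp dvd_rfl

omit [CharP Ω p] [PerfectRing Ω p] in
theorem slopesGE_half {T S : Matrix ι ι (WittVector p Ω)}
    (hS : T * T.map WittVector.frobenius = (p : WittVector p Ω) • S) : SlopesGE p T (1 / 2) := by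
  refine ⟨0, fun n => ?_⟩
  have hfl : ⌊(1 / 2 : ℚ) * n⌋₊ = n / 2 := by
    rw [one_div_mul_eq_div]
    exact Nat.floor_div_eq_div n 2
  rw [hfl, pow_zero, one_smul]
  obtain ⟨m, rfl | rfl⟩ := Nat.even_or_odd' n
  · exact ⟨_, by rw [iterMatrix_two_mul hS, Nat.mul_div_cancel_left _ two_pos]⟩
  · refine ⟨halfIter S m * T.map (WittVector.frobenius^[2 * m]), ?_⟩
    rw [iterMatrix_succ', iterMatrix_two_mul hS, Matrix.smul_mul,
      show (2 * m + 1) / 2 = m by omega]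

/-- Once ρ n exceeds c, a bound on the slopes would make the entry divisible by p. -/
theorem not_slopesGE_of_entry {T : Matrix ι ι (WittVector p Ω)} {ρ : ℚ} (hρ : 0 < ρ) (a b : ι)
    (h : ∀ n, WittVector.constantCoeff (iterMatrix p T (n + 1) a b) ≠ 0) : ¬ SlopesGE p T ρ := by
  rintro ⟨c, hc⟩
  obtain ⟨n, hn⟩ := exists_nat_gt ((c + 1 : ℚ) / ρ)
  obtain ⟨N, hN⟩ := hc (n + 1)
  have hle : c + 1 ≤ ⌊ρ * (n + 1 : ℕ)⌋₊ := by
    rw [Nat.le_floor_iff (by positivity)]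
    rw [div_lt_iff₀ hρ] at hn
    push_cast
    nlinarith
  obtain ⟨d, hd⟩ := Nat.exists_eq_add_of_le hle
  have h1 := congrFun (congrFun hN a) b
  rw [hd, Matrix.smul_apply, Matrix.smul_apply, smul_eq_mul, smul_eq_mul, add_assoc, pow_add,
    mul_assoc] at h1
  have h2 := mul_left_cancel₀ (pow_ne_zero c (WittVector.p_nonzero p Ω)) h1
  refine h n (p_dvd_iff.mp ⟨p ^ d * N a b, ?_⟩)
  rw [h2, pow_add, pow_one, mul_assoc]

theorem not_slopesGE_one_of_entry {T S : Matrix ι ι (WittVector p Ω)}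
    (hS : T * T.map WittVector.frobenius = (p : WittVector p Ω) • S) (a b : ι)
    (h : ∀ n, WittVector.constantCoeff (halfIter S (n + 1) a b) ≠ 0) : ¬ SlopesGE p T 1 := by
  rintro ⟨c, hc⟩
  -- The iterate 2(c + 1) contains exactly p^{c+1} in this entry; with p^c this is one factor p
  -- short of p^{2(c+1)}.
  obtain ⟨N, hN⟩ := hc (2 * (c + 1))
  rw [one_mul, Nat.floor_natCast, iterMatrix_two_mul hS] at hN
  have h1 := congrFun (congrFun hN a) b
  rw [Matrix.smul_apply, Matrix.smul_apply, Matrix.smul_apply, smul_eq_mul, smul_eq_mul,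
    smul_eq_mul, ← mul_assoc, ← pow_add, show 2 * (c + 1) = c + (c + 1) + 1 by ring,
    pow_succ _ (c + (c + 1)), mul_assoc] at h1
  have h2 := mul_left_cancel₀ (pow_ne_zero _ (WittVector.p_nonzero p Ω)) h1
  exact h c (p_dvd_iff.mp ⟨_, h2⟩)

variable {L i h b : WittVector p Ω} {x w : Fin 3 → WittVector p Ω}
  {T : Matrix (Fin 2 ⊕ Fin 3) (Fin 2 ⊕ Fin 3) (WittVector p Ω)}
  (hT : IsFrobMatrix p L i h b x w T) (hL : WittVector.frobenius L = -L)

-- Modulo p the lower left block vanishes and the upper left one is a nonzero multiple of (1, L)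
-- times (1, -1/L). Since L^p = -L, this row takes the value 2 on the twisted column, so the block
-- is not nilpotent under twisted iteration and the slope 0 occurs.
include hT hL in
theorem IsFrobMatrix.not_slopesGE (hb : WittVector.constantCoeff b ≠ 0) {ρ : ℚ} (hρ : 0 < ρ) :
    ¬ SlopesGE p T ρ := by
  refine not_slopesGE_of_entry hρ (.inl 0) (.inl 0) fun n => ?_
  refine iterate_entry_ne_zero (q := p) (Fact.out : p.Prime).ne_zero
    (g := WittVector.constantCoeff (h * b)) (l := WittVector.constantCoeff L)
    (s := -WittVector.constantCoeff i)
    (fun n => (iterMatrix p T n).map WittVector.constantCoeff) (T.map WittVector.constantCoeff)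
    ?_ ?_ ?_ ?_ ?_ ?_ n
  · simp [iterMatrix]
  · intro n
    simp only [iterMatrix]
    rw [Matrix.map_mul, Matrix.map_map, Matrix.map_map]
    congr 2
    funext a
    exact constantCoeff_frobenius a
  · rw [map_mul]
    exact mul_ne_zero hT.constantCoeff_half_ne_zero hb
  · rw [constantCoeff_pow_of_frobenius hL, neg_mul_neg, mul_comm, hT.constantCoeff_mul_inv,
      one_add_one_eq_two]
    exact hT.two_ne_zero
  · intro a c
    rw [Matrix.map_apply, hT.inl_inl, map_add, map_mul]
    fin_cases a <;> fin_cases c <;> simp [-WittVector.constantCoeff_apply]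
  · intro a c
    rw [Matrix.map_apply, hT.inr_inl, map_mul, constantCoeff_p, zero_mul]

include hT hL in
/-- When `β` vanishes modulo `p`, the square of the Frobenius is divisible by `p`, and its quotient
is block upper triangular modulo `p`. -/
theorem IsFrobMatrix.exists_mul_map_eq (hb : WittVector.constantCoeff b = 0) :
    ∃ S, T * T.map WittVector.frobenius = (p : WittVector p Ω) • S ∧
      (∀ a c, WittVector.constantCoeff (S (.inl a) (.inl c)) =
        -WittVector.constantCoeff (h * ∑ d, x d * WittVector.frobenius (w d)) *
          ((![1, WittVector.constantCoeff L] : Fin 2 → Ω) a *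
            (![1, WittVector.constantCoeff i] : Fin 2 → Ω) c)) ∧
      ∀ a c, WittVector.constantCoeff (S (.inr a) (.inl c)) = 0 := by
  have hp0 := WittVector.p_nonzero p Ω
  have hdvd : ∀ a c, (p : WittVector p Ω) ∣ (T * T.map WittVector.frobenius) a c := by
    have hl : ∀ a c, WittVector.constantCoeff (T (.inl a) (.inl c)) = 0 := fun a c => by
      rw [hT.inl_inl, map_add, map_mul, map_mul _ h, hb, mul_zero, zero_mul, add_zero]
      split_ifs
      · exact constantCoeff_p
      · exact map_zero _
    have hr : ∀ a c, WittVector.constantCoeff (T (.inr a) c) = 0 := by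
      rintro a (c | c)
      · rw [hT.inr_inl, map_mul, constantCoeff_p, zero_mul]
      · rw [hT.inr_inr]
        split_ifs
        · exact constantCoeff_p
        · exact map_zero _
    intro a c
    rw [p_dvd_iff, Matrix.mul_apply, map_sum]
    refine Finset.sum_eq_zero fun d _ => ?_
    rw [map_mul, Matrix.map_apply, constantCoeff_frobenius]
    rcases a with a | a
    · rcases d with d | d
      · rw [hl, zero_mul]
      · rw [hr, zero_pow (Fact.out : p.Prime).ne_zero, mul_zero]
    · rw [hr, zero_mul]
  choose S hS using hdvd
  have hS' : T * T.map WittVector.frobenius = (p : WittVector p Ω) • Matrix.of S := by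
    ext a c : 1
    exact hS a c
  obtain ⟨b', rfl⟩ := p_dvd_iff.mpr hb
  have hi := hT.frobenius_inv hL
  have hh := hT.frobenius_half
  have hll : ∀ a c, T (.inl a) (.inl c) = p * ((if a = c then 1 else 0) +
      h * b' * ((![1, L] : Fin 2 → WittVector p Ω) a * (![1, -i] : Fin 2 → WittVector p Ω) c)) := by
    intro a c
    rw [hT.inl_inl]
    split_ifs <;> ring
  refine ⟨Matrix.of S, hS', fun a c => ?_, fun a c => ?_⟩
  -- With p dividing β the upper left block is a multiple of p, so its own product contains p².
  -- After division by p only C times the twist of B survives; σ(L) = -L gives the minus sign and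
  -- turns the row (1, -1/L) into (1, 1/L).
  · obtain ⟨r, hr⟩ : ∃ r, S (.inl a) (.inl c) = p * r -
        h * (∑ d, x d * WittVector.frobenius (w d)) * ((![1, L] : Fin 2 → WittVector p Ω) a *
          (![1, i] : Fin 2 → WittVector p Ω) c) := by
      refine ⟨∑ d, ((if a = d then 1 else 0) +
        h * b' * ((![1, L] : Fin 2 → WittVector p Ω) a * (![1, -i] : Fin 2 → WittVector p Ω) d)) *
        WittVector.frobenius ((if d = c then 1 else 0) +
          h * b' * ((![1, L] : Fin 2 → WittVector p Ω) d * (![1, -i] : Fin 2 → WittVector p Ω) c)),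
        mul_left_cancel₀ hp0 ?_⟩
      rw [← hS, Matrix.mul_apply, Fintype.sum_sum_type, mul_sub]
      simp only [Matrix.map_apply, hll, hT.inl_inr, hT.inr_inl, map_mul, map_natCast]
      rw [sub_eq_add_neg, Finset.mul_sum, Finset.mul_sum]
      congr 1
      · exact Finset.sum_congr rfl fun d _ => by ring
      · rw [Finset.mul_sum, Finset.sum_mul, Finset.mul_sum, ← Finset.sum_neg_distrib]
        refine Finset.sum_congr rfl fun d _ => ?_
        have hc : WittVector.frobenius ((![1, -i] : Fin 2 → WittVector p Ω) c) =
            (![1, i] : Fin 2 → WittVector p Ω) c := by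
          fin_cases c <;> simp [hi]
        rw [hc, hL]
        linear_combination (-(p : WittVector p Ω) * h * (![1, L] : Fin 2 → WittVector p Ω) a * x d *
          WittVector.frobenius (w d) * (![1, i] : Fin 2 → WittVector p Ω) c) * hT.mul_inv
    rw [Matrix.of_apply, hr, map_sub, map_mul, constantCoeff_p, zero_mul, zero_sub, map_mul,
      neg_mul]
    congr 2
    fin_cases a <;> fin_cases c <;> simp [-WittVector.constantCoeff_apply]
  · obtain ⟨r, hr⟩ : ∃ r, S (.inr a) (.inl c) = p * r := by
      refine ⟨∑ d, L * (w a * (![1, -i] : Fin 2 → WittVector p Ω) d) *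
        WittVector.frobenius ((if d = c then 1 else 0) +
          h * b' * ((![1, L] : Fin 2 → WittVector p Ω) d * (![1, -i] : Fin 2 → WittVector p Ω) c)) +
        ∑ d, (if a = d then 1 else 0) * WittVector.frobenius (L * (w d *
          (![1, -i] : Fin 2 → WittVector p Ω) c)),
        mul_left_cancel₀ hp0 ?_⟩
      rw [← hS, Matrix.mul_apply, Fintype.sum_sum_type]
      simp only [Matrix.map_apply, hll, hT.inr_inr, hT.inr_inl, map_mul, map_natCast]
      rw [mul_add, mul_add, Finset.mul_sum, Finset.mul_sum, Finset.mul_sum, Finset.mul_sum]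
      congr 1
      · exact Finset.sum_congr rfl fun d _ => by ring
      · refine Finset.sum_congr rfl fun d _ => ?_
        split_ifs <;> ring
    rw [Matrix.of_apply, hr, map_mul, constantCoeff_p, zero_mul]

include hT hL in
theorem IsFrobMatrix.slopesGE_half (hb : WittVector.constantCoeff b = 0) : SlopesGE p T (1 / 2) :=
  have ⟨_, hS, _⟩ := hT.exists_mul_map_eq hL hb
  Superspecial.slopesGE_half hS

-- The argument for slope 0, applied to S and σ²: now L^{p²} = L and the row is (1, 1/L), so the
-- value is again 2. The even iterates have no more than the factor p^n, and the slope 1/2 occurs.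
include hT hL in
theorem IsFrobMatrix.not_slopesGE_one (hb : WittVector.constantCoeff b = 0)
    (hw : WittVector.constantCoeff (∑ d, x d * WittVector.frobenius (w d)) ≠ 0) :
    ¬ SlopesGE p T 1 := by
  obtain ⟨S, hS, h1, h2⟩ := hT.exists_mul_map_eq hL hb
  refine not_slopesGE_one_of_entry hS (.inl 0) (.inl 0) fun n => ?_
  refine iterate_entry_ne_zero (q := p ^ 2) (pow_ne_zero _ (Fact.out : p.Prime).ne_zero)
    (fun n => (halfIter S n).map WittVector.constantCoeff) (S.map WittVector.constantCoeff)
    ?_ ?_ ?_ ?_ h1 h2 n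
  · simp [halfIter]
  · intro n
    simp only [halfIter]
    rw [Matrix.map_mul, Matrix.map_map, Matrix.map_map]
    congr 2
    funext a
    simp only [Function.comp_apply]
    rw [constantCoeff_frobenius, constantCoeff_frobenius, ← pow_mul, sq]
  · rw [map_mul, neg_ne_zero]
    exact mul_ne_zero hT.constantCoeff_half_ne_zero hw
  · rw [sq, pow_mul, constantCoeff_pow_of_frobenius hL, Odd.neg_pow,
      constantCoeff_pow_of_frobenius hL, neg_neg, mul_comm, hT.constantCoeff_mul_inv,
      one_add_one_eq_two]
    · exact hT.two_ne_zero
    · refine (Fact.out : p.Prime).odd_of_ne_two ?_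
      rintro rfl
      exact hT.two_ne_zero (CharTwo.two_eq_zero)

-- In the n-th iterate the first two columns have the factor p^n, the last three only p^{n-1}.
-- Applying B supplies one p; the missing one comes from the orthogonality of Y to the twists of w,
-- which persists because x is orthogonal to all of them modulo p.
include hT in
theorem IsFrobMatrix.exists_row (hb : WittVector.constantCoeff b = 0)
    (hw : ∀ m, WittVector.constantCoeff (∑ d, x d * WittVector.frobenius^[m] (w d)) = 0)
    (j : Fin 2 ⊕ Fin 3) (n : ℕ) : ∃ (X : Fin 2 → WittVector p Ω) (Y : Fin 3 → WittVector p Ω),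
      (∀ c, iterMatrix p T n j (.inl c) = p ^ n * X c) ∧
      (∀ c, p * iterMatrix p T n j (.inr c) = p ^ n * Y c) ∧
      ∀ m, n ≤ m → (p : WittVector p Ω) ∣ ∑ d, Y d * WittVector.frobenius^[m] (w d) := by
  obtain ⟨b', rfl⟩ := p_dvd_iff.mpr hb
  induction n with
  | zero =>
    refine ⟨fun c => (1 : Matrix (Fin 2 ⊕ Fin 3) (Fin 2 ⊕ Fin 3) (WittVector p Ω)) j (.inl c),
      fun c => p * (1 : Matrix (Fin 2 ⊕ Fin 3) (Fin 2 ⊕ Fin 3) (WittVector p Ω)) j (.inr c),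
      fun c => ?_, fun c => ?_,
      fun m _ => Finset.dvd_sum fun d _ => ?_⟩
    · rw [pow_zero, one_mul, iterMatrix]
    · rw [pow_zero, one_mul, iterMatrix]
    · rw [mul_assoc]; exact dvd_mul_right _ _
  | succ n ih =>
    obtain ⟨X, Y, hX, hY, hYw⟩ := ih
    obtain ⟨t, ht⟩ := hYw n le_rfl
    rw [iterMatrix_succ']
    simp only [← RingHom.coe_pow] at ht hYw hw ⊢
    set f : WittVector p Ω →+* WittVector p Ω := WittVector.frobenius ^ n with hf
    refine ⟨fun c => ∑ a, X a * f ((if a = c then 1 else 0) +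
        h * b' * ((![1, L] : Fin 2 → WittVector p Ω) a * (![1, -i] : Fin 2 → WittVector p Ω) c)) +
        f (L * (![1, -i] : Fin 2 → WittVector p Ω) c) * t,
      fun c => (∑ a, X a * f ((![1, L] : Fin 2 → WittVector p Ω) a)) * f (h * i) * f (x c) + Y c,
      fun c => ?_, fun c => ?_, fun m hm => ?_⟩
    · rw [Matrix.mul_apply, Fintype.sum_sum_type]
      have h1 : ∀ a, iterMatrix p T n j (.inl a) * T.map f (.inl a) (.inl c) =
          p ^ (n + 1) * (X a * f ((if a = c then 1 else 0) + h * b' *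
            ((![1, L] : Fin 2 → WittVector p Ω) a * (![1, -i] : Fin 2 → WittVector p Ω) c))) := by
        intro a
        have : T (.inl a) (.inl c) = p * ((if a = c then 1 else 0) + h * b' *
            ((![1, L] : Fin 2 → WittVector p Ω) a * (![1, -i] : Fin 2 → WittVector p Ω) c)) := by
          rw [hT.inl_inl]
          split_ifs <;> ring
        rw [Matrix.map_apply, this, hX, map_mul, map_natCast]
        ring
      have h2 : ∀ a, iterMatrix p T n j (.inr a) * T.map f (.inr a) (.inl c) =
          p ^ n * f (L * (![1, -i] : Fin 2 → WittVector p Ω) c) * (Y a * f (w a)) := by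
        intro a
        rw [Matrix.map_apply, hT.inr_inl, map_mul, map_natCast, ← mul_assoc _ (p : WittVector p Ω),
          mul_comm _ (p : WittVector p Ω), hY, mul_left_comm L, map_mul f (w a)]
        ring
      rw [Finset.sum_congr rfl fun a _ => h1 a, Finset.sum_congr rfl fun a _ => h2 a,
        ← Finset.mul_sum, ← Finset.mul_sum, ht]
      ring
    · rw [Matrix.mul_apply, Fintype.sum_sum_type]
      have h1 : ∀ a, iterMatrix p T n j (.inl a) * T.map f (.inl a) (.inr c) =
          p ^ n * f (h * i) * f (x c) * (X a * f ((![1, L] : Fin 2 → WittVector p Ω) a)) := by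
        intro a
        rw [Matrix.map_apply, hT.inl_inr, hX, map_mul, map_mul _ _ (x c)]
        ring
      have h2 : ∀ a, iterMatrix p T n j (.inr a) * T.map f (.inr a) (.inr c) =
          if a = c then p * iterMatrix p T n j (.inr c) else 0 := by
        intro a
        rw [Matrix.map_apply, hT.inr_inr]
        split_ifs with hac
        · rw [hac, map_natCast, mul_comm]
        · rw [map_zero, mul_zero]
      rw [Finset.sum_congr rfl fun a _ => h1 a, Finset.sum_congr rfl fun a _ => h2 a,
        ← Finset.mul_sum, Finset.sum_ite_eq', if_pos (Finset.mem_univ _), hY]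
      ring
    · obtain ⟨d, rfl⟩ := Nat.exists_eq_add_of_le (Nat.le_of_succ_le hm)
      have h1 : (p : WittVector p Ω) ∣ ∑ e, f (x e) * (WittVector.frobenius ^ (n + d)) (w e) := by
        have h2 := map_dvd f (p_dvd_iff.mpr (hw d))
        rw [map_natCast, map_sum] at h2
        refine h2.trans (dvd_of_eq (Finset.sum_congr rfl fun e _ => ?_))
        rw [map_mul, hf, pow_add, RingHom.mul_def, RingHom.comp_apply]
      have h3 : ∀ e, ((∑ a, X a * f ((![1, L] : Fin 2 → WittVector p Ω) a)) * f (h * i) * f (x e) +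
          Y e) * (WittVector.frobenius ^ (n + d)) (w e) =
          (∑ a, X a * f ((![1, L] : Fin 2 → WittVector p Ω) a)) * f (h * i) *
            (f (x e) * (WittVector.frobenius ^ (n + d)) (w e)) +
          Y e * (WittVector.frobenius ^ (n + d)) (w e) := fun e => by ring
      rw [Finset.sum_congr rfl fun e _ => h3 e, Finset.sum_add_distrib, ← Finset.mul_sum]
      exact dvd_add (h1.mul_left _) (hYw _ (Nat.le_add_right n d))

include hT in
theorem IsFrobMatrix.slopesGE_one (hb : WittVector.constantCoeff b = 0)
    (hw : ∀ m, WittVector.constantCoeff (∑ d, x d * WittVector.frobenius^[m] (w d)) = 0) :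
    SlopesGE p T 1 := by
  -- The constant 1 pays for the single p missing in the last three columns.
  refine ⟨1, fun n => ?_⟩
  choose X Y hX hY _ using fun j => hT.exists_row hb hw j n
  refine ⟨Matrix.of fun j => Sum.elim (fun c => p * X j c) (Y j), ?_⟩
  rw [one_mul, Nat.floor_natCast]
  ext j c : 1
  rcases c with c | c
  · rw [Matrix.smul_apply, Matrix.smul_apply, Matrix.of_apply, Sum.elim_inl, hX, smul_eq_mul,
      smul_eq_mul]
    ring
  · rw [Matrix.smul_apply, Matrix.smul_apply, Matrix.of_apply, Sum.elim_inr, smul_eq_mul,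
      smul_eq_mul, pow_one, hY]

end Slopes

end

/-! ### The Newton strata -/

section

open MvPowerSeries

section Point
variable {p : ℕ} [Fact p.Prime] {Ω : Type*} [Field Ω] {lam : W p} (g : KXYZ p →+* Ω)

/-- The Frobenius matrix at a point with values in `Ω`. -/
def pointMatrix (lam : W p) (g : KXYZ p →+* Ω) :
    Matrix (Fin 2 ⊕ Fin 3) (Fin 2 ⊕ Fin 3) (WittVector p Ω) :=
  frobMatrix (WittVector.map (g.comp C) lam) (WittVector.teichmuller p (g (X 0)))
    (WittVector.teichmuller p (g (X 1))) (WittVector.teichmuller p (g (X 2))) p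

theorem constantCoeff_map_comp_C (a : W p) :
    WittVector.constantCoeff (WittVector.map (g.comp C) a) =
      g (C (WittVector.constantCoeff a)) := by
  rw [WittVector.constantCoeff_apply, WittVector.map_coeff, RingHom.comp_apply,
    WittVector.constantCoeff_apply]

theorem constantCoeff_teichmuller (u : Ω) :
    WittVector.constantCoeff (WittVector.teichmuller p u) = u := by
  rw [WittVector.constantCoeff_apply, WittVector.teichmuller_coeff_zero]

theorem map_C_inv (a : BaseField p) : g (C a⁻¹) = (g (C a))⁻¹ :=
  map_inv₀ (g.comp C) a

theorem frobenius_map (hfr : WittVector.frobenius lam = -lam) [CharP Ω p] :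
    WittVector.frobenius (WittVector.map (g.comp C) lam) = -WittVector.map (g.comp C) lam := by
  rw [← map_neg, ← hfr]
  ext n
  rw [WittVector.coeff_frobenius_charP, WittVector.map_coeff, WittVector.map_coeff,
    WittVector.coeff_frobenius_charP, map_pow]

variable (hp : p ≠ 2) (hu : IsUnit lam)
include hp hu

theorem isFrobMatrix_pointMatrix :
    IsFrobMatrix p (WittVector.map (g.comp C) lam) (Ring.inverse (WittVector.map (g.comp C) lam))
      (Ring.inverse 2) (beta (WittVector.map (g.comp C) lam) (WittVector.teichmuller p (g (X 0)))
        (WittVector.teichmuller p (g (X 1))) (WittVector.teichmuller p (g (X 2))))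
      ![WittVector.teichmuller p (g (X 0)), WittVector.teichmuller p (g (X 1)),
        WittVector.teichmuller p (g (X 2))]
      ![WittVector.teichmuller p (g (X 1)), WittVector.teichmuller p (g (X 0)),
        Ring.inverse (2 * WittVector.map (g.comp C) lam ^ 2) *
          WittVector.teichmuller p (g (X 2))] (pointMatrix lam g) := by
  refine isFrobMatrix_frobMatrix (hu.map _) ?_ _ _ _ p
  simpa only [map_ofNat] using (isUnit_two hp).map (WittVector.map (g.comp C))

theorem constantCoeff_beta_point :
    WittVector.constantCoeff (beta (WittVector.map (g.comp C) lam)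
      (WittVector.teichmuller p (g (X 0))) (WittVector.teichmuller p (g (X 1)))
      (WittVector.teichmuller p (g (X 2)))) = g (betaSeries (WittVector.constantCoeff lam)) := by
  have h4 : IsUnit (4 * WittVector.map (g.comp C) lam ^ 2) := by
    have h2 := (isUnit_two hp).map (WittVector.map (g.comp C))
    rw [map_ofNat] at h2
    rw [show (4 : WittVector p Ω) = 2 ^ 2 by norm_num]
    exact (h2.pow 2).mul ((hu.map _).pow 2)
  rw [beta, map_add, map_mul, map_mul, map_pow, map_ringInverse _ h4, Ring.inverse_eq_inv',
    constantCoeff_teichmuller, constantCoeff_teichmuller, constantCoeff_teichmuller, map_mul,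
    map_pow, map_ofNat, constantCoeff_map_comp_C, betaSeries, quadric, map_add, map_mul, map_mul,
    map_C_inv, map_mul C, map_ofNat C, map_pow C, map_mul g, map_ofNat g, map_pow g, map_pow g,
    mul_comm (g (X 2) ^ 2)]

variable [CharP Ω p] (hfr : WittVector.frobenius lam = -lam)
include hfr

theorem constantCoeff_dot_point (m : ℕ) :
    WittVector.constantCoeff (∑ d, (![WittVector.teichmuller p (g (X 0)),
        WittVector.teichmuller p (g (X 1)), WittVector.teichmuller p (g (X 2))] :
          Fin 3 → WittVector p Ω) d *
      WittVector.frobenius^[m] ((![WittVector.teichmuller p (g (X 1)),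
        WittVector.teichmuller p (g (X 0)), Ring.inverse (2 * WittVector.map (g.comp C) lam ^ 2) *
          WittVector.teichmuller p (g (X 2))] : Fin 3 → WittVector p Ω) d)) =
      g (pairing p (WittVector.constantCoeff lam) m) := by
  have h2 : IsUnit (2 * WittVector.map (g.comp C) lam ^ 2) := by
    have h2 := (isUnit_two hp).map (WittVector.map (g.comp C))
    rw [map_ofNat] at h2
    exact h2.mul ((hu.map _).pow 2)
  have hfm : ∀ a : WittVector p Ω, WittVector.constantCoeff (WittVector.frobenius^[m] a) =
      WittVector.constantCoeff a ^ p ^ m := by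
    intro a
    induction m with
    | zero => simp
    | succ m ih => rw [Function.iterate_succ_apply', constantCoeff_frobenius, ih, ← pow_mul,
        pow_succ]
  have hl : (2 * WittVector.constantCoeff lam ^ 2)⁻¹ ^ p ^ m =
      (2 * WittVector.constantCoeff lam ^ 2)⁻¹ := by
    rw [inv_pow, mul_pow, pow_right_comm, constantCoeff_pow_pow hfr, mul_pow, ← pow_mul,
      mul_comm m 2, pow_mul, neg_one_sq, one_pow, one_mul]
    have h3 : (2 : BaseField p) ^ p ^ m = 2 := by
      have := algebraMap_pow_pow (k := BaseField p) (2 : ZMod p) m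
      rwa [map_ofNat] at this
    rw [h3]
  simp only [Fin.sum_univ_three, Matrix.cons_val_zero, Matrix.cons_val_one, Matrix.cons_val]
  rw [map_add, map_add, map_mul, map_mul, map_mul, hfm, hfm, hfm, map_mul, map_ringInverse _ h2,
    Ring.inverse_eq_inv', constantCoeff_teichmuller, constantCoeff_teichmuller,
    constantCoeff_teichmuller, map_mul, map_pow, map_ofNat, constantCoeff_map_comp_C, pairing,
    ← hl, map_add, map_add, map_mul, map_mul, map_mul, map_pow g, map_pow g, map_pow g, map_pow C,
    map_pow g, map_C_inv, map_mul C, map_ofNat C, map_pow C, map_mul g, map_ofNat g, map_pow g]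
  ring

variable [PerfectRing Ω p]

theorem exists_slopesGE_pointMatrix_iff :
    (∃ ρ : ℚ, 0 < ρ ∧ SlopesGE p (pointMatrix lam g) ρ) ↔
      g (betaSeries (WittVector.constantCoeff lam)) = 0 := by
  have hT := isFrobMatrix_pointMatrix g hp hu
  rw [← constantCoeff_beta_point g hp hu]
  constructor
  · rintro ⟨ρ, hρ, h⟩
    by_contra hb
    exact hT.not_slopesGE (frobenius_map g hfr) hb hρ h
  · exact fun hb => ⟨1 / 2, by norm_num, hT.slopesGE_half (frobenius_map g hfr) hb⟩

theorem slopesGE_one_pointMatrix_iff :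
    SlopesGE p (pointMatrix lam g) 1 ↔
      g (betaSeries (WittVector.constantCoeff lam)) = 0 ∧
        g (pairing p (WittVector.constantCoeff lam) 1) = 0 := by
  have hT := isFrobMatrix_pointMatrix g hp hu
  have hw := constantCoeff_dot_point g hp hu hfr
  rw [← constantCoeff_beta_point g hp hu, ← hw]
  constructor
  · intro h
    have hb := not_imp_not.mp (fun hb => hT.not_slopesGE (frobenius_map g hfr) hb one_pos) h
    exact ⟨hb, not_imp_not.mp (fun h1 => hT.not_slopesGE_one (frobenius_map g hfr) hb h1) h⟩
  · rintro ⟨hb, h1⟩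
    refine hT.slopesGE_one hb fun m => ?_
    rw [hw] at h1 ⊢
    rw [constantCoeff_beta_point g hp hu] at hb
    -- Modulo β every higher pairing is a multiple of the first one, and the pairing for m = 0 is
    -- 2β. So two equations annihilate all of them.
    obtain ⟨a, -, -, r, s, hr0, -, -, hrs⟩ :=
      exists_pairing_succ_eq p hp (constantCoeff_ne_zero hu) (constantCoeff_pow hfr)
    rcases m with _ | m
    · rw [← hw, Function.iterate_zero]
      simp only [id_eq]
      rw [hT.dot, map_mul, constantCoeff_beta_point g hp hu, hb, mul_zero]
    · have ha : g a = 0 := by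
        rw [hrs 0, hr0, one_pow, mul_one, map_add, map_mul, hb, zero_mul, add_zero] at h1
        exact h1
      rw [hrs m, map_add, map_mul, map_mul, ha, hb, zero_mul, zero_mul, add_zero]

end Point

section Strata
variable {p : ℕ} [Fact p.Prime] {lam : W p}

theorem charP_geomField (q : PrimeSpectrum (KXYZ p)) : CharP (GeomField p q) p :=
  charP_of_injective_ringHom ((geomPoint p q).comp C).injective p

theorem perfectRing_geomField (q : PrimeSpectrum (KXYZ p)) :
    have := charP_geomField q
    PerfectRing (GeomField p q) p :=
  have := charP_geomField q
  PerfectField.toPerfectRing p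

theorem geomPoint_eq_zero_iff (q : PrimeSpectrum (KXYZ p)) (f : KXYZ p) :
    geomPoint p q f = 0 ↔ f ∈ q.asIdeal := by
  rw [geomPoint, RingHom.comp_apply, map_eq_zero_iff _ (RingHom.injective _),
    Ideal.algebraMap_residueField_eq_zero]

variable (hp : p ≠ 2) (hu : IsUnit lam) (hfr : WittVector.frobenius lam = -lam)
include hp hu hfr

theorem mem_nonOrdinary_iff (q : PrimeSpectrum (KXYZ p)) :
    q ∈ nonOrdinary p lam ↔ betaSeries (WittVector.constantCoeff lam) ∈ q.asIdeal := by
  have := charP_geomField q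
  have := perfectRing_geomField q
  rw [← geomPoint_eq_zero_iff, ← exists_slopesGE_pointMatrix_iff (geomPoint p q) hp hu hfr]
  rfl

theorem mem_supersingular_iff (q : PrimeSpectrum (KXYZ p)) :
    q ∈ supersingular p lam ↔ betaSeries (WittVector.constantCoeff lam) ∈ q.asIdeal ∧
      pairing p (WittVector.constantCoeff lam) 1 ∈ q.asIdeal := by
  have := charP_geomField q
  have := perfectRing_geomField q
  rw [← geomPoint_eq_zero_iff, ← geomPoint_eq_zero_iff,
    ← slopesGE_one_pointMatrix_iff (geomPoint p q) hp hu hfr]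
  rfl

end Strata

/-! ### Irreducible components. -/

section Components

/-- Zorn's lemma: the union of a chain of preirreducible subsets is preirreducible, so each point
lies in a maximal irreducible subset. -/
theorem sUnion_components {X : Type*} [TopologicalSpace X] (S : Set X) :
    ⋃₀ components S = S := by
  have hmem : ∀ C, C ∈ components S ↔ Maximal (fun T : Set X => IsIrreducible T ∧ T ⊆ S) C :=
    fun _ => Iff.rfl
  refine Set.Subset.antisymm (Set.sUnion_subset fun C hC => ((hmem C).mp hC).prop.2)
    fun x hx => ?_
  obtain ⟨M, hxM, hM⟩ := zorn_subset_nonempty {T : Set X | IsPreirreducible T ∧ T ⊆ S}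
    (fun c hc hcc _ => ⟨⋃₀ c, ⟨fun u v hu hv ⟨y, hy, hyu⟩ ⟨z, hz, hzv⟩ => by
      obtain ⟨P, hPc, hyP⟩ := hy
      obtain ⟨Q, hQc, hzQ⟩ := hz
      rcases hcc.total hPc hQc with h | h
      · obtain ⟨t, ht, htu⟩ := (hc hQc).1 u v hu hv ⟨y, h hyP, hyu⟩ ⟨z, hzQ, hzv⟩
        exact ⟨t, ⟨Q, hQc, ht⟩, htu⟩
      · obtain ⟨t, ht, htu⟩ := (hc hPc).1 u v hu hv ⟨y, hyP, hyu⟩ ⟨z, h hzQ, hzv⟩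
        exact ⟨t, ⟨P, hPc, ht⟩, htu⟩,
      Set.sUnion_subset fun T hT => (hc hT).2⟩, fun T hT => Set.subset_sUnion_of_mem hT⟩)
    {x} ⟨isPreirreducible_singleton, Set.singleton_subset_iff.mpr hx⟩
  have hmax : Maximal (fun T : Set X => IsIrreducible T ∧ T ⊆ S) M :=
    ⟨⟨⟨⟨x, hxM rfl⟩, hM.prop.1⟩, hM.prop.2⟩, fun T hT hMT => hM.2 ⟨hT.1.2, hT.2⟩ hMT⟩
  exact ⟨M, (hmem M).mpr hmax, hxM rfl⟩

end Components

/-! ### The square root of the Teichmüller lift. -/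

section Lambda
variable {p : ℕ} [Fact p.Prime] {e : ZMod p} (he : ¬ IsSquare e) {lam : W p}
  (hlam : lam ^ 2 = WittVector.teichmuller p (algebraMap (ZMod p) (BaseField p) e))
include he hlam

theorem isUnit_of_sq_eq : IsUnit lam := by
  refine WittVector.isUnit_of_coeff_zero_ne_zero _ fun h => he ?_
  have h1 := congrArg (WittVector.constantCoeff (p := p) (R := BaseField p)) hlam
  rw [map_pow, constantCoeff_teichmuller, WittVector.constantCoeff_apply, h,
    zero_pow two_ne_zero, eq_comm, map_eq_zero_iff _ (algebraMap (ZMod p) _).injective] at h1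
  exact h1 ▸ IsSquare.zero

/-- λ² is fixed by Frobenius, so λ goes to λ or -λ. In the first case its residue would lie in 𝔽_p
and be a square root of e. -/
theorem frobenius_eq_neg_of_sq_eq : WittVector.frobenius lam = -lam := by
  have h1 : WittVector.frobenius lam ^ 2 = lam ^ 2 := by
    rw [← map_pow, hlam]
    ext n
    rw [WittVector.coeff_frobenius_charP]
    rcases n with _ | n
    · rw [WittVector.teichmuller_coeff_zero, ← map_pow, ZMod.pow_card]
    · rw [WittVector.teichmuller_coeff_pos _ _ _ n.succ_pos,
        zero_pow (Fact.out : p.Prime).ne_zero]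
  refine (sq_eq_sq_iff_eq_or_eq_neg.mp h1).resolve_left fun h => he ?_
  have h2 : WittVector.constantCoeff lam ^ p = WittVector.constantCoeff lam := by
    rw [← constantCoeff_frobenius, h]
  obtain ⟨a, ha⟩ : ∃ a : ZMod p, algebraMap (ZMod p) (BaseField p) a =
      WittVector.constantCoeff lam := by
    have h3 := (Subfield.mem_bot_iff_pow_eq_self (BaseField p) p).mpr h2
    rw [← ZMod.fieldRange_castHom_eq_bot p, RingHom.mem_fieldRange] at h3
    obtain ⟨a, ha⟩ := h3
    exact ⟨a, by rw [← ha]; exact congrFun (congrArg _ (Subsingleton.elim _ _)) a⟩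
  refine ⟨a, (algebraMap (ZMod p) (BaseField p)).injective ?_⟩
  have h3 := congrArg (WittVector.constantCoeff (p := p) (R := BaseField p)) hlam
  rw [map_pow, constantCoeff_teichmuller] at h3
  rw [← h3, map_mul, ha, sq]

end Lambda

end

end Superspecial

end

/-! ### Assembly of the three assertions. -/

open Superspecial

theorem corollary3p17 (p : ℕ) [Fact p.Prime] (hp : p ≠ 2)
    (e : ZMod p) (he : ¬ IsSquare e) (lam : Superspecial.W p)
    (hlam : lam ^ 2 =
      WittVector.teichmuller p (algebraMap (ZMod p) (Superspecial.BaseField p) e))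
    (ω : Fin 2 ⊕ Fin 3 → ℤ_[p]) (hω : ω ≠ 0) :
    Superspecial.suppD p lam 1 ω ⊂ Superspecial.suppD p lam 1 ((p : ℤ_[p]) • ω) ∧
    Superspecial.suppDAO p lam 1 ω ⊆ Superspecial.suppDAO p lam 1 ((p : ℤ_[p]) • ω) ∧
    (∃ Z ⊆ Superspecial.components (Superspecial.supersingular p lam),
      Superspecial.suppDAO p lam 1 ((p : ℤ_[p]) • ω) =
        Superspecial.suppDAO p lam 1 ω ∪ ⋃₀ Z) ∧
    ∀ n : ℕ, 2 ≤ n →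
      Superspecial.suppDAO p lam n ω = Superspecial.suppDAO p lam n ((p : ℤ_[p]) • ω) ∧
      Superspecial.supersingular p lam ⊆ Superspecial.suppDAO p lam n ω := by
  -- The discrete topology serves only to treat the coefficientwise finite sums as convergent
  -- series.
  let _ : TopologicalSpace (BaseField p) := ⊥
  have : DiscreteTopology (BaseField p) := ⟨rfl⟩
  have hu := isUnit_of_sq_eq he hlam
  have hfr := frobenius_eq_neg_of_sq_eq he hlam
  have hl0 := constantCoeff_ne_zero hu
  have hlp := constantCoeff_pow hfr
  have hD : ∀ n ω q, q ∈ suppD p lam n ω ↔ modP p (seriesG p lam n ω) ∈ q.asIdeal :=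
    fun n ω q => by
      rw [suppD, PrimeSpectrum.mem_zeroLocus, Set.singleton_subset_iff, SetLike.mem_coe]
  have hno := mem_nonOrdinary_iff hp hu hfr
  have hss := mem_supersingular_iff hp hu hfr
  have hstep := fun n (q : PrimeSpectrum (KXYZ p)) =>
    (isStep_seriesG hp hu hfr n ω).mem_iff_of_beta_mem
      (constantCoeff_modP_seriesG hp hu hfr (n + 1) ω) q.asIdeal hp hl0
      (constantCoeff_modP_seriesG hp hu hfr n ω) hlp
  -- Here b stands for β = 0 and c for the vanishing of the first pairing; d, a, a' stand for the
  -- vanishing of consecutive series. In the second statement c already forces a, so a' adds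
  -- nothing.
  have logic₁ {a b c d : Prop} (h : b → (a ↔ c ∨ d)) : a ∧ b ↔ (d ∧ b) ∨ (b ∧ c) := by tauto
  have logic₂ {a a' b c d : Prop} (h : b → (a ↔ c ∨ d)) (h' : b → (a' ↔ c ∨ a)) :
      a ∧ b ↔ a' ∧ b := by tauto
  have h1 : suppD p lam 1 ω ⊂ suppD p lam 1 ((p : ℤ_[p]) • ω) := by
    rw [Set.ssubset_iff_exists]
    have h := isStep_seriesG hp hu hfr 0 ω
    have h2 := constantCoeff_modP_seriesG hp hu hfr 1 ω
    refine ⟨fun q hq => ?_, ?_⟩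
    · rw [hD] at hq ⊢
      rw [modP_seriesG_p_smul]
      exact h.mem_of_mem h2 q.asIdeal hq
    · obtain ⟨q, hq, hq'⟩ := h.exists_prime h2 hp hl0 (constantCoeff_modP_seriesG hp hu hfr 0 ω)
        (not_beta_dvd_seriesG hp hu hfr hω 0)
      refine ⟨q, ?_, ?_⟩
      · rwa [hD, modP_seriesG_p_smul]
      · rwa [hD]
  -- All components of the supersingular locus are taken: their union is the whole locus, which is
  -- exactly what the step adds on β = 0.
  refine ⟨h1, Set.inter_subset_inter_left _ h1.1, ⟨_, subset_rfl, ?_⟩, fun n hn => ?_⟩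
  · ext q
    rw [sUnion_components, suppDAO, suppDAO, Set.mem_union, Set.mem_inter_iff, Set.mem_inter_iff,
      hD, hD, hno, hss, modP_seriesG_p_smul]
    exact logic₁ (hstep 0 q)
  -- For n ≥ 2 the series of length n is itself the result of a step, so it already vanishes on the
  -- supersingular locus.
  · obtain ⟨m, rfl⟩ := Nat.exists_eq_add_of_le' hn
    constructor
    · ext q
      rw [suppDAO, suppDAO, Set.mem_inter_iff, Set.mem_inter_iff, hD, hD, hno, modP_seriesG_p_smul]
      exact logic₂ (hstep m q) (hstep (m + 1) q)
    · intro q hq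
      rw [hss] at hq
      rw [suppDAO, Set.mem_inter_iff, hD, hno]
      exact ⟨(hstep m q hq.1).mpr (.inl hq.2), hq.1⟩
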